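/- **Theorem (sampling from symmetric DPPs).** For a symmetric positive semidefinite matrix $L\in\mathbb R^{n\times n}$, $n\ge 1$, the *DPP* defined by $L$ is the probability distribution $\mu$ on subsets of $[n]$ with $\mu(S)=\det(L_{S,S})/\sum_{S'\subseteq[n]}\det(L_{S',S'})$. If $1\le k\le n$ and $\sum_{|S'|=k}\det(L_{S',S'})>0$, the *$k$-DPP* defined by $L$ is the probability distribution $\mu_k$ on the $k$-element subsets of $[n]$ with $\mu_k(S)=\det(L_{S,S})/\sum_{|S'|=k}\det(L_{S',S'})$. Algorithms are programs for a randomized PRAM: synchronous processors with a common shared memory of words (natural numbers, used for indices and control, with unit-cost addition, truncated subtraction and comparison) and of real numbers (with exact unit-cost field operations and comparison); concurrent reads are allowed, each processor writes only to cells it owns, and randomness consists of independent coins whose biases are numbers computed by the program. The parallel time is the number of synchronous unit-cost operations, and the number of machines is the largest number of processors that are used simultaneously. Say that an algorithm *samples exactly from $\nu$ with probability at least $1-\delta$* if it always halts, reports failure with probability at most $\delta$, and conditioned on not reporting failure its output has distribution exactly $\nu$. 1. There are a single PRAM program and constants $C,c\in\mathbb N$ such that for all $1\le k\le n$, all $\delta\in(0,1)$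 and all symmetric positive semidefinite $L\in\mathbb R^{n\times n}$ with $\sum_{|S|=k}\det(L_{S,S})>0$, the program with input $(n,k,L,\delta)$ samples exactly from $\mu_k$ with probability at least $1-\delta$, and on every run it takes parallel time at most $C\sqrt k\,(1+\log\frac n\delta)^c$ and uses at most $C n^c\,(1+\log\frac k\delta)$ machines. (That is, the parallel time is $\tilde O(\sqrt k)$, where $\tilde O$ hides factors polylogarithmic in $n$ and $1/\delta$, and $\mathrm{poly}(n)\cdot\log\frac k\delta$ machines are used.) 2. There are a single PRAM program and constants $C,c\in\mathbb N$ such that for all $n\ge 1$, all $\delta\in(0,1)$ and all symmetric positive semidefinite $L\in\mathbb R^{n\times n}$, the program with input $(n,L,\delta)$ samples exactly from $\mu$ with probability at least $1-\delta$, and on every run it takes parallel time at most $C\sqrt n\,(1+\log\frac n\delta)^c$ and uses at most $C n^c\,(1+\log\frac n\delta)$ machines. -/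

import Mathlib

/-! ### Determinantal point processes -/

/-- The principal minor `det L_{S,S}`, the unnormalised weight of `S`. -/
noncomputable def dppWeight {n : ℕ} (L : Matrix (Fin n) (Fin n) ℝ) (S : Finset (Fin n)) : ℝ :=
  (L.submatrix (fun i : S => (i : Fin n)) (fun i : S => (i : Fin n))).det

/-- The partition function `∑_S det L_{S,S}` of the DPP defined by `L`. -/
noncomputable def dppZ {n : ℕ} (L : Matrix (Fin n) (Fin n) ℝ) : ℝ :=
  ∑ S : Finset (Fin n), dppWeight L S

/-- The DPP defined by `L`: the probability of the set `S`. -/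
noncomputable def dppProb {n : ℕ} (L : Matrix (Fin n) (Fin n) ℝ) (S : Finset (Fin n)) : ℝ :=
  dppWeight L S / dppZ L

/-- The partition function `∑_{|S| = k} det L_{S,S}` of the `k`-DPP defined by `L`. -/
noncomputable def kdppZ {n : ℕ} (L : Matrix (Fin n) (Fin n) ℝ) (k : ℕ) : ℝ :=
  ∑ S ∈ (Finset.univ : Finset (Fin n)).powersetCard k, dppWeight L S

/-- The `k`-DPP defined by `L`: the probability of the set `S`. -/
noncomputable def kdppProb {n : ℕ} (L : Matrix (Fin n) (Fin n) ℝ) (k : ℕ)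
    (S : Finset (Fin n)) : ℝ :=
  if S.card = k then dppWeight L S / kdppZ L k else 0

/-! ### A randomised PRAM over the reals

Synchronous processors share a memory of word arrays and real arrays.  Words are natural numbers
used for indices and control, with addition, truncated subtraction and comparison only.  Reals
have exact unit-cost field operations and comparison; there is no conversion from reals to words.
Reads may be concurrent; each processor writes only to a cell that it owns (CROW).  The only
source of randomness are independent coins of prescribed bias. -/

/-- The two kinds of memory cells. -/
inductive Ty : Type
  | word
  | real

/-- Values of a cell. -/
abbrev Ty.Val : Ty → Type
  | .word => ℕ
  | .real => ℝ

/-- Expressions, evaluated by one processor; truth values are the words `0` and `1`. -/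
inductive Exp : Ty → Type
  /-- a constant word -/
  | lit (c : ℕ) : Exp .word
  /-- the `i`-th coordinate of the index of the processor that evaluates the expression -/
  | pid (i : ℕ) : Exp .word
  /-- the cell with index `idx` of the word array number `a` -/
  | wget (a : ℕ) {d : ℕ} (idx : Fin d → Exp .word) : Exp .word
  /-- the cell with index `idx` of the real array number `a` -/
  | rget (a : ℕ) {d : ℕ} (idx : Fin d → Exp .word) : Exp .real
  | wadd (x y : Exp .word) : Exp .word
  | wsub (x y : Exp .word) : Exp .word
  | wlt (x y : Exp .word) : Exp .word
  | radd (x y : Exp .real) : Exp .real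
  | rsub (x y : Exp .real) : Exp .real
  | rmul (x y : Exp .real) : Exp .real
  | rdiv (x y : Exp .real) : Exp .real
  | rlt (x y : Exp .real) : Exp .word
  /-- a word, read as a real number -/
  | ofWord (x : Exp .word) : Exp .real
  | wite (c x y : Exp .word) : Exp .word
  | rite (c : Exp .word) (x y : Exp .real) : Exp .real

/-- The number of operations of an expression, charged as its evaluation time. -/
def Exp.size : {τ : Ty} → Exp τ → ℕ
  | _, .lit _ => 1
  | _, .pid _ => 1
  | _, .wget _ idx => 1 + ∑ i, (idx i).size
  | _, .rget _ idx => 1 + ∑ i, (idx i).size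
  | _, .wadd x y => 1 + x.size + y.size
  | _, .wsub x y => 1 + x.size + y.size
  | _, .wlt x y => 1 + x.size + y.size
  | _, .radd x y => 1 + x.size + y.size
  | _, .rsub x y => 1 + x.size + y.size
  | _, .rmul x y => 1 + x.size + y.size
  | _, .rdiv x y => 1 + x.size + y.size
  | _, .rlt x y => 1 + x.size + y.size
  | _, .ofWord x => 1 + x.size
  | _, .wite c x y => 1 + c.size + x.size + y.size
  | _, .rite c x y => 1 + c.size + x.size + y.size

/-- Programs.  A parallel statement with bounds `[b₁, …, b_d]` is executed synchronously by
`b₁ ⋯ b_d` processors, indexed by the lists `[i₁, …, i_d]` with `i_j < b_j`; the processor with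
index `i` writes to the cell with index `i` of the array number `a`. -/
inductive Prog : Type
  | skip : Prog
  | seq (P Q : Prog) : Prog
  | ite (c : Exp .word) (P Q : Prog) : Prog
  | loop (c : Exp .word) (P : Prog) : Prog
  /-- each processor stores the word `e` in its cell -/
  | wset (a : ℕ) (bounds : List (Exp .word)) (e : Exp .word) : Prog
  /-- each processor stores the real `e` in its cell -/
  | rset (a : ℕ) (bounds : List (Exp .word)) (e : Exp .real) : Prog
  /-- each processor stores in its cell the result `0` or `1` of its own coin, which shows `1`
  with probability `q` -/
  | flip (a : ℕ) (bounds : List (Exp .word)) (q : Exp .real) : Prog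

/-- Contents of the shared memory, with the time that has elapsed and the largest number of
processors used in one step so far (programs cannot read the last two). -/
structure Config where
  word : ℕ → List ℕ → ℕ
  real : ℕ → List ℕ → ℝ
  time : ℕ
  procs : ℕ

/-- The value of an expression for the processor with index `p`. -/
noncomputable def Exp.eval (s : Config) (p : List ℕ) : {τ : Ty} → Exp τ → τ.Val
  | _, .lit c => c
  | _, .pid i => p.getD i 0
  | _, .wget a idx => s.word a (List.ofFn fun i => ((idx i).eval s p : ℕ))
  | _, .rget a idx => s.real a (List.ofFn fun i => ((idx i).eval s p : ℕ))
  | _, .wadd x y => ((x.eval s p : ℕ) + (y.eval s p : ℕ) : ℕ)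
  | _, .wsub x y => ((x.eval s p : ℕ) - (y.eval s p : ℕ) : ℕ)
  | _, .wlt x y => (if (x.eval s p : ℕ) < (y.eval s p : ℕ) then 1 else 0 : ℕ)
  | _, .radd x y => ((x.eval s p : ℝ) + (y.eval s p : ℝ) : ℝ)
  | _, .rsub x y => ((x.eval s p : ℝ) - (y.eval s p : ℝ) : ℝ)
  | _, .rmul x y => ((x.eval s p : ℝ) * (y.eval s p : ℝ) : ℝ)
  | _, .rdiv x y => ((x.eval s p : ℝ) / (y.eval s p : ℝ) : ℝ)
  | _, .rlt x y =>
      (if (x.eval s p : ℝ) < (y.eval s p : ℝ) then 1 else 0 : ℕ)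
  | _, .ofWord x => (((x.eval s p : ℕ) : ℝ) : ℝ)
  | _, .wite c x y => (if (c.eval s p : ℕ) ≠ 0 then x.eval s p else y.eval s p : ℕ)
  | _, .rite c x y => (if (c.eval s p : ℕ) ≠ 0 then x.eval s p else y.eval s p : ℝ)

/-- The value of a word expression outside parallel statements. -/
noncomputable def Exp.ctrl (e : Exp .word) (s : Config) : ℕ := e.eval s []

/-- The lists `[i₁, …, i_d]` with `i_j < b_j` for all `j`. -/
def box : List ℕ → Finset (List ℕ)
  | [] => {[]}
  | b :: bs => (Finset.range b ×ˢ box bs).image fun p => p.1 :: p.2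

/-- The processors of a parallel statement. -/
noncomputable def procBox (bounds : List (Exp .word)) (s : Config) : Finset (List ℕ) :=
  box (bounds.map fun e => e.ctrl s)

/-- Charge `t` units of time and record the use of `m` processors. -/
def Config.charge (s : Config) (t m : ℕ) : Config :=
  { s with time := s.time + t, procs := max s.procs m }

/-- Charge for a parallel statement with the given bounds and an expression of size `t`. -/
noncomputable def Config.chargePar (s : Config) (bounds : List (Exp .word)) (t : ℕ) : Config :=
  s.charge (1 + (bounds.map Exp.size).sum + t) (procBox bounds s).card

/-- Overwrite the cells of word array `a` with index in `B`. -/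
def Config.setWord (s : Config) (a : ℕ) (B : Finset (List ℕ)) (v : B → ℕ) : Config :=
  { s with
    word := Function.update s.word a fun i => if h : i ∈ B then v ⟨i, h⟩ else s.word a i }

/-- Overwrite the cells of real array `a` with index in `B`. -/
def Config.setReal (s : Config) (a : ℕ) (B : Finset (List ℕ)) (v : B → ℝ) : Config :=
  { s with
    real := Function.update s.real a fun i => if h : i ∈ B then v ⟨i, h⟩ else s.real a i }

/-- The probability that a coin with prescribed bias `q` (clipped to `[0, 1]`) shows `b`. -/
noncomputable def coinMass (q : ℝ) (b : Bool) : ENNReal :=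
  if b then ENNReal.ofReal (max 0 (min 1 q)) else ENNReal.ofReal (1 - max 0 (min 1 q))

theorem coinMass_sum (q : ℝ) : ∑ b : Bool, coinMass q b = 1 := by
  have h0 : (0 : ℝ) ≤ max 0 (min 1 q) := le_max_left _ _
  have h1 : max 0 (min 1 q) ≤ (1 : ℝ) := max_le zero_le_one (min_le_left _ _)
  simp only [Fintype.sum_bool, coinMass, if_true, Bool.false_eq_true, if_false]
  rw [← ENNReal.ofReal_add h0 (by linarith)]
  simp

/-- Independent coins, the `i`-th one with bias `q i`. -/
noncomputable def coins {ι : Type} [Fintype ι] [DecidableEq ι] (q : ι → ℝ) : PMF (ι → Bool) :=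
  PMF.ofFintype (fun f => ∏ i, coinMass (q i) (f i)) (by
    rw [← Fintype.prod_sum (fun i b => coinMass (q i) b)]
    simp only [coinMass_sum, Finset.prod_const_one])

/-- `Exec P s D`: started in `s`, the program `P` halts, whatever the coins show, and the final
configuration has law `D`. -/
inductive Exec : Prog → Config → PMF Config → Prop
  | skip (s : Config) : Exec .skip s (PMF.pure s)
  | seq {P Q : Prog} {s : Config} {D : PMF Config} {F : Config → PMF Config} :
      Exec P s D → (∀ s' ∈ D.support, Exec Q s' (F s')) → Exec (.seq P Q) s (D.bind F)
  | iteTrue {c : Exp .word} {P Q : Prog} {s : Config} {D : PMF Config} :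
      c.ctrl s ≠ 0 → Exec P (s.charge (1 + c.size) 1) D → Exec (.ite c P Q) s D
  | iteFalse {c : Exp .word} {P Q : Prog} {s : Config} {D : PMF Config} :
      c.ctrl s = 0 → Exec Q (s.charge (1 + c.size) 1) D → Exec (.ite c P Q) s D
  | loopTrue {c : Exp .word} {P : Prog} {s : Config} {D : PMF Config}
      {F : Config → PMF Config} :
      c.ctrl s ≠ 0 → Exec P (s.charge (1 + c.size) 1) D →
      (∀ s' ∈ D.support, Exec (.loop c P) s' (F s')) → Exec (.loop c P) s (D.bind F)
  | loopFalse {c : Exp .word} {P : Prog} {s : Config} :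
      c.ctrl s = 0 → Exec (.loop c P) s (PMF.pure (s.charge (1 + c.size) 1))
  | wset (a : ℕ) (bounds : List (Exp .word)) (e : Exp .word) (s : Config) :
      Exec (.wset a bounds e) s (PMF.pure
        ((s.chargePar bounds e.size).setWord a (procBox bounds s) fun i => e.eval s i))
  | rset (a : ℕ) (bounds : List (Exp .word)) (e : Exp .real) (s : Config) :
      Exec (.rset a bounds e) s (PMF.pure
        ((s.chargePar bounds e.size).setReal a (procBox bounds s) fun i => e.eval s i))
  | flip (a : ℕ) (bounds : List (Exp .word)) (q : Exp .real) (s : Config) :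
      Exec (.flip a bounds q) s
        ((coins fun i : procBox bounds s => (q.eval s i : ℝ)).map fun f =>
          (s.chargePar bounds q.size).setWord a (procBox bounds s) fun i => (f i).toNat)

/-- The law of the final configuration is determined by the program and its input. -/
theorem Exec.unique {P : Prog} {s : Config} {D D' : PMF Config} (h : Exec P s D)
    (h' : Exec P s D') : D = D' := by
  have key : ∀ {D : PMF Config} {F G : Config → PMF Config},
      (∀ x ∈ D.support, F x = G x) → D.bind F = D.bind G := by
    intro D F G hFG
    ext y
    rw [PMF.bind_apply, PMF.bind_apply]
    refine tsum_congr fun x => ?_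
    by_cases hx : x ∈ D.support
    · rw [hFG x hx]
    · rw [(PMF.apply_eq_zero_iff D x).2 hx, zero_mul, zero_mul]
  induction h generalizing D' with
  | skip s => cases h'; rfl
  | seq _ _ ih1 ih2 =>
    cases h' with
    | seq k1 k2 =>
      obtain rfl := ih1 k1
      exact key fun x hx => ih2 x hx (k2 x hx)
  | iteTrue hc _ ih =>
    cases h' with
    | iteTrue _ k => exact ih k
    | iteFalse hc' _ => exact absurd hc' hc
  | iteFalse hc _ ih =>
    cases h' with
    | iteTrue hc' _ => exact absurd hc hc'
    | iteFalse _ k => exact ih k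
  | loopTrue hc _ _ ih1 ih2 =>
    cases h' with
    | loopTrue _ k1 k2 =>
      obtain rfl := ih1 k1
      exact key fun x hx => ih2 x hx (k2 x hx)
    | loopFalse hc' => exact absurd hc' hc
  | loopFalse hc =>
    cases h' with
    | loopTrue hc' _ _ => exact absurd hc hc'
    | loopFalse _ => rfl
  | wset a b e s => cases h'; rfl
  | rset a b e s => cases h'; rfl
  | flip a b q s => cases h'; rfl

/-! ### Input, output, and exact sampling with failure -/

/-- The initial configuration: `n` and `k` in the cells `[0]` and `[1]` of word array `0`, the
matrix in real array `0`, the failure probability `δ` in the cell `[]` of real array `1`, and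
`0` everywhere else. -/
noncomputable def inputConfig (n k : ℕ) (L : Matrix (Fin n) (Fin n) ℝ) (δ : ℝ) : Config where
  word a idx := if a = 0 ∧ idx = [0] then n else if a = 0 ∧ idx = [1] then k else 0
  real a idx :=
    match a, idx with
    | 0, [i, j] => if h : i < n ∧ j < n then L ⟨i, h.1⟩ ⟨j, h.2⟩ else 0
    | 1, [] => δ
    | _, _ => 0
  time := 0
  procs := 1

/-- The output: failure if the cell `[]` of word array `1` is `0`, and otherwise the set whose
indicator vector is in word array `2`. -/
def output (n : ℕ) (s : Config) : Option (Finset (Fin n)) :=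
  if s.word 1 [] = 0 then none
  else some (Finset.univ.filter fun i : Fin n => s.word 2 [(i : ℕ)] ≠ 0)

/-- A law on outputs (`none` is failure) fails with probability at most `δ` and, conditioned on
success, is exactly `μ`. -/
def SamplesExactly {n : ℕ} (R : PMF (Option (Finset (Fin n)))) (μ : Finset (Fin n) → ℝ)
    (δ : ℝ) : Prop :=
  (R none).toReal ≤ δ ∧
    ∀ S : Finset (Fin n), (R (some S)).toReal = (1 - (R none).toReal) * μ S

/-! The sampler builds the set in batches. Write `T` for the elements selected so far, `r = k - |T|`
and `l = ⌊√r⌋`. Let `p i` be the conditional probability that `i` belongs to the final set given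
that `T` does. The numbers `p i` with `i ∉ T` add up to `r`, so `p i / r` is a proposal
distribution, and `l` elements are drawn from it independently and in parallel. If they form a set
`R` of `l` distinct elements, `R` is accepted with probability `1/2 * P(R | T) / (∏ p i * ∏_{j<l} (r
- j)/r)`. For an ordered proposal the marginals cancel: it is made and accepted with probability
`1/2 * P(R | T) / (r (r-1) ⋯ (r-l+1))`, which is half the probability of meeting this tuple when the
remaining elements of the final set are listed in random order. Hence the conditional law of the set
is preserved, and the acceptance probability is exactly `1/2` whatever `T` is
(`sum_proposal_acceptProb_condProb`, `sum_proposal_acceptProb`).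

The quotient is a probability for two reasons. Symmetric DPPs are negatively correlated, so `P(R |
T) ≤ ∏ p i` (`condZ_union_div_le`). The falling product is at least `1/2` because `l ^ 2 ≤ r`
(`half_le_prod_falling`). Negative correlation of two indices comes from a generating polynomial
that is affine in each of the two weights. In a basis diagonalising the Gram matrix of the other
weights its coefficients are sums of elementary symmetric polynomials with squared `2 × 2` minors as
factors; log-concavity and Lagrange's identity then give the inequality
(`weightedMinorSum_pair_le`). Conditioning on `T` is the limit of large weights on `T`.

A batch lowers `√r` by at least `1/4`, so there are `O(√k)` batches. Each is tried at most `m`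
times, where `k / 2 ^ m ≤ δ`. Since the batch sizes are deterministic and acceptance has probability
`1/2`, the probability `σ` of completing all batches is known to the program; a last coin of bias
`(1 - δ) / σ` makes the failure probability exactly `δ` (`completeSelection_runs`).

All conditional partition functions needed are coefficients of sums of principal minors once the
rows in `T` are multiplied by a variable. The Faddeev–LeVerrier recursion computes these sums and is
linear in its state, so it is a power of one explicit matrix of order `(n+1) ^ 4` (`flStep_pow`).
Repeated squaring with parallel sums takes polylogarithmic time and `(n+1) ^ 12` processors.

A DPP is a mixture of `k`-DPPs with weights proportional to their partition functions. These are
read off from the same recursion, the order is drawn, and the fixed-order sampler is run. -/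

open Polynomial in
/-- The sum of the principal minors of order `k`. -/
noncomputable def minorSum {ι R : Type*} [Fintype ι] [DecidableEq ι] [CommRing R]
    (A : Matrix ι ι R) (k : ℕ) : R :=
  ∑ S ∈ (Finset.univ : Finset ι).powersetCard k,
    (A.submatrix (Subtype.val : S → ι) (Subtype.val : S → ι)).det

open Polynomial in
/-- The coefficients of the adjugate of `1 + X • A`. -/
noncomputable def adjCoeff {ι R : Type*} [Fintype ι] [DecidableEq ι] [CommRing R]
    (A : Matrix ι ι R) (k : ℕ) : Matrix ι ι R :=
  Matrix.of fun i j => ((1 + (X : R[X]) • A.map C).adjugate i j).coeff k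

/-! ### Faddeev–LeVerrier recursion for sums of principal minors. -/

section FaddeevLeVerrier

open Polynomial

variable {ι R : Type*} [Fintype ι] [DecidableEq ι] [CommRing R] (A : Matrix ι ι R)

theorem adjCoeff_zero : adjCoeff A 0 = 1 := by
  have h1 : (1 + (X : R[X]) • A.map C).map (Polynomial.eval 0) = 1 := by
    ext i j
    by_cases h : i = j <;> simp [Matrix.one_apply, h]
  have h2 := RingHom.map_adjugate (Polynomial.evalRingHom (0 : R)) (1 + (X : R[X]) • A.map C)
  ext i j
  have h3 := congrFun (congrFun h2 i) j
  have h4 : (Polynomial.evalRingHom (0 : R)).mapMatrix (1 + (X : R[X]) • A.map C) = 1 := h1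
  rw [h4, Matrix.adjugate_one] at h3
  rw [← h3]
  simp [adjCoeff, Polynomial.coeff_zero_eq_eval_zero]

/-- Compare coefficients of `X ^ (k + 1)` in `M * adj M = det M • 1` for `M = 1 + X • A`. -/
theorem adjCoeff_succ (k : ℕ) :
    adjCoeff A (k + 1) = minorSum A (k + 1) • 1 - A * adjCoeff A k := by
  rw [eq_sub_iff_add_eq]
  ext i j
  have h := congrArg (fun p : R[X] => p.coeff (k + 1))
    (congrFun (congrFun (Matrix.mul_adjugate (1 + (X : R[X]) • A.map C)) i) j)
  simp only [Matrix.add_mul, Matrix.one_mul, Matrix.add_apply, Matrix.smul_mul, Matrix.smul_apply,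
    smul_eq_mul, Polynomial.coeff_add, Polynomial.coeff_X_mul] at h
  rw [Matrix.add_apply, Matrix.smul_apply, smul_eq_mul]
  have h1 : ((Matrix.det (1 + (X : R[X]) • A.map C)) * (1 : Matrix ι ι R[X]) i j).coeff (k + 1)
      = minorSum A (k + 1) * (1 : Matrix ι ι R) i j := by
    by_cases hij : i = j
    · subst hij
      simp only [Matrix.one_apply_eq, mul_one]
      exact Matrix.coeff_det_one_add_X_smul_eq_sum_minors A (k + 1)
    · simp [Matrix.one_apply_ne hij]
  rw [← h1, ← h]
  congr 1
  simp [Matrix.mul_apply, adjCoeff, Polynomial.finsetSum_coeff]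

/-- A diagonal cofactor of `1 + X • A` is the determinant of `1 + X • A'`, where `A'` is `A` with
row `i` cleared; the principal minors of `A'` through `i` vanish and the others are those of `A`. -/
theorem adjCoeff_diag (k : ℕ) (i : ι) :
    adjCoeff A k i i = ∑ S ∈ ((Finset.univ : Finset ι).powersetCard k).filter (i ∉ ·),
      (A.submatrix (Subtype.val : S → ι) (Subtype.val : S → ι)).det := by
  have h : (1 + (X : R[X]) • A.map C).adjugate i i =
      Matrix.det (1 + (X : R[X]) • (A.updateRow i 0).map C) := by
    rw [Matrix.adjugate_apply]
    congr 1
    ext a c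
    by_cases ha : a = i
    · subst ha; simp [Matrix.one_apply, Pi.single_apply, eq_comm]
    · simp [ha]
  simp only [adjCoeff, Matrix.of_apply]
  rw [h, Matrix.coeff_det_one_add_X_smul_eq_sum_minors, Finset.sum_filter]
  refine Finset.sum_congr rfl fun S _ => ?_
  split_ifs with hi
  · refine Matrix.det_eq_zero_of_row_eq_zero (⟨i, hi⟩ : S) fun c => ?_
    simp
  · refine congrArg (Matrix.det (n := S) (R := R)) ?_
    ext a c
    have : (a : ι) ≠ i := fun h => hi (h ▸ a.2)
    simp [this]

theorem minorSum_sub_adjCoeff_diag (k : ℕ) (i : ι) :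
    minorSum A k - adjCoeff A k i i = ∑ S ∈ ((Finset.univ : Finset ι).powersetCard k).filter (i ∈ ·),
      (A.submatrix (Subtype.val : S → ι) (Subtype.val : S → ι)).det := by
  rw [adjCoeff_diag, sub_eq_iff_eq_add, minorSum,
    Finset.sum_filter_add_sum_filter_not]

/-- Each minor of order `k + 1` is counted once for each of its indices. With `adjCoeff_succ` this
closes the recursion: the next coefficient is a linear function of the present one. -/
theorem trace_mul_adjCoeff (k : ℕ) :
    (A * adjCoeff A k).trace = (k + 1 : ℕ) * minorSum A (k + 1) := by
  have h : ∀ i, (A * adjCoeff A k) i i = minorSum A (k + 1) - adjCoeff A (k + 1) i i := by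
    intro i
    rw [adjCoeff_succ]
    simp
  simp only [Matrix.trace, Matrix.diag_apply, h, minorSum_sub_adjCoeff_diag, Finset.sum_filter]
  rw [Finset.sum_comm, minorSum, Finset.mul_sum]
  refine Finset.sum_congr rfl fun S hS => ?_
  rw [← Finset.sum_filter, Finset.sum_const, nsmul_eq_mul]
  congr 2
  rw [Finset.filter_univ_mem]
  exact_mod_cast (Finset.mem_powersetCard.1 hS).2

end FaddeevLeVerrier

/-! ### Log-concavity of elementary symmetric polynomials. -/

section LogConcave

open Polynomial

/-- Coefficients form a nonnegative log-concave sequence without internal zeros. -/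
def LogConcaveCoeff (p : ℝ[X]) : Prop :=
  (∀ i, 0 ≤ p.coeff i) ∧
    ∀ i j, i ≤ j → p.coeff i * p.coeff (j + 2) ≤ p.coeff (i + 1) * p.coeff (j + 1)

theorem coeff_one_add_C_mul_X_mul_zero (c : ℝ) (p : ℝ[X]) :
    ((1 + C c * X) * p).coeff 0 = p.coeff 0 := by
  simp [Polynomial.mul_coeff_zero]

theorem coeff_one_add_C_mul_X_mul_succ (c : ℝ) (p : ℝ[X]) (i : ℕ) :
    ((1 + C c * X) * p).coeff (i + 1) = p.coeff (i + 1) + c * p.coeff i := by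
  rw [add_mul, one_mul, mul_assoc, coeff_add, coeff_C_mul, coeff_X_mul]

theorem LogConcaveCoeff.mul {p : ℝ[X]} (hp : LogConcaveCoeff p) {c : ℝ} (hc : 0 ≤ c) :
    LogConcaveCoeff ((1 + C c * X) * p) := by
  obtain ⟨h0, h1⟩ := hp
  refine ⟨fun i => ?_, fun i j hij => ?_⟩
  · cases i with
    | zero => rw [coeff_one_add_C_mul_X_mul_zero]; exact h0 0
    | succ i =>
      rw [coeff_one_add_C_mul_X_mul_succ]
      exact add_nonneg (h0 _) (mul_nonneg hc (h0 _))
  · have hcc := mul_nonneg hc hc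
    cases i with
    | zero =>
      simp only [coeff_one_add_C_mul_X_mul_zero, coeff_one_add_C_mul_X_mul_succ]
      have a := h1 0 j (Nat.zero_le j)
      have d := mul_nonneg (h0 0) (h0 j)
      have e : p.coeff 0 * p.coeff (j + 1) ≤ p.coeff 0 * p.coeff (j + 1) +
          p.coeff 1 * p.coeff j := le_add_of_nonneg_right (mul_nonneg (h0 _) (h0 _))
      nlinarith [mul_le_mul_of_nonneg_left e hc, mul_nonneg hcc d]
    | succ i =>
      obtain ⟨j, rfl⟩ : ∃ m, j = m + 1 := ⟨j - 1, by omega⟩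
      simp only [coeff_one_add_C_mul_X_mul_succ]
      have a := h1 (i + 1) (j + 1) hij
      have b := h1 i j (by omega)
      have b' := h1 i (j + 1) (by omega)
      -- This is the part of the inequality that is linear in `c`, after cancelling the common term
      -- `p.coeff (i + 1) * p.coeff (j + 2)`; `a` and `b` are the parts of degree zero and two.
      have d : p.coeff i * p.coeff (j + 3) ≤ p.coeff (i + 2) * p.coeff (j + 1) := by
        rcases Nat.lt_or_ge i j with hlt | hge
        · exact b'.trans (h1 (i + 1) j hlt)
        · obtain rfl : i = j := by omega
          linarith [b', mul_comm (p.coeff (i + 1)) (p.coeff (i + 2))]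
      nlinarith [mul_le_mul_of_nonneg_left d hc, mul_le_mul_of_nonneg_left b hcc]

theorem logConcaveCoeff_prod {ι : Type*} (s : Finset ι) {c : ι → ℝ} (hc : ∀ i, 0 ≤ c i) :
    LogConcaveCoeff (∏ i ∈ s, (1 + C (c i) * X)) := by
  classical
  induction s using Finset.induction_on with
  | empty =>
    simp only [Finset.prod_empty, LogConcaveCoeff, coeff_one]
    refine ⟨fun i => by split_ifs <;> norm_num, fun i j _ => ?_⟩
    simp
  | insert a s ha ih =>
    rw [Finset.prod_insert ha]
    exact ih.mul (hc a)

/-- The Rayleigh inequality for elementary symmetric polynomials. -/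
theorem coeff_prod_erase_mul_le {ι : Type*} [Fintype ι] [DecidableEq ι] {c : ι → ℝ}
    (hc : ∀ i, 0 ≤ c i) {i j : ι} (hij : i ≠ j) (k : ℕ) :
    (∏ l ∈ (Finset.univ.erase i).erase j, (1 + C (c l) * X)).coeff k *
        (∏ l, (1 + C (c l) * X)).coeff (k + 2) ≤
      (∏ l ∈ Finset.univ.erase i, (1 + C (c l) * X)).coeff (k + 1) *
        (∏ l ∈ Finset.univ.erase j, (1 + C (c l) * X)).coeff (k + 1) := by
  have hj : j ∈ Finset.univ.erase i := by simp [hij.symm]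
  have hi : i ∈ Finset.univ.erase j := by simp [hij]
  rw [← Finset.mul_prod_erase _ _ (Finset.mem_univ i), ← Finset.mul_prod_erase _ _ hj,
    ← Finset.mul_prod_erase _ _ hi, Finset.erase_right_comm (a := j) (b := i)]
  -- With `p` the product over the remaining factors, every term containing `c i` or `c j` cancels:
  -- right side minus left side is `p.coeff (k + 1) ^ 2 - p.coeff k * p.coeff (k + 2)`.
  obtain ⟨h0, h1⟩ := logConcaveCoeff_prod ((Finset.univ.erase i).erase j) hc
  simp only [coeff_one_add_C_mul_X_mul_succ]
  have := h1 k k le_rfl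
  nlinarith

end LogConcave

/-! ### Rank two perturbations and simultaneous diagonalisation. -/

section RankTwo

variable {ι : Type*} [Fintype ι] [DecidableEq ι]

/-- The matrix determinant lemma reduces the determinant to one of order two. -/
theorem det_diagonal_add_rank_two (p u w : ι → ℝ) (hp : ∀ i, p i ≠ 0) (x y : ℝ) :
    (Matrix.diagonal p + x • Matrix.vecMulVec u u + y • Matrix.vecMulVec w w).det =
      (∏ i, p i) * ((1 + x * ∑ i, u i ^ 2 / p i) * (1 + y * ∑ i, w i ^ 2 / p i) -
        x * y * (∑ i, u i * w i / p i) ^ 2) := by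
  have hdet : (Matrix.diagonal p).det = ∏ i, p i := Matrix.det_diagonal
  have hunit : IsUnit (Matrix.diagonal p).det := by
    rw [hdet, isUnit_iff_ne_zero, Finset.prod_ne_zero_iff]
    exact fun i _ => hp i
  let U : Matrix ι (Fin 2) ℝ := Matrix.of fun i => ![x * u i, y * w i]
  let V : Matrix (Fin 2) ι ℝ := Matrix.of ![u, w]
  have hUV : Matrix.diagonal p + x • Matrix.vecMulVec u u + y • Matrix.vecMulVec w w =
      Matrix.diagonal p + U * V := by
    rw [add_assoc]
    congr 1
    ext i j
    simp [U, V, Matrix.mul_apply, Fin.sum_univ_two, Matrix.vecMulVec_apply]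
    ring
  have hinv : (Matrix.diagonal p)⁻¹ = Matrix.diagonal (fun i => (p i)⁻¹) := by
    apply Matrix.inv_eq_right_inv
    rw [Matrix.diagonal_mul_diagonal, ← Matrix.diagonal_one]
    congr 1
    ext i
    exact mul_inv_cancel₀ (hp i)
  rw [hUV, Matrix.det_add_mul _ _ hunit, hdet, hinv, Matrix.det_fin_two]
  have key : ∀ a e, (V * Matrix.diagonal (fun i => (p i)⁻¹) * U) a e =
      ∑ i, V a i * (p i)⁻¹ * U i e := by
    intro a e
    simp [Matrix.mul_apply, Matrix.diagonal_apply]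
  simp only [Matrix.add_apply, key]
  have h00 : ∑ i, V 0 i * (p i)⁻¹ * U i 0 = x * ∑ i, u i ^ 2 / p i := by
    rw [Finset.mul_sum]; refine Finset.sum_congr rfl fun i _ => ?_
    simp [U, V, div_eq_mul_inv]; ring
  have h11 : ∑ i, V 1 i * (p i)⁻¹ * U i 1 = y * ∑ i, w i ^ 2 / p i := by
    rw [Finset.mul_sum]; refine Finset.sum_congr rfl fun i _ => ?_
    simp [U, V, div_eq_mul_inv]; ring
  have h01 : ∑ i, V 0 i * (p i)⁻¹ * U i 1 = y * ∑ i, u i * w i / p i := by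
    rw [Finset.mul_sum]; refine Finset.sum_congr rfl fun i _ => ?_
    simp [U, V, div_eq_mul_inv]; ring
  have h10 : ∑ i, V 1 i * (p i)⁻¹ * U i 0 = x * ∑ i, u i * w i / p i := by
    rw [Finset.mul_sum]; refine Finset.sum_congr rfl fun i _ => ?_
    simp [U, V, div_eq_mul_inv]; ring
  rw [h00, h11, h01, h10, Matrix.one_apply_eq, Matrix.one_apply_eq,
    Matrix.one_apply_ne (by decide), Matrix.one_apply_ne (by decide)]
  ring

theorem exists_orthogonal_diagonalization {A : Matrix ι ι ℝ} (hA : A.PosSemidef) :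
    ∃ (Q : Matrix ι ι ℝ) (c : ι → ℝ), (∀ i, 0 ≤ c i) ∧ Q * Q.transpose = 1 ∧
      Q.transpose * Q = 1 ∧ A = Q * Matrix.diagonal c * Q.transpose := by
  have h := hA.isHermitian.spectral_theorem
  refine ⟨hA.isHermitian.eigenvectorUnitary, hA.isHermitian.eigenvalues,
    hA.eigenvalues_nonneg, ?_, ?_, ?_⟩
  · have := (Matrix.mem_unitaryGroup_iff).1 hA.isHermitian.eigenvectorUnitary.2
    rwa [Matrix.star_eq_conjTranspose, Matrix.conjTranspose_eq_transpose_of_trivial] at this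
  · have := (Matrix.mem_unitaryGroup_iff').1 hA.isHermitian.eigenvectorUnitary.2
    rwa [Matrix.star_eq_conjTranspose, Matrix.conjTranspose_eq_transpose_of_trivial] at this
  · conv_lhs => rw [h, Unitary.conjStarAlgAut_apply]
    simp only [Matrix.star_eq_conjTranspose, Matrix.conjTranspose_eq_transpose_of_trivial]
    rfl

/-- A factorization `L = V Vᵀ` for which the rows in `s` have a diagonal Gram matrix of columns. -/
theorem exists_factor_diagonal {L : Matrix ι ι ℝ} (hL : L.PosSemidef) (d : ι → ℝ)
    (hd : ∀ i, 0 ≤ d i) :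
    ∃ (V : Matrix ι ι ℝ) (c : ι → ℝ), (∀ i, 0 ≤ c i) ∧ L = V * V.transpose ∧
      V.transpose * Matrix.diagonal d * V = Matrix.diagonal c := by
  obtain ⟨Q, e, he, h1, -, h3⟩ := exists_orthogonal_diagonalization hL
  set V₀ := Q * Matrix.diagonal fun i => √(e i) with hV₀
  have hLV : L = V₀ * V₀.transpose := by
    rw [hV₀, Matrix.transpose_mul, Matrix.diagonal_transpose, Matrix.mul_assoc,
      ← Matrix.mul_assoc (Matrix.diagonal _) (Matrix.diagonal _), Matrix.diagonal_mul_diagonal,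
      ← Matrix.mul_assoc, h3]
    congr
    ext i
    exact (Real.mul_self_sqrt (he i)).symm
  -- Start from any square root of `L` and rotate its columns by an eigenbasis of its weighted Gram
  -- matrix. The rotation cancels in `V * V.transpose`.
  have hC : (V₀.transpose * Matrix.diagonal d * V₀).PosSemidef := by
    have := (Matrix.PosSemidef.diagonal (d := d) hd).conjTranspose_mul_mul_same V₀
    rwa [Matrix.conjTranspose_eq_transpose_of_trivial] at this
  obtain ⟨P, c, hc, p1, p2, p3⟩ := exists_orthogonal_diagonalization hC
  refine ⟨V₀ * P, c, hc, ?_, ?_⟩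
  · rw [Matrix.transpose_mul, Matrix.mul_assoc, ← Matrix.mul_assoc P, p1, Matrix.one_mul, hLV]
  · rw [Matrix.transpose_mul]
    calc P.transpose * V₀.transpose * Matrix.diagonal d * (V₀ * P)
        = P.transpose * (V₀.transpose * Matrix.diagonal d * V₀) * P := by
          simp only [Matrix.mul_assoc]
      _ = (P.transpose * P) * Matrix.diagonal c * (P.transpose * P) := by
          rw [p3]; simp only [Matrix.mul_assoc]
      _ = Matrix.diagonal c := by rw [p2, Matrix.one_mul, Matrix.mul_one]

end RankTwo

/-! ### The generating polynomial as a function of two weights. -/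

section NegativeCorrelation

open Polynomial

variable {ι : Type*} [Fintype ι] [DecidableEq ι]

theorem minorSum_diagonal_mul (L : Matrix ι ι ℝ) (d : ι → ℝ) (k : ℕ) :
    minorSum (Matrix.diagonal d * L) k =
      ∑ S ∈ (Finset.univ : Finset ι).powersetCard k, (∏ i ∈ S, d i) *
        (L.submatrix (Subtype.val : S → ι) (Subtype.val : S → ι)).det := by
  refine Finset.sum_congr rfl fun S _ => ?_
  have h : (Matrix.diagonal d * L).submatrix (Subtype.val : S → ι) (Subtype.val : S → ι) =
      Matrix.of fun (i j : S) => d i * L.submatrix (Subtype.val : S → ι) (Subtype.val : S → ι) i j := by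
    ext i j
    simp [Matrix.diagonal_mul]
  rw [h, Matrix.det_mul_column, Finset.prod_coe_sort S d]

/-- The generating polynomial of the sums of principal minors under a rank two change of the
weights, in a basis where the unperturbed Gram matrix is diagonal. -/
theorem det_one_add_X_smul_rank_two (L : Matrix ι ι ℝ) (V : Matrix ι ι ℝ) (c d : ι → ℝ)
    (hc : ∀ i, 0 ≤ c i) (hLV : L = V * V.transpose)
    (hV : V.transpose * Matrix.diagonal d * V = Matrix.diagonal c) (a b : ι) (x y : ℝ) :
    Matrix.det (1 + (X : ℝ[X]) •
        (Matrix.diagonal (d + Pi.single a x + Pi.single b y) * L).map C) =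
      (∏ i, (1 + C (c i) * X)) +
        C x * (X * ∑ i, C (V a i ^ 2) * ∏ l ∈ Finset.univ.erase i, (1 + C (c l) * X)) +
        C y * (X * ∑ i, C (V b i ^ 2) * ∏ l ∈ Finset.univ.erase i, (1 + C (c l) * X)) +
        C (x * y) * (X * (X * ∑ i, ∑ j ∈ Finset.univ.erase i,
          C ((V a i * V b j - V a j * V b i) ^ 2 / 2) *
            ∏ l ∈ (Finset.univ.erase i).erase j, (1 + C (c l) * X))) := by
  -- Compare values at all `t > 0`. There every factor `1 + c i * t` is nonzero, so the rank two
  -- formula with its divisions applies.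
  refine Polynomial.eq_of_infinite_eval_eq _ _ ((Set.Ioi_infinite (0 : ℝ)).mono ?_)
  intro t ht
  simp only [Set.mem_ofPred_eq]
  have ht : (0 : ℝ) < t := ht
  set p : ι → ℝ := fun i => 1 + c i * t with hp
  have hp0 : ∀ i, p i ≠ 0 := fun i => by
    have := mul_nonneg (hc i) ht.le
    simp only [hp]; positivity
  have hl : Polynomial.eval t (Matrix.det (1 + (X : ℝ[X]) •
      (Matrix.diagonal (d + Pi.single a x + Pi.single b y) * L).map C)) =
      (Matrix.diagonal p + (t * x) • Matrix.vecMulVec (V a) (V a) +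
        (t * y) • Matrix.vecMulVec (V b) (V b)).det := by
    rw [← Polynomial.coe_evalRingHom, RingHom.map_det]
    have h1 : (evalRingHom t).mapMatrix (1 + (X : ℝ[X]) •
        (Matrix.diagonal (d + Pi.single a x + Pi.single b y) * L).map C) =
        1 + (t • (Matrix.diagonal (d + Pi.single a x + Pi.single b y) * V)) * V.transpose := by
      rw [Matrix.smul_mul, Matrix.mul_assoc, ← hLV]
      ext i j
      by_cases hij : i = j <;> simp [hij]
    -- Sylvester's identity passes to the Gram side, where the unperturbed matrix is diagonal and
    -- each of the two changed weights adds a rank one term.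
    rw [h1, Matrix.det_one_add_mul_comm]
    congr 1
    have h2 : V.transpose * t • (Matrix.diagonal (d + Pi.single a x + Pi.single b y) * V) =
        t • (Matrix.diagonal c + x • Matrix.vecMulVec (V a) (V a) +
          y • Matrix.vecMulVec (V b) (V b)) := by
      rw [Matrix.mul_smul, ← hV]
      congr 1
      have ent : ∀ (e : ι → ℝ) (i j : ι), (V.transpose * (Matrix.diagonal e * V)) i j =
          ∑ s, V s i * (e s * V s j) := fun e i j => by
        rw [Matrix.mul_apply]
        exact Finset.sum_congr rfl fun s _ => by rw [Matrix.diagonal_mul, Matrix.transpose_apply]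
      ext i j
      rw [Matrix.mul_assoc]
      simp only [ent, Matrix.add_apply, Matrix.smul_apply,
        Matrix.vecMulVec_apply, Pi.add_apply, smul_eq_mul, add_mul,
        mul_add, Finset.sum_add_distrib, Pi.single_apply, ite_mul, zero_mul, mul_ite, mul_zero,
        Finset.sum_ite_eq', Finset.mem_univ, if_true]
      ring
    rw [h2]
    ext i j
    by_cases hij : i = j
    · subst hij; simp [hp]; ring
    · simp [hij]; ring
  rw [hl, det_diagonal_add_rank_two _ _ _ hp0]
  simp only [eval_add, eval_mul, eval_prod, eval_finsetSum, eval_C, eval_X, eval_one]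
  have hP : ∀ i, ∏ l ∈ Finset.univ.erase i, p l = (∏ l, p l) / p i := fun i => by
    rw [← Finset.mul_prod_erase _ _ (Finset.mem_univ i), mul_div_cancel_left₀ _ (hp0 i)]
  have hP2 : ∀ i, ∀ j ∈ Finset.univ.erase i, ∏ l ∈ (Finset.univ.erase i).erase j, p l =
      (∏ l, p l) / (p i * p j) := fun i j hj => by
    have := Finset.mul_prod_erase _ p hj
    rw [eq_div_iff (mul_ne_zero (hp0 i) (hp0 j)), ← Finset.mul_prod_erase _ _ (Finset.mem_univ i),
      ← this]
    ring
  change (∏ i, p i) * _ = (∏ i, p i) +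
    x * (t * ∑ i, V a i ^ 2 * ∏ l ∈ Finset.univ.erase i, p l) +
    y * (t * ∑ i, V b i ^ 2 * ∏ l ∈ Finset.univ.erase i, p l) +
    x * y * (t * (t * ∑ i, ∑ j ∈ Finset.univ.erase i,
      (V a i * V b j - V a j * V b i) ^ 2 / 2 * ∏ l ∈ (Finset.univ.erase i).erase j, p l))
  have e1 : ∀ u : ι → ℝ, ∑ i, u i ^ 2 * ∏ l ∈ Finset.univ.erase i, p l =
      (∏ i, p i) * ∑ i, u i ^ 2 / p i := fun u => by
    rw [Finset.mul_sum]
    exact Finset.sum_congr rfl fun i _ => by rw [hP]; ring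
  -- Lagrange's identity with weights `1 / p i`. Ordered pairs count each `2 × 2` minor twice, hence
  -- the factor `1 / 2`; diagonal terms may be added because they vanish.
  have e2 : ∑ i, ∑ j ∈ Finset.univ.erase i, (V a i * V b j - V a j * V b i) ^ 2 / 2 *
      ∏ l ∈ (Finset.univ.erase i).erase j, p l =
      (∏ i, p i) * ((∑ i, V a i ^ 2 / p i) * (∑ i, V b i ^ 2 / p i) -
        (∑ i, V a i * V b i / p i) ^ 2) := by
    have e3 : ∀ i, ∑ j ∈ Finset.univ.erase i, (V a i * V b j - V a j * V b i) ^ 2 / 2 *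
        ∏ l ∈ (Finset.univ.erase i).erase j, p l =
        ∑ j, (V a i * V b j - V a j * V b i) ^ 2 / 2 * ((∏ l, p l) / (p i * p j)) := fun i => by
      rw [← Finset.add_sum_erase _ _ (Finset.mem_univ i), sub_self]
      rw [Finset.sum_congr rfl fun j hj => by rw [hP2 i j hj]]
      ring
    simp only [e3]
    have e4 : ∀ i j, (V a i * V b j - V a j * V b i) ^ 2 / 2 * ((∏ l, p l) / (p i * p j)) =
        (∏ l, p l) * ((V a i ^ 2 / p i) * (V b j ^ 2 / p j) / 2 +
          (V b i ^ 2 / p i) * (V a j ^ 2 / p j) / 2 -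
          (V a i * V b i / p i) * (V a j * V b j / p j)) := fun i j => by
      field_simp [hp0 i, hp0 j]
      ring
    simp only [e4, ← Finset.mul_sum, Finset.sum_sub_distrib, Finset.sum_add_distrib,
      ← Finset.sum_div, ← Finset.sum_mul]
    ring
  rw [e1, e1, e2]
  ring

/-- Sum of the weighted principal minors of order `k` whose index set contains `A`. -/
noncomputable def weightedMinorSum (L : Matrix ι ι ℝ) (d : ι → ℝ) (k : ℕ) (A : Finset ι) : ℝ :=
  ∑ S ∈ ((Finset.univ : Finset ι).powersetCard k).filter (A ⊆ ·), (∏ i ∈ S, d i) *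
    (L.submatrix (Subtype.val : S → ι) (Subtype.val : S → ι)).det

theorem minor_nonneg {L : Matrix ι ι ℝ} (hL : L.PosSemidef) (S : Finset ι) :
    0 ≤ (L.submatrix (Subtype.val : S → ι) (Subtype.val : S → ι)).det :=
  (hL.submatrix _).det_nonneg

end NegativeCorrelation

/-! ### Negative correlation of two indices. -/

section NegativeCorrelation

open Polynomial

variable {ι : Type*} [Fintype ι] [DecidableEq ι]

/-- The Rayleigh inequality bounds the term of the pair `i, j` by a multiple of `β i * β j`. By
Lagrange's identity the resulting sum is the right side minus the square `(∑ u i * w i * β i) ^ 2`.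
-/
theorem sum_sum_wedge_sq_le {c u w : ι → ℝ} (hc : ∀ i, 0 ≤ c i) (k : ℕ) :
    (∑ i, ∑ j ∈ Finset.univ.erase i, C ((u i * w j - u j * w i) ^ 2 / 2) *
        ∏ l ∈ (Finset.univ.erase i).erase j, (1 + C (c l) * X)).coeff k *
      (∏ i, (1 + C (c i) * X)).coeff (k + 2) ≤
    (∑ i, C (u i ^ 2) * ∏ l ∈ Finset.univ.erase i, (1 + C (c l) * X)).coeff (k + 1) *
      (∑ i, C (w i ^ 2) * ∏ l ∈ Finset.univ.erase i, (1 + C (c l) * X)).coeff (k + 1) := by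
  simp only [finsetSum_coeff, coeff_C_mul]
  set β : ι → ℝ := fun i => (∏ l ∈ Finset.univ.erase i, (1 + C (c l) * X)).coeff (k + 1) with hβ
  have step : ∀ i, ∀ j ∈ Finset.univ.erase i, ((u i * w j - u j * w i) ^ 2 / 2 *
      (∏ l ∈ (Finset.univ.erase i).erase j, (1 + C (c l) * X)).coeff k) *
      (∏ i, (1 + C (c i) * X)).coeff (k + 2) ≤ (u i * w j - u j * w i) ^ 2 / 2 * (β i * β j) := by
    intro i j hj
    rw [mul_assoc]
    exact mul_le_mul_of_nonneg_left
      (coeff_prod_erase_mul_le hc (Finset.ne_of_mem_erase hj).symm k) (by positivity)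
  calc _ ≤ ∑ i, ∑ j ∈ Finset.univ.erase i, (u i * w j - u j * w i) ^ 2 / 2 * (β i * β j) := by
        rw [Finset.sum_mul]
        refine Finset.sum_le_sum fun i _ => ?_
        rw [Finset.sum_mul]
        exact Finset.sum_le_sum (step i)
    _ = ∑ i, ∑ j, (u i * w j - u j * w i) ^ 2 / 2 * (β i * β j) := by
        refine Finset.sum_congr rfl fun i _ => ?_
        rw [← Finset.add_sum_erase _ _ (Finset.mem_univ i)]
        ring
    _ = (∑ i, u i ^ 2 * β i) * (∑ i, w i ^ 2 * β i) - (∑ i, u i * w i * β i) ^ 2 := by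
        have e4 : ∀ i j, (u i * w j - u j * w i) ^ 2 / 2 * (β i * β j) =
            (u i ^ 2 * β i) * (w j ^ 2 * β j) / 2 + (w i ^ 2 * β i) * (u j ^ 2 * β j) / 2 -
              (u i * w i * β i) * (u j * w j * β j) := fun i j => by ring
        simp only [e4, ← Finset.mul_sum, Finset.sum_sub_distrib, Finset.sum_add_distrib,
          ← Finset.sum_div, ← Finset.sum_mul]
        ring
    _ ≤ _ := sub_le_self _ (sq_nonneg _)

/-- With the weights of `a` and `b` replaced by variables `x` and `y`, the partition function is `E
+ x α + y β + x y γ` in order `k`. The claim reduces to `γ * E ≤ α * β`. -/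
theorem weightedMinorSum_pair_le {L : Matrix ι ι ℝ} (hL : L.PosSemidef) {d : ι → ℝ}
    (hd : ∀ i, 0 ≤ d i) (k : ℕ) {a b : ι} (hab : a ≠ b) :
    weightedMinorSum L d k {a, b} * weightedMinorSum L d k ∅ ≤
      weightedMinorSum L d k {a} * weightedMinorSum L d k {b} := by
  set d₀ : ι → ℝ := Function.update (Function.update d a 0) b 0 with hd₀
  have hd₀' : ∀ i, 0 ≤ d₀ i := fun i => by
    simp only [hd₀, Function.update_apply]
    split_ifs <;> simp [hd]
  obtain ⟨V, c, hc, hLV, hV⟩ := exists_factor_diagonal hL d₀ hd₀'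
  have key := fun x y => congrArg (fun p : ℝ[X] => p.coeff k)
    (det_one_add_X_smul_rank_two L V c d₀ hc hLV hV a b x y)
  set E : ℝ[X] := ∏ i, (1 + C (c i) * X)
  set α : ℝ[X] := ∑ i, C (V a i ^ 2) * ∏ l ∈ Finset.univ.erase i, (1 + C (c l) * X) with hα
  set β : ℝ[X] := ∑ i, C (V b i ^ 2) * ∏ l ∈ Finset.univ.erase i, (1 + C (c l) * X) with hβ
  set γ : ℝ[X] := ∑ i, ∑ j ∈ Finset.univ.erase i, C ((V a i * V b j - V a j * V b i) ^ 2 / 2) *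
    ∏ l ∈ (Finset.univ.erase i).erase j, (1 + C (c l) * X) with hγ
  simp only [coeff_add, coeff_C_mul, Matrix.coeff_det_one_add_X_smul_eq_sum_minors] at key
  set m : Finset ι → ℝ := fun S =>
    (L.submatrix (Subtype.val : S → ι) (Subtype.val : S → ι)).det with hm
  set D : ℝ → ℝ → ι → ℝ := fun x y => d₀ + Pi.single a x + Pi.single b y with hD
  have hZ : ∀ x y, ∑ S ∈ (Finset.univ : Finset ι).powersetCard k,
      (∏ i ∈ S, D x y i) * m S =
      E.coeff k + x * (X * α).coeff k + y * (X * β).coeff k + x * y * (X * (X * γ)).coeff k :=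
    fun x y => by rw [← key, ← minorSum_diagonal_mul]; rfl
  have hprod : ∀ (x y : ℝ) (S : Finset ι), (x = d a ∨ x = 0) → (y = d b ∨ y = 0) →
      ∏ i ∈ S, D x y i =
        if (a ∈ S ∧ x = 0) ∨ (b ∈ S ∧ y = 0) then 0 else ∏ i ∈ S, d i := by
    intro x y S hx hy
    have va : D x y a = x := by
      simp [hD, hd₀, hab]
    have vb : D x y b = y := by
      simp [hD, hd₀, hab.symm]
    split_ifs with h
    · rcases h with ⟨h, rfl⟩ | ⟨h, rfl⟩
      · exact Finset.prod_eq_zero h va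
      · exact Finset.prod_eq_zero h vb
    · push Not at h
      refine Finset.prod_congr rfl fun i hi => ?_
      by_cases hia : i = a
      · subst hia
        rw [va]; exact hx.resolve_right (h.1 hi)
      · by_cases hib : i = b
        · subst hib
          rw [vb]; exact hy.resolve_right (h.2 hi)
        · simp [hD, hd₀, hia, hib]
  -- A zero weight makes both sides vanish. It is excluded because the evaluations below tell `x = d
  -- a` from `x = 0`.
  by_cases hda : d a = 0
  · have h1 : weightedMinorSum L d k {a, b} = 0 := by
      refine Finset.sum_eq_zero fun S hS => ?_
      rw [Finset.prod_eq_zero (i := a) ((Finset.mem_filter.1 hS).2 (by simp)) hda, zero_mul]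
    have h2 : weightedMinorSum L d k {a} = 0 := by
      refine Finset.sum_eq_zero fun S hS => ?_
      rw [Finset.prod_eq_zero (i := a) ((Finset.mem_filter.1 hS).2 (by simp)) hda, zero_mul]
    rw [h1, h2, zero_mul, zero_mul]
  by_cases hdb : d b = 0
  · have h1 : weightedMinorSum L d k {a, b} = 0 := by
      refine Finset.sum_eq_zero fun S hS => ?_
      rw [Finset.prod_eq_zero (i := b) ((Finset.mem_filter.1 hS).2 (by simp)) hdb, zero_mul]
    have h2 : weightedMinorSum L d k {b} = 0 := by
      refine Finset.sum_eq_zero fun S hS => ?_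
      rw [Finset.prod_eq_zero (i := b) ((Finset.mem_filter.1 hS).2 (by simp)) hdb, zero_mul]
    rw [h1, h2, zero_mul, mul_zero]
  -- Setting `x` or `y` to zero removes the sets containing `a` or `b`; inclusion–exclusion over the
  -- four evaluations isolates the sums over sets containing prescribed elements.
  have z11 := hZ (d a) (d b)
  have z01 := hZ 0 (d b)
  have z10 := hZ (d a) 0
  have z00 := hZ 0 0
  simp only [hprod _ _ _ (Or.inl rfl) (Or.inl rfl)] at z11
  simp only [hprod _ _ _ (Or.inr rfl) (Or.inl rfl)] at z01
  simp only [hprod _ _ _ (Or.inl rfl) (Or.inr rfl)] at z10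
  simp only [hprod _ _ _ (Or.inr rfl) (Or.inr rfl)] at z00
  have w0 : weightedMinorSum L d k ∅ = E.coeff k + d a * (X * α).coeff k + d b * (X * β).coeff k +
      d a * d b * (X * (X * γ)).coeff k := by
    rw [← z11, weightedMinorSum, Finset.sum_filter]
    exact Finset.sum_congr rfl fun S _ => by simp [hda, hdb, hm]
  have wa : weightedMinorSum L d k {a} = d a * (X * α).coeff k +
      d a * d b * (X * (X * γ)).coeff k := by
    have : weightedMinorSum L d k {a} = (E.coeff k + d a * (X * α).coeff k +
      d b * (X * β).coeff k + d a * d b * (X * (X * γ)).coeff k) - (E.coeff k +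
      0 * (X * α).coeff k + d b * (X * β).coeff k + 0 * d b * (X * (X * γ)).coeff k) := by
      rw [← z11, ← z01, weightedMinorSum, Finset.sum_filter, ← Finset.sum_sub_distrib]
      refine Finset.sum_congr rfl fun S _ => ?_
      by_cases h : a ∈ S <;> simp [hda, hdb, hm, h]
    rw [this]; ring
  have wb : weightedMinorSum L d k {b} = d b * (X * β).coeff k +
      d a * d b * (X * (X * γ)).coeff k := by
    have : weightedMinorSum L d k {b} = (E.coeff k + d a * (X * α).coeff k +
      d b * (X * β).coeff k + d a * d b * (X * (X * γ)).coeff k) - (E.coeff k +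
      d a * (X * α).coeff k + 0 * (X * β).coeff k + d a * 0 * (X * (X * γ)).coeff k) := by
      rw [← z11, ← z10, weightedMinorSum, Finset.sum_filter, ← Finset.sum_sub_distrib]
      refine Finset.sum_congr rfl fun S _ => ?_
      by_cases h : b ∈ S <;> simp [hda, hdb, hm, h]
    rw [this]; ring
  have wab : weightedMinorSum L d k {a, b} = d a * d b * (X * (X * γ)).coeff k := by
    have : weightedMinorSum L d k {a, b} = (E.coeff k + d a * (X * α).coeff k +
      d b * (X * β).coeff k + d a * d b * (X * (X * γ)).coeff k) - (E.coeff k +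
      0 * (X * α).coeff k + d b * (X * β).coeff k + 0 * d b * (X * (X * γ)).coeff k) -
      (E.coeff k +
      d a * (X * α).coeff k + 0 * (X * β).coeff k + d a * 0 * (X * (X * γ)).coeff k) +
      (E.coeff k + 0 * (X * α).coeff k + 0 * (X * β).coeff k + 0 * 0 * (X * (X * γ)).coeff k) := by
      rw [← z11, ← z10, ← z01, ← z00, weightedMinorSum, Finset.sum_filter,
        ← Finset.sum_sub_distrib, ← Finset.sum_sub_distrib, ← Finset.sum_add_distrib]
      refine Finset.sum_congr rfl fun S _ => ?_
      by_cases h : a ∈ S <;> by_cases h' : b ∈ S <;>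
        simp [hda, hdb, hm, h, h', Finset.insert_subset_iff]
    rw [this]; ring
  -- The factor `X ^ 2` in front of `γ` makes the left side zero for `k = 0` and `k = 1`, so the
  -- coefficient inequality is needed only from `k = 2` on.
  have main : (X * (X * γ)).coeff k * E.coeff k ≤ (X * α).coeff k * (X * β).coeff k := by
    rcases k with _ | _ | k
    · simp
    · rw [coeff_X_mul, coeff_X_mul, coeff_X_mul, coeff_X_mul_zero, zero_mul]
      have hnn : ∀ u : ι → ℝ, 0 ≤ (∑ i, C (u i ^ 2) *
          ∏ l ∈ Finset.univ.erase i, (1 + C (c l) * X)).coeff 0 := fun u => by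
        simp only [finsetSum_coeff, coeff_C_mul]
        exact Finset.sum_nonneg fun i _ => mul_nonneg (sq_nonneg _)
          ((logConcaveCoeff_prod _ hc).1 _)
      exact mul_nonneg (hnn (V a)) (hnn (V b))
    · rw [coeff_X_mul, coeff_X_mul, coeff_X_mul, coeff_X_mul]
      exact sum_sum_wedge_sq_le hc k
  -- All mixed terms cancel: the difference of the two sides is `d a * d b` times the difference in
  -- `main`.
  rw [w0, wa, wb, wab]
  nlinarith [mul_le_mul_of_nonneg_left main (mul_nonneg (hd a) (hd b))]

end NegativeCorrelation

/-! ### Partition functions conditioned on a selected set. -/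

section ConditionedMinors

open Polynomial

variable {m : ℕ} {L : Matrix (Fin m) (Fin m) ℝ}

/-- The sum of the principal minors of order `k` whose index set contains `T`. -/
noncomputable def condZ (L : Matrix (Fin m) (Fin m) ℝ) (k : ℕ) (T : Finset (Fin m)) : ℝ :=
  ∑ S ∈ ((Finset.univ : Finset (Fin m)).powersetCard k).filter (T ⊆ ·), dppWeight L S

theorem dppWeight_nonneg (hL : L.PosSemidef) (S : Finset (Fin m)) : 0 ≤ dppWeight L S :=
  minor_nonneg hL S

theorem condZ_nonneg (hL : L.PosSemidef) (k : ℕ) (T : Finset (Fin m)) : 0 ≤ condZ L k T :=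
  Finset.sum_nonneg fun S _ => dppWeight_nonneg hL S

theorem condZ_anti (hL : L.PosSemidef) (k : ℕ) {T T' : Finset (Fin m)} (h : T ⊆ T') :
    condZ L k T' ≤ condZ L k T :=
  Finset.sum_le_sum_of_subset_of_nonneg
    (fun S hS => by
      rw [Finset.mem_filter] at hS ⊢
      exact ⟨hS.1, h.trans hS.2⟩)
    fun S _ _ => dppWeight_nonneg hL S

theorem dppWeight_le_condZ (hL : L.PosSemidef) {k : ℕ} {T S : Finset (Fin m)} (h : T ⊆ S)
    (hS : S.card = k) : dppWeight L S ≤ condZ L k T :=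
  Finset.single_le_sum (f := fun S => dppWeight L S) (fun S _ => dppWeight_nonneg hL S)
    (Finset.mem_filter.2 ⟨Finset.mem_powersetCard.2 ⟨Finset.subset_univ _, hS⟩, h⟩)

theorem condZ_empty (L : Matrix (Fin m) (Fin m) ℝ) (k : ℕ) : condZ L k ∅ = kdppZ L k := by
  simp [condZ, kdppZ]

theorem card_le_of_condZ_pos {k : ℕ} {T : Finset (Fin m)} (h : 0 < condZ L k T) : T.card ≤ k := by
  by_contra hlt
  refine h.ne' (Finset.sum_eq_zero fun S hS => ?_)
  rw [Finset.mem_filter, Finset.mem_powersetCard] at hS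
  exact absurd (Finset.card_le_card hS.2) (by omega)

theorem condZ_of_card_eq {k : ℕ} {T : Finset (Fin m)} (h : T.card = k) :
    condZ L k T = dppWeight L T := by
  have : ((Finset.univ : Finset (Fin m)).powersetCard k).filter (T ⊆ ·) = {T} := by
    ext S
    rw [Finset.mem_filter, Finset.mem_powersetCard, Finset.mem_singleton]
    refine ⟨fun hS => (Finset.eq_of_subset_of_card_le hS.2 (by omega)).symm, ?_⟩
    rintro rfl
    exact ⟨⟨Finset.subset_univ _, h⟩, Finset.Subset.refl _⟩
  rw [condZ, this, Finset.sum_singleton]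

/-- A set `S ⊇ T` is counted once for each element of `S \ T`. This is the normalising constant of
the proposals. -/
theorem sum_condZ_insert (L : Matrix (Fin m) (Fin m) ℝ) (k : ℕ) (T : Finset (Fin m)) :
    ∑ i ∈ Tᶜ, condZ L k (insert i T) = ((k : ℝ) - T.card) * condZ L k T := by
  simp only [condZ, Finset.mul_sum, Finset.sum_filter]
  rw [Finset.sum_comm]
  refine Finset.sum_congr rfl fun S hS => ?_
  by_cases h : T ⊆ S
  · simp only [Finset.insert_subset_iff, h, and_true, if_true]
    rw [← Finset.sum_filter, Finset.sum_const, nsmul_eq_mul]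
    congr 1
    have : Tᶜ.filter (· ∈ S) = S \ T := by
      ext i; simp [and_comm]
    rw [this, Finset.card_sdiff_of_subset h, (Finset.mem_powersetCard.1 hS).2,
      Nat.cast_sub ((Finset.mem_powersetCard.1 hS).2 ▸ Finset.card_le_card h)]
  · simp [Finset.insert_subset_iff, h]

/-- Give the elements of `T` the weight `1 / ε` and rescale by `ε ^ |T|`; as `ε → 0`, only sets
containing `T` survive in the inequality for weighted minors. -/
theorem condZ_pair_le (hL : L.PosSemidef) (k : ℕ) (T : Finset (Fin m)) {a b : Fin m}
    (hab : a ≠ b) :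
    condZ L k (insert a (insert b T)) * condZ L k T ≤
      condZ L k (insert a T) * condZ L k (insert b T) := by
  -- After rescaling, a set is penalised by one factor `ε` for each element of `T` that it misses.
  -- This form is continuous at `0`, where the convention `0 ^ 0 = 1` keeps exactly the sets `S ⊇
  -- T`.
  set h : Finset (Fin m) → ℝ → ℝ := fun A ε =>
    ∑ S ∈ ((Finset.univ : Finset (Fin m)).powersetCard k).filter (A ⊆ ·),
      ε ^ (T \ S).card * dppWeight L S with hh
  have hcont : ∀ A, Continuous (h A) := fun A => by
    simp only [hh]
    fun_prop
  have h0 : ∀ A, h A 0 = condZ L k (A ∪ T) := fun A => by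
    simp only [hh, condZ, Finset.sum_filter]
    refine Finset.sum_congr rfl fun S _ => ?_
    by_cases h1 : A ⊆ S <;> by_cases h2 : T ⊆ S
    · simp [h1, h2, Finset.union_subset_iff, Finset.sdiff_eq_empty_iff_subset.2 h2]
    · have : (T \ S).card ≠ 0 := by
        rw [Ne, Finset.card_eq_zero, Finset.sdiff_eq_empty_iff_subset]; exact h2
      simp [h1, h2, Finset.union_subset_iff, zero_pow this]
    · simp [h1, Finset.union_subset_iff]
    · simp [h1, Finset.union_subset_iff]
  have hpos : ∀ ε : ℝ, 0 < ε → h {a, b} ε * h ∅ ε ≤ h {a} ε * h {b} ε := by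
    intro ε hε
    have hw : ∀ A, h A ε = ε ^ T.card *
        weightedMinorSum L (fun i => if i ∈ T then ε⁻¹ else 1) k A := fun A => by
      simp only [hh, weightedMinorSum, Finset.mul_sum]
      refine Finset.sum_congr rfl fun S _ => ?_
      rw [← mul_assoc]
      change _ = _ * dppWeight L S
      congr 1
      rw [Finset.prod_ite, Finset.prod_const, Finset.prod_const_one, mul_one]
      have h1 : S.filter (· ∈ T) = S ∩ T := by ext; simp
      have h2 : T.card = (T \ S).card + (S ∩ T).card := by
        rw [Finset.inter_comm, Finset.card_sdiff_add_card_inter]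
      rw [h1, h2, pow_add, mul_assoc, ← mul_pow, mul_inv_cancel₀ hε.ne', one_pow, mul_one]
    have := weightedMinorSum_pair_le hL (d := fun i => if i ∈ T then ε⁻¹ else 1)
      (fun i => by split_ifs <;> positivity) k hab
    simp only [hw]
    have h2 := mul_le_mul_of_nonneg_left this (by positivity : 0 ≤ ε ^ T.card * ε ^ T.card)
    linarith
  have hlim : h {a, b} 0 * h ∅ 0 ≤ h {a} 0 * h {b} 0 := by
    have c1 := (((hcont {a, b}).mul (hcont ∅)).tendsto 0).mono_left
      (nhdsWithin_le_nhds (s := Set.Ioi (0 : ℝ)))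
    have c2 := (((hcont {a}).mul (hcont {b})).tendsto 0).mono_left
      (nhdsWithin_le_nhds (s := Set.Ioi (0 : ℝ)))
    exact le_of_tendsto_of_tendsto c1 c2 (Filter.eventually_of_mem self_mem_nhdsWithin hpos)
  simp only [h0] at hlim
  simpa [Finset.insert_union, Finset.singleton_union] using hlim

/-- Conditioning on one more element never raises the probability of `i`; iterate over `R`. -/
theorem condZ_insert_union_le (hL : L.PosSemidef) (k : ℕ) (T : Finset (Fin m)) (i : Fin m)
    (R : Finset (Fin m)) (hi : i ∉ R) :
    condZ L k (insert i (R ∪ T)) * condZ L k T ≤ condZ L k (R ∪ T) * condZ L k (insert i T) := by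
  induction R using Finset.induction_on with
  | empty => rw [Finset.empty_union, mul_comm]
  | insert c R hc ih =>
    have ih := ih fun h => hi (Finset.mem_insert_of_mem h)
    have hic : i ≠ c := fun h => hi (h ▸ Finset.mem_insert_self _ _)
    have hp := condZ_pair_le hL k (R ∪ T) hic
    rw [Finset.insert_union]
    -- The two inequalities are chained by cancelling `condZ L k (R ∪ T)`; if it is zero, the left
    -- side is zero by monotonicity.
    rcases (condZ_nonneg hL k (R ∪ T)).eq_or_lt with h0 | h0
    · have : condZ L k (insert i (insert c (R ∪ T))) = 0 := by
        refine le_antisymm ?_ (condZ_nonneg hL k _)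
        rw [h0]
        exact condZ_anti hL k ((Finset.subset_insert _ _).trans (Finset.subset_insert _ _))
      rw [this, zero_mul]
      exact mul_nonneg (condZ_nonneg hL k _) (condZ_nonneg hL k _)
    · refine le_of_mul_le_mul_left ?_ h0
      have h1 := mul_le_mul_of_nonneg_right hp (condZ_nonneg hL k T)
      have h2 := mul_le_mul_of_nonneg_left ih (condZ_nonneg hL k (insert c (R ∪ T)))
      linarith

/-- Negative correlation: the inclusion probability of a set is at most the product of the
inclusion probabilities of its elements. -/
theorem condZ_union_div_le (hL : L.PosSemidef) {k : ℕ} {T : Finset (Fin m)}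
    (hT : 0 < condZ L k T) (R : Finset (Fin m)) :
    condZ L k (R ∪ T) / condZ L k T ≤ ∏ i ∈ R, condZ L k (insert i T) / condZ L k T := by
  induction R using Finset.induction_on with
  | empty => rw [Finset.empty_union, div_self hT.ne', Finset.prod_empty]
  | insert i R hi ih =>
    rw [Finset.prod_insert hi, Finset.insert_union]
    have h1 := condZ_insert_union_le hL k T i R hi
    have h2 : condZ L k (insert i (R ∪ T)) / condZ L k T ≤
        condZ L k (insert i T) / condZ L k T * (condZ L k (R ∪ T) / condZ L k T) := by
      rw [div_mul_div_comm, div_le_div_iff₀ hT (mul_pos hT hT)]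
      nlinarith
    exact h2.trans (mul_le_mul_of_nonneg_left ih (div_nonneg (condZ_nonneg hL k _) hT.le))

/-- The matrix `L` with the rows in `T` multiplied by the variable. -/
noncomputable def markRows (L : Matrix (Fin m) (Fin m) ℝ) (T : Finset (Fin m)) :
    Matrix (Fin m) (Fin m) ℝ[X] :=
  Matrix.of fun a c => (if a ∈ T then X else 1) * C (L a c)

theorem det_markRows (T S : Finset (Fin m)) :
    ((markRows L T).submatrix (Subtype.val : S → Fin m) (Subtype.val : S → Fin m)).det =
      X ^ (S ∩ T).card * C (dppWeight L S) := by
  have h : (markRows L T).submatrix (Subtype.val : S → Fin m) (Subtype.val : S → Fin m) =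
      Matrix.of fun (i j : S) => (if (i : Fin m) ∈ T then X else 1) *
        ((L.submatrix (Subtype.val : S → Fin m) (Subtype.val : S → Fin m)).map C) i j := rfl
  rw [h, Matrix.det_mul_column, Finset.prod_coe_sort S (fun i => if i ∈ T then (X : ℝ[X]) else 1),
    Finset.prod_ite, Finset.prod_const, Finset.prod_const_one, mul_one]
  have hdet : ((L.submatrix (Subtype.val : S → Fin m) (Subtype.val : S → Fin m)).map C).det =
      C (dppWeight L S) := (RingHom.map_det C _).symm
  have hcard : S.filter (· ∈ T) = S ∩ T := by ext; simp
  rw [hcard, ← hdet]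

theorem coeff_det_markRows (T S : Finset (Fin m)) :
    (((markRows L T).submatrix (Subtype.val : S → Fin m) (Subtype.val : S → Fin m)).det).coeff
      T.card = if T ⊆ S then dppWeight L S else 0 := by
  rw [det_markRows, mul_comm, coeff_C_mul_X_pow]
  have : T.card = (S ∩ T).card ↔ T ⊆ S := by
    constructor
    · intro h
      exact Finset.inter_eq_right.1 (Finset.eq_of_subset_of_card_le Finset.inter_subset_right h.le)
    · intro h; rw [Finset.inter_eq_right.2 h]
  simp only [this]

/-- The minor on `S` carries `X ^ |S ∩ T|`, and this exponent equals `|T|` exactly when `T ⊆ S`. -/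
theorem coeff_minorSum_markRows (k : ℕ) (T : Finset (Fin m)) :
    (minorSum (markRows L T) k).coeff T.card = condZ L k T := by
  simp only [minorSum, finsetSum_coeff, coeff_det_markRows, condZ, Finset.sum_filter]

theorem coeff_minorSum_sub_markRows (k : ℕ) (T : Finset (Fin m)) (i : Fin m) :
    (minorSum (markRows L T) k - adjCoeff (markRows L T) k i i).coeff T.card =
      condZ L k (insert i T) := by
  rw [minorSum_sub_adjCoeff_diag]
  simp only [finsetSum_coeff, condZ, Finset.sum_filter]
  refine Finset.sum_congr rfl fun S _ => ?_
  by_cases h : i ∈ S <;> by_cases h' : T ⊆ S <;> simp [h, h', Finset.insert_subset_iff, coeff_det_markRows]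

end ConditionedMinors

/-! ### Reasoning about programs -/

/-- The word register number `a`, i.e. the cell `[]` of word array `a`. -/
def Exp.reg (a : ℕ) : Exp .word := .wget a (d := 0) fun i => i.elim0

/-- The real register number `a`. -/
def Exp.rreg (a : ℕ) : Exp .real := .rget a (d := 0) fun i => i.elim0

@[simp] theorem Exp.eval_reg (a : ℕ) (s : Config) (p : List ℕ) :
    ((Exp.reg a).eval s p : ℕ) = s.word a [] := by
  simp [Exp.reg, Exp.eval]

@[simp] theorem Exp.eval_rreg (a : ℕ) (s : Config) (p : List ℕ) :
    ((Exp.rreg a).eval s p : ℝ) = s.real a [] := by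
  simp [Exp.rreg, Exp.eval]

/-- Bounds of the parallel statements used here: `d` times the content of word register `3`. -/
def cube (d : ℕ) : List (Exp .word) := List.replicate d (Exp.reg 3)

theorem mem_box_replicate {b : ℕ} : ∀ {d : ℕ} {I : List ℕ},
    I ∈ box (List.replicate d b) ↔ I.length = d ∧ ∀ x ∈ I, x < b
  | 0, I => by
    simp only [List.replicate_zero, box, Finset.mem_singleton, List.length_eq_zero_iff]
    constructor
    · rintro rfl; simp
    · exact fun h => h.1
  | d + 1, [] => by simp [List.replicate_succ, box]
  | d + 1, x :: I => by
    simp only [List.replicate_succ, box, Finset.mem_image, Finset.mem_product, Finset.mem_range,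
      Prod.exists, List.cons.injEq, List.length_cons, Nat.add_right_cancel_iff, List.mem_cons,
      forall_eq_or_imp]
    constructor
    · rintro ⟨y, J, ⟨hy, hJ⟩, rfl, rfl⟩
      have := mem_box_replicate.1 hJ
      exact ⟨this.1, hy, this.2⟩
    · rintro ⟨h1, h2, h3⟩
      exact ⟨x, I, ⟨h2, mem_box_replicate.2 ⟨h1, h3⟩⟩, rfl, rfl⟩

theorem card_box_replicate_le (b : ℕ) : ∀ d : ℕ, (box (List.replicate d b)).card ≤ b ^ d
  | 0 => by simp [box]
  | d + 1 => by
    rw [List.replicate_succ, box, pow_succ']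
    refine Finset.card_image_le.trans ?_
    rw [Finset.card_product, Finset.card_range]
    exact Nat.mul_le_mul_left _ (card_box_replicate_le b d)

theorem procBox_cube (d : ℕ) (s : Config) :
    procBox (cube d) s = box (List.replicate d (s.word 3 [])) := by
  simp [procBox, cube, Exp.ctrl]

/-- The program does not write to word array `a`. -/
def Prog.keepsWord (a : ℕ) : Prog → Bool
  | .skip => true
  | .seq P Q => P.keepsWord a && Q.keepsWord a
  | .ite _ P Q => P.keepsWord a && Q.keepsWord a
  | .loop _ P => P.keepsWord a
  | .wset a' _ _ => !(a' == a)
  | .rset _ _ _ => true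
  | .flip a' _ _ => !(a' == a)

/-- The program does not write to real array `a`. -/
def Prog.keepsReal (a : ℕ) : Prog → Bool
  | .skip => true
  | .seq P Q => P.keepsReal a && Q.keepsReal a
  | .ite _ P Q => P.keepsReal a && Q.keepsReal a
  | .loop _ P => P.keepsReal a
  | .wset _ _ _ => true
  | .rset a' _ _ => !(a' == a)
  | .flip _ _ _ => true

/-- All parallel statements have bounds `cube d` with `d ≤ 12`. -/
def Prog.Uniform : Prog → Prop
  | .skip => True
  | .seq P Q => P.Uniform ∧ Q.Uniform
  | .ite _ P Q => P.Uniform ∧ Q.Uniform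
  | .loop _ P => P.Uniform
  | .wset _ bs _ => ∃ d ≤ 12, bs = cube d
  | .rset _ bs _ => ∃ d ≤ 12, bs = cube d
  | .flip _ bs _ => ∃ d ≤ 12, bs = cube d

/-- A bound for the time of a program each of whose loops makes at most `t` passes. -/
def Prog.timeBound (t : ℕ) : Prog → ℕ
  | .skip => 0
  | .seq P Q => P.timeBound t + Q.timeBound t
  | .ite c P Q => 1 + c.size + P.timeBound t + Q.timeBound t
  | .loop c P => t * (1 + c.size + P.timeBound t) + (1 + c.size)
  | .wset _ bs e => 1 + (bs.map Exp.size).sum + e.size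
  | .rset _ bs e => 1 + (bs.map Exp.size).sum + e.size
  | .flip _ bs e => 1 + (bs.map Exp.size).sum + e.size

/-- The degree can be taken to be the nesting depth of the loops. For a fixed program whose loops
run logarithmically often the time is therefore polylogarithmic. -/
theorem Prog.exists_timeBound_le (P : Prog) :
    ∃ K d : ℕ, ∀ t, P.timeBound t ≤ K * (t + 1) ^ d := by
  induction P with
  | skip => exact ⟨0, 0, fun t => by simp [Prog.timeBound]⟩
  | seq P Q ihP ihQ =>
    obtain ⟨K, d, h⟩ := ihP
    obtain ⟨K', d', h'⟩ := ihQ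
    refine ⟨K + K', max d d', fun t => ?_⟩
    have e1 := Nat.pow_le_pow_right (Nat.succ_pos t) (le_max_left d d')
    have e2 := Nat.pow_le_pow_right (Nat.succ_pos t) (le_max_right d d')
    rw [Prog.timeBound, add_mul]
    exact Nat.add_le_add ((h t).trans (Nat.mul_le_mul_left _ e1))
      ((h' t).trans (Nat.mul_le_mul_left _ e2))
  | ite c P Q ihP ihQ =>
    obtain ⟨K, d, h⟩ := ihP
    obtain ⟨K', d', h'⟩ := ihQ
    refine ⟨(1 + c.size) + K + K', max d d', fun t => ?_⟩
    have e1 := Nat.pow_le_pow_right (Nat.succ_pos t) (le_max_left d d')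
    have e2 := Nat.pow_le_pow_right (Nat.succ_pos t) (le_max_right d d')
    have e3 : 1 ≤ (t + 1) ^ max d d' := Nat.one_le_pow _ _ (Nat.succ_pos t)
    rw [Prog.timeBound, add_mul, add_mul]
    exact Nat.add_le_add (Nat.add_le_add (Nat.le_mul_of_pos_right _ e3)
      ((h t).trans (Nat.mul_le_mul_left _ e1))) ((h' t).trans (Nat.mul_le_mul_left _ e2))
  | loop c P ih =>
    obtain ⟨K, d, h⟩ := ih
    refine ⟨(1 + c.size) + K + (1 + c.size), d + 1, fun t => ?_⟩
    have e3 : 1 ≤ (t + 1) ^ d := Nat.one_le_pow _ _ (Nat.succ_pos t)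
    rw [Prog.timeBound]
    calc t * (1 + c.size + P.timeBound t) + (1 + c.size)
        ≤ (t + 1) * ((1 + c.size) * (t + 1) ^ d + K * (t + 1) ^ d) +
          (t + 1) * ((1 + c.size) * (t + 1) ^ d) := by
          refine Nat.add_le_add (Nat.mul_le_mul (Nat.le_succ t)
            (Nat.add_le_add (Nat.le_mul_of_pos_right _ e3) (h t))) ?_
          exact (Nat.le_mul_of_pos_right _ e3).trans (Nat.le_mul_of_pos_left _ (Nat.succ_pos t))
      _ = _ := by ring
  | wset a bs e => exact ⟨_, 0, fun t => by rw [Prog.timeBound, pow_zero, mul_one]⟩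
  | rset a bs e => exact ⟨_, 0, fun t => by rw [Prog.timeBound, pow_zero, mul_one]⟩
  | flip a bs e => exact ⟨_, 0, fun t => by rw [Prog.timeBound, pow_zero, mul_one]⟩

/-- The frame rule: a syntactic check, decidable by computation, yields preservation of an array on
every run. -/
theorem Exec.word_eq {P : Prog} {s : Config} {D : PMF Config} (h : Exec P s D) {a : ℕ}
    (ha : P.keepsWord a = true) : ∀ s' ∈ D.support, s'.word a = s.word a := by
  induction h with
  | skip s => intro s' hs'; rw [PMF.mem_support_pure_iff] at hs'; rw [hs']
  | seq _ _ ih1 ih2 =>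
    simp only [Prog.keepsWord, Bool.and_eq_true] at ha
    intro s' hs'
    obtain ⟨u, hu, hs'⟩ := (PMF.mem_support_bind_iff _ _ _).1 hs'
    rw [ih2 u hu ha.2 s' hs', ih1 ha.1 u hu]
  | iteTrue _ _ ih =>
    simp only [Prog.keepsWord, Bool.and_eq_true] at ha
    exact ih ha.1
  | iteFalse _ _ ih =>
    simp only [Prog.keepsWord, Bool.and_eq_true] at ha
    exact ih ha.2
  | loopTrue _ _ _ ih1 ih2 =>
    intro s' hs'
    obtain ⟨u, hu, hs'⟩ := (PMF.mem_support_bind_iff _ _ _).1 hs'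
    rw [ih2 u hu ha s' hs', ih1 ha u hu]
    rfl
  | loopFalse _ => intro s' hs'; rw [PMF.mem_support_pure_iff] at hs'; rw [hs']; rfl
  | wset a' bs e s =>
    intro s' hs'; rw [PMF.mem_support_pure_iff] at hs'; rw [hs']
    have : a ≠ a' := fun h => by subst h; simp [Prog.keepsWord] at ha
    simp [Config.setWord, Config.chargePar, Config.charge, Function.update_of_ne this]
  | rset a' bs e s =>
    intro s' hs'; rw [PMF.mem_support_pure_iff] at hs'; rw [hs']
    rfl
  | flip a' bs e s =>
    intro s' hs'
    obtain ⟨f, _, rfl⟩ := (PMF.mem_support_map_iff _ _ _).1 hs'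
    have : a ≠ a' := fun h => by subst h; simp [Prog.keepsWord] at ha
    simp [Config.setWord, Config.chargePar, Config.charge, Function.update_of_ne this]

theorem Exec.real_eq {P : Prog} {s : Config} {D : PMF Config} (h : Exec P s D) {a : ℕ}
    (ha : P.keepsReal a = true) : ∀ s' ∈ D.support, s'.real a = s.real a := by
  induction h with
  | skip s => intro s' hs'; rw [PMF.mem_support_pure_iff] at hs'; rw [hs']
  | seq _ _ ih1 ih2 =>
    simp only [Prog.keepsReal, Bool.and_eq_true] at ha
    intro s' hs'
    obtain ⟨u, hu, hs'⟩ := (PMF.mem_support_bind_iff _ _ _).1 hs'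
    rw [ih2 u hu ha.2 s' hs', ih1 ha.1 u hu]
  | iteTrue _ _ ih =>
    simp only [Prog.keepsReal, Bool.and_eq_true] at ha
    exact ih ha.1
  | iteFalse _ _ ih =>
    simp only [Prog.keepsReal, Bool.and_eq_true] at ha
    exact ih ha.2
  | loopTrue _ _ _ ih1 ih2 =>
    intro s' hs'
    obtain ⟨u, hu, hs'⟩ := (PMF.mem_support_bind_iff _ _ _).1 hs'
    rw [ih2 u hu ha s' hs', ih1 ha u hu]
    rfl
  | loopFalse _ => intro s' hs'; rw [PMF.mem_support_pure_iff] at hs'; rw [hs']; rfl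
  | wset a' bs e s =>
    intro s' hs'; rw [PMF.mem_support_pure_iff] at hs'; rw [hs']
    rfl
  | rset a' bs e s =>
    intro s' hs'; rw [PMF.mem_support_pure_iff] at hs'; rw [hs']
    have : a ≠ a' := fun h => by subst h; simp [Prog.keepsReal] at ha
    simp [Config.setReal, Config.chargePar, Config.charge, Function.update_of_ne this]
  | flip a' bs e s =>
    intro s' hs'
    obtain ⟨f, _, rfl⟩ := (PMF.mem_support_map_iff _ _ _).1 hs'
    rfl

theorem card_procBox_le {bs : List (Exp .word)} {s : Config} {b : ℕ} (hb : 1 ≤ b)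
    (hs : s.word 3 [] = b) (h : ∃ d ≤ 12, bs = cube d) : (procBox bs s).card ≤ b ^ 12 := by
  obtain ⟨d, hd, rfl⟩ := h
  rw [procBox_cube, hs]
  exact (card_box_replicate_le b d).trans (Nat.pow_le_pow_right hb hd)

/-- The register that holds the side of all index boxes is never written, so every parallel
statement uses a cube of side `b` and dimension at most twelve. -/
theorem Exec.procs_le {P : Prog} {s : Config} {D : PMF Config} (h : Exec P s D) {b : ℕ}
    (hb : 1 ≤ b) (hP : P.Uniform) (h3 : P.keepsWord 3 = true) (hs : s.word 3 [] = b) :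
    ∀ s' ∈ D.support, s'.procs ≤ max s.procs (b ^ 12) := by
  have hone : 1 ≤ b ^ 12 := Nat.one_le_pow _ _ hb
  induction h with
  | skip s =>
    intro s' hs'; rw [PMF.mem_support_pure_iff] at hs'; rw [hs']; exact le_max_left _ _
  | seq h1 _ ih1 ih2 =>
    simp only [Prog.keepsWord, Bool.and_eq_true] at h3
    intro s' hs'
    obtain ⟨u, hu, hs'⟩ := (PMF.mem_support_bind_iff _ _ _).1 hs'
    have e1 := ih1 hP.1 h3.1 hs u hu
    have e2 := ih2 u hu hP.2 h3.2 (by rw [h1.word_eq h3.1 u hu, hs]) s' hs'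
    omega
  | iteTrue _ _ ih =>
    simp only [Prog.keepsWord, Bool.and_eq_true] at h3
    intro s' hs'
    have := ih hP.1 h3.1 hs s' hs'
    simp only [Config.charge] at this
    omega
  | iteFalse _ _ ih =>
    simp only [Prog.keepsWord, Bool.and_eq_true] at h3
    intro s' hs'
    have := ih hP.2 h3.2 hs s' hs'
    simp only [Config.charge] at this
    omega
  | loopTrue _ h1 _ ih1 ih2 =>
    intro s' hs'
    obtain ⟨u, hu, hs'⟩ := (PMF.mem_support_bind_iff _ _ _).1 hs'
    have e1 := ih1 hP h3 hs u hu
    have e2 := ih2 u hu hP h3 (by rw [h1.word_eq h3 u hu]; exact hs) s' hs'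
    simp only [Config.charge] at e1
    omega
  | loopFalse _ =>
    intro s' hs'; rw [PMF.mem_support_pure_iff] at hs'; rw [hs']
    simp only [Config.charge]
    omega
  | wset a' bs e s =>
    intro s' hs'; rw [PMF.mem_support_pure_iff] at hs'; rw [hs']
    have := card_procBox_le hb hs hP
    simp only [Config.setWord, Config.chargePar, Config.charge]
    omega
  | rset a' bs e s =>
    intro s' hs'; rw [PMF.mem_support_pure_iff] at hs'; rw [hs']
    have := card_procBox_le hb hs hP
    simp only [Config.setReal, Config.chargePar, Config.charge]
    omega
  | flip a' bs e s =>
    intro s' hs'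
    obtain ⟨f, _, rfl⟩ := (PMF.mem_support_map_iff _ _ _).1 hs'
    have := card_procBox_le hb hs hP
    simp only [Config.setWord, Config.chargePar, Config.charge]
    omega

/-! ### Deterministic programs -/

/-- Started in `s`, the program `P` makes no random choices, takes at most the time of a program
whose loops make at most `t` passes, and ends in a configuration satisfying `Q`. -/
def Det (t : ℕ) (P : Prog) (s : Config) (Q : Config → Prop) : Prop :=
  ∃ s', Exec P s (PMF.pure s') ∧ s'.time ≤ s.time + P.timeBound t ∧ Q s'

theorem Exec.pure_seq {P R : Prog} {s s' : Config} {D : PMF Config} (h : Exec P s (PMF.pure s'))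
    (h' : Exec R s' D) : Exec (.seq P R) s D := by
  have := Exec.seq (F := fun _ => D) h fun u hu => by
    rw [PMF.mem_support_pure_iff] at hu
    exact hu ▸ h'
  rwa [PMF.pure_bind] at this

theorem Exec.pure_loop {c : Exp .word} {P : Prog} {s s' : Config} {D : PMF Config}
    (hc : c.ctrl s ≠ 0) (h : Exec P (s.charge (1 + c.size) 1) (PMF.pure s'))
    (h' : Exec (.loop c P) s' D) : Exec (.loop c P) s D := by
  have := Exec.loopTrue (F := fun _ => D) hc h fun u hu => by
    rw [PMF.mem_support_pure_iff] at hu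
    exact hu ▸ h'
  rwa [PMF.pure_bind] at this

theorem Det.mono {t : ℕ} {P : Prog} {s : Config} {Q Q' : Config → Prop} (h : Det t P s Q)
    (hQ : ∀ s', Q s' → Q' s') : Det t P s Q' := by
  obtain ⟨s', h1, h2, h3⟩ := h
  exact ⟨s', h1, h2, hQ s' h3⟩

/-- What a deterministic program does not write to, it keeps. -/
theorem Det.frame {t : ℕ} {P : Prog} {s : Config} {Q : Config → Prop} (h : Det t P s Q) :
    Det t P s fun s' => Q s' ∧ (∀ a, P.keepsWord a = true → s'.word a = s.word a) ∧
      ∀ a, P.keepsReal a = true → s'.real a = s.real a := by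
  obtain ⟨s', h1, h2, h3⟩ := h
  have hmem : s' ∈ (PMF.pure s').support := by rw [PMF.mem_support_pure_iff]
  exact ⟨s', h1, h2, h3, fun a ha => h1.word_eq ha s' hmem, fun a ha => h1.real_eq ha s' hmem⟩

theorem Det.skip {t : ℕ} {s : Config} {Q : Config → Prop} (h : Q s) : Det t .skip s Q :=
  ⟨s, .skip s, Nat.le_add_right _ _, h⟩

theorem Det.seq {t : ℕ} {P R : Prog} {s : Config} {Q Q' : Config → Prop} (h : Det t P s Q)
    (h' : ∀ s', Q s' → Det t R s' Q') : Det t (.seq P R) s Q' := by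
  obtain ⟨u, h1, h2, h3⟩ := h
  obtain ⟨v, k1, k2, k3⟩ := h' u h3
  refine ⟨v, h1.pure_seq k1, ?_, k3⟩
  rw [Prog.timeBound]
  omega

theorem Det.wset {t a d : ℕ} {e : Exp .word} {s : Config} {Q : Config → Prop}
    (h : ∀ s', s'.word = Function.update s.word a (fun I =>
      if I ∈ box (List.replicate d (s.word 3 [])) then (e.eval s I : ℕ) else s.word a I) →
      s'.real = s.real → Q s') : Det t (.wset a (cube d) e) s Q := by
  refine ⟨_, .wset a (cube d) e s, le_of_eq ?_, h _ ?_ rfl⟩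
  · rfl
  · simp only [Config.setWord, procBox_cube]
    congr 1

theorem Det.rset {t a d : ℕ} {e : Exp .real} {s : Config} {Q : Config → Prop}
    (h : ∀ s', s'.real = Function.update s.real a (fun I =>
      if I ∈ box (List.replicate d (s.word 3 [])) then (e.eval s I : ℝ) else s.real a I) →
      s'.word = s.word → Q s') : Det t (.rset a (cube d) e) s Q := by
  refine ⟨_, .rset a (cube d) e s, le_of_eq ?_, h _ ?_ rfl⟩
  · rfl
  · simp only [Config.setReal, procBox_cube]
    congr 1

/-- A loop that makes exactly `N` passes. -/
theorem Det.loop {t N : ℕ} {c : Exp .word} {P : Prog} {s : Config} (inv : ℕ → Config → Prop)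
    (hN : N ≤ t) (h0 : inv 0 s) (hcharge : ∀ i s u m, inv i s → inv i (s.charge u m))
    (htrue : ∀ i s, i < N → inv i s → c.ctrl s ≠ 0 ∧ Det t P s (inv (i + 1)))
    (hfalse : ∀ s, inv N s → c.ctrl s = 0) : Det t (.loop c P) s (inv N) := by
  suffices H : ∀ j i s, i + j = N → inv i s → ∃ s', Exec (.loop c P) s (PMF.pure s') ∧
      s'.time ≤ s.time + (j * (1 + c.size + P.timeBound t) + (1 + c.size)) ∧ inv N s' by
    obtain ⟨s', h1, h2, h3⟩ := H N 0 s (zero_add N) h0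
    refine ⟨s', h1, h2.trans ?_, h3⟩
    rw [Prog.timeBound]
    gcongr
  intro j
  induction j with
  | zero =>
    intro i s hi hs
    obtain rfl : i = N := by omega
    refine ⟨_, .loopFalse (hfalse s hs), ?_, hcharge _ _ _ _ hs⟩
    simp only [Config.charge]
    omega
  | succ j ih =>
    intro i s hi hs
    obtain ⟨hc, -⟩ := htrue i s (by omega) hs
    obtain ⟨-, u, h1, h2, h3⟩ := htrue i (s.charge (1 + c.size) 1) (by omega)
      (hcharge _ _ _ _ hs)
    obtain ⟨v, k1, k2, k3⟩ := ih (i + 1) u (by omega) h3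
    refine ⟨v, h1.pure_loop hc k1, ?_, k3⟩
    simp only [Config.charge] at h2
    rw [add_mul]
    omega

/-! ### Value functions of randomised programs -/

/-- The expectation of `φ` under `D`. -/
noncomputable def PMF.ev {α : Type*} (D : PMF α) (φ : α → ENNReal) : ENNReal := ∑' x, D x * φ x

theorem PMF.ev_pure {α : Type*} (a : α) (φ : α → ENNReal) : (PMF.pure a).ev φ = φ a := by
  rw [PMF.ev, tsum_eq_single a fun x hx => by rw [PMF.pure_apply_of_ne _ _ hx, zero_mul]]
  rw [PMF.pure_apply_self, one_mul]

theorem PMF.ev_bind {α β : Type*} (D : PMF α) (F : α → PMF β) (φ : β → ENNReal) :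
    (D.bind F).ev φ = D.ev fun x => (F x).ev φ := by
  simp only [PMF.ev, PMF.bind_apply, ← ENNReal.tsum_mul_left, ← ENNReal.tsum_mul_right]
  rw [ENNReal.tsum_comm]
  simp only [mul_assoc]

theorem PMF.ev_map {α β : Type*} (D : PMF α) (f : α → β) (φ : β → ENNReal) :
    (D.map f).ev φ = D.ev fun x => φ (f x) := by
  rw [← PMF.bind_pure_comp, PMF.ev_bind]
  simp only [Function.comp_apply, PMF.ev_pure]

theorem PMF.ev_congr {α : Type*} {D : PMF α} {φ ψ : α → ENNReal}
    (h : ∀ x ∈ D.support, φ x = ψ x) : D.ev φ = D.ev ψ := by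
  refine tsum_congr fun x => ?_
  by_cases hx : x ∈ D.support
  · rw [h x hx]
  · rw [(PMF.apply_eq_zero_iff D x).2 hx, zero_mul, zero_mul]

theorem PMF.ev_coins {ι : Type} [Fintype ι] [DecidableEq ι] (q : ι → ℝ)
    (φ : (ι → Bool) → ENNReal) :
    (coins q).ev φ = ∑ f, (∏ i, coinMass (q i) (f i)) * φ f := by
  rw [PMF.ev, tsum_fintype]
  rfl

/-- Started in `s`, the program `P` halts before time `τ`, and the expected value of `φ` in the
final configuration is `v`. -/
def Runs (P : Prog) (s : Config) (φ : Config → ENNReal) (v : ENNReal) (τ : ℕ) : Prop :=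
  ∃ D, Exec P s D ∧ D.ev φ = v ∧ ∀ s' ∈ D.support, s'.time ≤ τ

theorem Runs.mono {P : Prog} {s : Config} {φ : Config → ENNReal} {v : ENNReal} {τ τ' : ℕ}
    (h : Runs P s φ v τ) (hτ : τ ≤ τ') : Runs P s φ v τ' := by
  obtain ⟨D, h1, h2, h3⟩ := h
  exact ⟨D, h1, h2, fun s' hs' => (h3 s' hs').trans hτ⟩

theorem Runs.congr_value {P : Prog} {s : Config} {φ : Config → ENNReal} {v v' : ENNReal} {τ : ℕ}
    (h : Runs P s φ v τ) (hv : v = v') : Runs P s φ v' τ := hv ▸ h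

theorem Runs.of_det {t : ℕ} {P : Prog} {s : Config} {φ : Config → ENNReal} {v : ENNReal}
    (h : Det t P s fun s' => φ s' = v) : Runs P s φ v (s.time + P.timeBound t) := by
  obtain ⟨s', h1, h2, h3⟩ := h
  refine ⟨_, h1, by rw [PMF.ev_pure, h3], fun u hu => ?_⟩
  rw [PMF.mem_support_pure_iff] at hu
  rwa [hu]

theorem Runs.det_seq {t : ℕ} {P R : Prog} {s : Config} {Q : Config → Prop}
    {φ : Config → ENNReal} {v : ENNReal} {τ : ℕ} (h : Det t P s Q)
    (h' : ∀ s', Q s' → s'.time ≤ s.time + P.timeBound t → Runs R s' φ v τ) :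
    Runs (.seq P R) s φ v τ := by
  obtain ⟨u, h1, h2, h3⟩ := h
  obtain ⟨D, k1, k2⟩ := h' u h3 h2
  exact ⟨D, h1.pure_seq k1, k2⟩

/-- The coins of a parallel statement are tossed first. -/
theorem Runs.flip_seq {a d : ℕ} {q : Exp .real} {R : Prog} {s : Config} {φ : Config → ENNReal}
    {κ : Type} [Fintype κ] [DecidableEq κ] (e : κ ≃ box (List.replicate d (s.word 3 [])))
    (v : (κ → Bool) → ENNReal) {τ : ℕ}
    (h : ∀ f : κ → Bool, (∀ x, coinMass (q.eval s (e x)) (f x) ≠ 0) → ∀ s',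
      s'.word = Function.update s.word a (fun I =>
        if hI : I ∈ box (List.replicate d (s.word 3 [])) then (f (e.symm ⟨I, hI⟩)).toNat
        else s.word a I) →
      s'.real = s.real → s'.time ≤ s.time + (Prog.flip a (cube d) q).timeBound 0 →
      Runs R s' φ (v f) τ) :
    Runs (.seq (.flip a (cube d) q) R) s φ
      (∑ f : κ → Bool, (∏ x, coinMass (q.eval s (e x)) (f x)) * v f) τ := by
  classical
  have hpb := procBox_cube d s
  obtain ⟨B, hB⟩ : ∃ B, B = box (List.replicate d (s.word 3 [])) := ⟨_, rfl⟩
  rw [← hB] at hpb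
  have hex := Exec.flip a (cube d) q s
  rw [hpb] at hex
  revert e h
  rw [← hB]
  intro e h
  set g : (B → Bool) → Config := fun f =>
    (s.chargePar (cube d) q.size).setWord a B fun i => (f i).toNat with hg
  have hrun : ∀ f : B → Bool, f ∈ (coins fun i : B => (q.eval s i : ℝ)).support →
      Runs R (g f) φ (v fun x => f (e x)) τ := by
    intro f hf
    have hf : (∏ i : B, coinMass (q.eval s i) (f i)) ≠ 0 := (PMF.mem_support_iff _ _).1 hf
    rw [Finset.prod_ne_zero_iff] at hf
    refine h _ (fun x => hf (e x) (Finset.mem_univ _)) (g f) ?_ rfl le_rfl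
    simp [hg, Config.setWord, Config.chargePar, Config.charge]
  -- The continuation must be a function of the configuration and not of the coins, so a law of `R`
  -- is chosen for each configuration having one. By uniqueness it is the intended law; the default
  -- value is never met on the support.
  let F : Config → PMF Config := fun s' =>
    if hs : ∃ D, Exec R s' D then hs.choose else PMF.pure s'
  have hF : ∀ f ∈ (coins fun i : B => (q.eval s i : ℝ)).support,
      Exec R (g f) (F (g f)) ∧ (F (g f)).ev φ = v (fun x => f (e x)) ∧
        ∀ s' ∈ (F (g f)).support, s'.time ≤ τ := by
    intro f hf
    obtain ⟨D, h1, h2, h3⟩ := hrun f hf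
    have hs : ∃ D, Exec R (g f) D := ⟨D, h1⟩
    have hFD : F (g f) = D := by
      simp only [F, dif_pos hs]
      exact hs.choose_spec.unique h1
    rw [hFD]
    exact ⟨h1, h2, h3⟩
  refine ⟨_, Exec.seq hex (F := F) ?_, ?_, ?_⟩
  · intro s' hs'
    obtain ⟨f, hf, rfl⟩ := (PMF.mem_support_map_iff _ _ _).1 hs'
    exact (hF f hf).1
  · rw [PMF.ev_bind, PMF.ev_map, PMF.ev_congr fun f hf => (hF f hf).2.1, PMF.ev_coins]
    refine Fintype.sum_equiv (e.arrowCongr (Equiv.refl Bool)).symm _ _ fun f => ?_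
    congr 1
    exact (Fintype.prod_equiv e _ _ fun x => rfl).symm
  · intro s' hs'
    obtain ⟨u, hu, hs'⟩ := (PMF.mem_support_bind_iff _ _ _).1 hs'
    obtain ⟨f, hf, rfl⟩ := (PMF.mem_support_map_iff _ _ _).1 hu
    exact (hF f hf).2.2 s' hs'

/-- The rules below treat the first statement of a sequence; reassociating lets them enter a nested
program with the rest as continuation. -/
theorem Exec.assoc {P Q R : Prog} {s : Config} {D : PMF Config}
    (h : Exec (.seq P (.seq Q R)) s D) : Exec (.seq (.seq P Q) R) s D := by
  classical
  cases h with
  | @seq _ _ _ D₁ F h1 h2 =>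
    have h3 : ∀ u ∈ D₁.support, ∃ D₂ : PMF Config, ∃ G : Config → PMF Config,
        Exec Q u D₂ ∧ (∀ w ∈ D₂.support, Exec R w (G w)) ∧ F u = D₂.bind G := by
      intro u hu
      have := h2 u hu
      generalize F u = E at this
      cases this with
      | seq k1 k2 => exact ⟨_, _, k1, k2, rfl⟩
    -- The laws `G` depend on the intermediate configuration `u`. Uniqueness of the law of `R`
    -- replaces them by one function independent of `u`.
    let H : Config → PMF Config := fun w =>
      if hw : ∃ E, Exec R w E then hw.choose else PMF.pure w
    have hH : ∀ w E, Exec R w E → H w = E := fun w E hE => by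
      have hw : ∃ E, Exec R w E := ⟨E, hE⟩
      simp only [H, dif_pos hw]
      exact hw.choose_spec.unique hE
    choose! D₂ G k1 k2 k3 using h3
    have e : D₁.bind F = (D₁.bind D₂).bind H := by
      rw [PMF.bind_bind]
      ext y
      rw [PMF.bind_apply, PMF.bind_apply]
      refine tsum_congr fun u => ?_
      by_cases hu : u ∈ D₁.support
      · congr 1
        rw [k3 u hu, PMF.bind_apply, PMF.bind_apply]
        refine tsum_congr fun w => ?_
        by_cases hw : w ∈ (D₂ u).support
        · rw [hH w _ (k2 u hu w hw)]
        · rw [(PMF.apply_eq_zero_iff _ _).2 hw, zero_mul, zero_mul]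
      · rw [(PMF.apply_eq_zero_iff _ _).2 hu, zero_mul, zero_mul]
    rw [e]
    refine Exec.seq (Exec.seq h1 k1) fun w hw => ?_
    obtain ⟨u, hu, hw⟩ := (PMF.mem_support_bind_iff _ _ _).1 hw
    rw [hH w _ (k2 u hu w hw)]
    exact k2 u hu w hw

theorem Runs.assoc {P Q R : Prog} {s : Config} {φ : Config → ENNReal} {v : ENNReal} {τ : ℕ}
    (h : Runs (.seq P (.seq Q R)) s φ v τ) : Runs (.seq (.seq P Q) R) s φ v τ := by
  obtain ⟨D, h1, h2⟩ := h
  exact ⟨D, h1.assoc, h2⟩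

theorem Exec.loop_unfold {c : Exp .word} {P R : Prog} {s : Config} {D : PMF Config}
    (hc : c.ctrl s ≠ 0) (h : Exec (.seq P (.seq (.loop c P) R)) (s.charge (1 + c.size) 1) D) :
    Exec (.seq (.loop c P) R) s D := by
  have h' := h.assoc
  generalize hu : s.charge (1 + c.size) 1 = u at h'
  cases h' with
  | @seq _ _ _ D₁ F h1 h2 =>
    generalize hE : D₁ = E at h1
    cases h1 with
    | @seq _ _ _ D₂ G k1 k2 =>
      subst hE hu
      exact Exec.seq (Exec.loopTrue hc k1 k2) h2

theorem Runs.loop_true {c : Exp .word} {P R : Prog} {s : Config} {φ : Config → ENNReal}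
    {v : ENNReal} {τ : ℕ} (hc : c.ctrl s ≠ 0)
    (h : Runs (.seq P (.seq (.loop c P) R)) (s.charge (1 + c.size) 1) φ v τ) :
    Runs (.seq (.loop c P) R) s φ v τ := by
  obtain ⟨D, h1, h2⟩ := h
  exact ⟨D, h1.loop_unfold hc, h2⟩

theorem Runs.loop_false {c : Exp .word} {P R : Prog} {s : Config} {φ : Config → ENNReal}
    {v : ENNReal} {τ : ℕ} (hc : c.ctrl s = 0)
    (h : Runs R (s.charge (1 + c.size) 1) φ v τ) :
    Runs (.seq (.loop c P) R) s φ v τ := by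
  obtain ⟨D, h1, h2⟩ := h
  exact ⟨D, (Exec.loopFalse hc).pure_seq h1, h2⟩

/-! ### Prefix computations along the last index of an array -/

/-- The cell with index `idx` of the array number `a` of either kind. -/
def Exp.get : (τ : Ty) → ℕ → {d : ℕ} → (Fin d → Exp .word) → Exp τ
  | .word, a, _, idx => .wget a idx
  | .real, a, _, idx => .rget a idx

/-- Case distinction for values of either kind. -/
def Exp.sel : (τ : Ty) → Exp .word → Exp τ → Exp τ → Exp τ
  | .word, c, x, y => .wite c x y
  | .real, c, x, y => .rite c x y

/-- Parallel assignment to an array of either kind. -/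
def Prog.set : (τ : Ty) → ℕ → List (Exp .word) → Exp τ → Prog
  | .word, a, bs, e => .wset a bs e
  | .real, a, bs, e => .rset a bs e

/-- The arrays of either kind. -/
def Config.mem (s : Config) : (τ : Ty) → ℕ → List ℕ → τ.Val
  | .word => s.word
  | .real => s.real

theorem Exp.eval_get (s : Config) (p : List ℕ) (τ : Ty) (a : ℕ) {d : ℕ}
    (idx : Fin d → Exp .word) :
    (Exp.get τ a idx).eval s p = s.mem τ a (List.ofFn fun i => ((idx i).eval s p : ℕ)) := by
  cases τ <;> simp [Exp.get, Exp.eval, Config.mem]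

theorem Exp.eval_sel (s : Config) (p : List ℕ) (τ : Ty) (c : Exp .word) (x y : Exp τ) :
    (Exp.sel τ c x y).eval s p = if (c.eval s p : ℕ) ≠ 0 then x.eval s p else y.eval s p := by
  cases τ <;> simp [Exp.sel, Exp.eval]

/-- The index of the processor, with the last coordinate replaced by `e`. -/
def snocIdx (d : ℕ) (e : Exp .word) : Fin (d + 1) → Exp .word :=
  fun i => if i.val < d then .pid i else e

theorem eval_pids (s : Config) {d : ℕ} {p : List ℕ} (hp : p.length = d) :
    (List.ofFn fun i : Fin d => ((Exp.pid i).eval s p : ℕ)) = p := by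
  apply List.ext_getElem
  · simp [hp]
  · intro i h1 h2
    simp [Exp.eval, h2]

theorem eval_snocIdx (s : Config) {d : ℕ} {p J : List ℕ} (hJ : J.length = d) (hp : J <+: p)
    (e : Exp .word) :
    (List.ofFn fun i => ((snocIdx d e i).eval s p : ℕ)) = J ++ [(e.eval s p : ℕ)] := by
  obtain ⟨K, rfl⟩ := hp
  apply List.ext_getElem
  · simp [hJ]
  · intro i h1 h2
    rw [List.getElem_ofFn]
    by_cases hi : i < d
    · have : i < J.length := hJ ▸ hi
      simp [snocIdx, hi, Exp.eval, List.getElem_append_left this, List.getElem?_append_left this,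
        List.getElem?_eq_getElem this]
    · have : i = d := by simp [hJ] at h2; omega
      subst this
      simp [snocIdx, hJ]

theorem Det.set {t a d : ℕ} {τ : Ty} {e : Exp τ} {s : Config} {Q : Config → Prop} (ha : a ≠ 3)
    (ha' : a ≠ 5)
    (h : ∀ s', (∀ I, s'.mem τ a I =
      if I ∈ box (List.replicate d (s.word 3 [])) then e.eval s I else s.mem τ a I) →
      s'.word 3 = s.word 3 → s'.word 5 = s.word 5 → Q s') : Det t (.set τ a (cube d) e) s Q := by
  cases τ
  · refine Det.wset fun s' h1 h2 => h s' (fun I => ?_) ?_ ?_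
    · simp [Config.mem, h1]
    · rw [h1, Function.update_of_ne ha.symm]
    · rw [h1, Function.update_of_ne ha'.symm]
  · refine Det.rset fun s' h1 h2 => h s' (fun I => ?_) ?_ ?_
    · simp [Config.mem, h1]
    · rw [h2]
    · rw [h2]

/-- Combine `f j, …, f (j + h - 1)`. -/
def window {α : Type*} (op : α → α → α) (u : α) (f : ℕ → α) (j : ℕ) : ℕ → α
  | 0 => u
  | h + 1 => op (f j) (window op u f (j + 1) h)

section Window

variable {α : Type*} {op : α → α → α} {u : α} {f : ℕ → α}

theorem window_add (hassoc : ∀ x y z, op (op x y) z = op x (op y z)) (hu : ∀ x, op u x = x)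
    (h h' : ℕ) : ∀ j, window op u f j (h + h') = op (window op u f j h) (window op u f (j + h) h') := by
  induction h with
  | zero => intro j; simp [window, hu]
  | succ h ih =>
    intro j
    rw [show h + 1 + h' = h + h' + 1 by omega, window, ih, window, hassoc,
      show j + (h + 1) = j + 1 + h by omega]

theorem window_unit (hu : ∀ x, op u x = x) {h j : ℕ} (hf : ∀ i, j ≤ i → f i = u) :
    window op u f j h = u := by
  induction h generalizing j with
  | zero => rfl
  | succ h ih => rw [window, hf j le_rfl, hu, ih fun i hi => hf i (by omega)]

theorem window_eq_sum {M : Type*} [AddCommMonoid M] (f : ℕ → M) (j h : ℕ) :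
    window (· + ·) 0 f j h = ∑ i ∈ Finset.range h, f (j + i) := by
  induction h generalizing j with
  | zero => simp [window]
  | succ h ih =>
    rw [window, ih, Finset.sum_range_succ', add_comm]
    simp [add_assoc, add_comm 1]

theorem window_eq_prod {M : Type*} [CommMonoid M] (f : ℕ → M) (j h : ℕ) :
    window (· * ·) 1 f j h = ∏ i ∈ Finset.range h, f (j + i) := by
  induction h generalizing j with
  | zero => simp [window]
  | succ h ih =>
    rw [window, ih, Finset.prod_range_succ', mul_comm]
    simp [add_assoc, add_comm 1]

end Window

/-- Replace every entry of the array `a` with `d + 1` indices by the combination of the entries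
from this one on along the last index. -/
def scan (τ : Ty) (op : Exp τ → Exp τ → Exp τ) (u : Exp τ) (a d : ℕ) : Prog :=
  .seq (.wset 5 (cube 0) (.lit 1))
    (.loop (.wlt (.reg 5) (.reg 3))
      (.seq
        (.set τ a (cube (d + 1)) (op (.get τ a fun i : Fin (d + 1) => .pid i)
          (.sel τ (.wlt (.wadd (.pid d) (.reg 5)) (.reg 3))
            (.get τ a (snocIdx d (.wadd (.pid d) (.reg 5)))) u)))
        (.wset 5 (cube 0) (.wadd (.reg 5) (.reg 5)))))

/-- Doubling: after `i` passes each entry combines the `2 ^ i` entries that start there, positions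
from `b` on counting as the unit. Reads precede writes in a parallel statement, so the update may be
made in place. -/
theorem scan_spec {τ : Ty} {op : Exp τ → Exp τ → Exp τ} {u : Exp τ} {opv : τ.Val → τ.Val → τ.Val}
    {uv : τ.Val} (hop : ∀ s p x y, (op x y).eval s p = opv (x.eval s p) (y.eval s p))
    (hu : ∀ s p, u.eval s p = uv) (hassoc : ∀ x y z, opv (opv x y) z = opv x (opv y z))
    (hul : ∀ x, opv uv x = x) (hur : ∀ x, opv x uv = x) {a d b t : ℕ} (ha : a ≠ 3) (ha' : a ≠ 5)
    (ht : Nat.clog 2 b ≤ t) {s : Config} (hs : s.word 3 [] = b) :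
    Det t (scan τ op u a d) s fun s' => ∀ J x, J.length = d → (∀ y ∈ J, y < b) → x < b →
      s'.mem τ a (J ++ [x]) =
        window opv uv (fun y => if y < b then s.mem τ a (J ++ [y]) else uv) x
          (2 ^ Nat.clog 2 b) := by
  set F : List ℕ → ℕ → τ.Val := fun J y => if y < b then s.mem τ a (J ++ [y]) else uv with hF
  refine Det.seq (Q := fun s₁ => s₁.word 5 [] = 1 ∧ s₁.word 3 [] = b ∧
    s₁.mem τ a = s.mem τ a) (Det.wset fun s₁ h1 h2 => ⟨?_, ?_, ?_⟩) ?_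
  · simp [h1, box, Exp.eval]
  · simp [h1, hs]
  · cases τ <;> simp [Config.mem, h1, h2, Function.update_of_ne ha']
  rintro s₁ ⟨h5, h3, hm⟩
  refine (Det.loop (fun i s' => s'.word 5 [] = 2 ^ i ∧ s'.word 3 [] = b ∧
    ∀ J x, J.length = d → (∀ y ∈ J, y < b) → x < b →
      s'.mem τ a (J ++ [x]) = window opv uv (F J) x (2 ^ i)) ht ?_ ?_ ?_ ?_).mono
    fun s' h => h.2.2
  · refine ⟨by simpa using h5, h3, fun J x _ _ hx => ?_⟩
    rw [hm, pow_zero]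
    simp [window, hur, hF, hx]
  · rintro i s' u m ⟨k1, k2, k3⟩
    refine ⟨k1, k2, ?_⟩
    cases τ <;> exact k3
  · rintro i s' hi ⟨k1, k2, k3⟩
    have hlt : 2 ^ i < b := (Nat.lt_clog_iff_pow_lt one_lt_two).1 hi
    refine ⟨by simp [Exp.ctrl, Exp.eval, k1, k2, hlt], ?_⟩
    refine Det.seq (Q := fun s'' => s''.word 5 [] = 2 ^ i ∧ s''.word 3 [] = b ∧
      ∀ J x, J.length = d → (∀ y ∈ J, y < b) → x < b →
        s''.mem τ a (J ++ [x]) = window opv uv (F J) x (2 ^ (i + 1)))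
      (Det.set ha ha' fun s'' l1 l3 l5 => ⟨by rw [l5, k1], by rw [l3, k2], ?_⟩) ?_
    · intro J x hJ hJb hx
      have hmem : J ++ [x] ∈ box (List.replicate (d + 1) (s'.word 3 [])) := by
        rw [mem_box_replicate, k2]
        refine ⟨by simp [hJ], fun y hy => ?_⟩
        rcases List.mem_append.1 hy with h | h
        · exact hJb y h
        · rw [List.mem_singleton.1 h]; exact hx
      have hxd : (J ++ [x]).getD d 0 = x := by
        subst hJ; simp
      rw [l1, if_pos hmem, hop, Exp.eval_get, eval_pids s' (by simp [hJ]), Exp.eval_sel,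
        Exp.eval_get, eval_snocIdx s' hJ (List.prefix_append _ _), k3 J x hJ hJb hx, hu, pow_succ,
        mul_two, window_add hassoc hul]
      congr 1
      simp only [Exp.eval, Exp.eval_reg, k1, k2, hxd]
      by_cases hlt' : x + 2 ^ i < b
      · simp only [hlt', if_true]
        simp only [ne_eq, one_ne_zero, not_false_eq_true, if_true]
        exact k3 J _ hJ hJb hlt'
      · simp only [hlt', if_false]
        simp only [ne_eq, not_true_eq_false, if_false]
        rw [window_unit hul]
        intro y hy
        exact if_neg (by omega)
    · rintro s'' ⟨l5, l3, lm⟩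
      refine Det.wset fun s₃ m1 m2 => ⟨?_, ?_, ?_⟩
      · simp [m1, box, Exp.eval, l5, pow_succ, mul_two]
      · simp [m1, l3]
      · have : s₃.mem τ a = s''.mem τ a := by
          cases τ <;> simp [Config.mem, m1, m2, Function.update_of_ne ha']
        rw [this]; exact lm
  · rintro s' ⟨k1, k2, -⟩
    have := Nat.le_pow_clog one_lt_two b
    simp [Exp.ctrl, Exp.eval, k1, k2, this]

/-- The window has length at least `b` and therefore reaches the end of the array; what lies beyond
contributes zero. -/
theorem sum_window {M : Type*} [AddCommMonoid M] (f : ℕ → M) (b x : ℕ) :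
    window (· + ·) 0 (fun y => if y < b then f y else 0) x (2 ^ Nat.clog 2 b) =
      ∑ y ∈ Finset.Ico x b, f y := by
  have h := Nat.le_pow_clog one_lt_two b
  rw [window_eq_sum, Finset.sum_Ico_eq_sum_range,
    ← Finset.sum_subset (Finset.range_subset_range.2 (show b - x ≤ 2 ^ Nat.clog 2 b by omega))]
  · exact Finset.sum_congr rfl fun i hi => if_pos (by rw [Finset.mem_range] at hi; omega)
  · intro i _ hi
    exact if_neg (by rw [Finset.mem_range] at hi; omega)

theorem prod_window {M : Type*} [CommMonoid M] (f : ℕ → M) (b : ℕ) :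
    window (· * ·) 1 (fun y => if y < b then f y else 1) 0 (2 ^ Nat.clog 2 b) =
      ∏ y ∈ Finset.range b, f y := by
  have h := Nat.le_pow_clog one_lt_two b
  rw [window_eq_prod, ← Finset.prod_subset (Finset.range_subset_range.2 h)]
  · exact Finset.prod_congr rfl fun i hi => by
      rw [zero_add]; exact if_pos (Finset.mem_range.1 hi)
  · intro i _ hi
    rw [zero_add]
    exact if_neg (by rw [Finset.mem_range] at hi; omega)

/-- Suffix sums of words along the last index. -/
def wordSums (a d : ℕ) : Prog := scan .word .wadd (.lit 0) a d

/-- Suffix sums of reals along the last index. -/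
def realSums (a d : ℕ) : Prog := scan .real .radd (.ofWord (.lit 0)) a d

/-- Suffix products of reals along the last index. -/
def realProds (a d : ℕ) : Prog := scan .real .rmul (.ofWord (.lit 1)) a d

section Scans

variable {a d b t : ℕ} {s : Config}

theorem wordSums_spec (ha : a ≠ 3) (ha' : a ≠ 5) (ht : Nat.clog 2 b ≤ t) (hs : s.word 3 [] = b) :
    Det t (wordSums a d) s fun s' => ∀ J x, J.length = d → (∀ y ∈ J, y < b) → x < b →
      s'.word a (J ++ [x]) = ∑ y ∈ Finset.Ico x b, s.word a (J ++ [y]) := by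
  refine (scan_spec (τ := .word) (opv := fun x y : ℕ => x + y) (uv := (0 : ℕ))
    (fun s p x y => by rw [Exp.eval]) (fun s p => by rw [Exp.eval]) (fun x y z => Nat.add_assoc x y z)
    (fun x => Nat.zero_add x) (fun x => Nat.add_zero x) ha ha' ht hs).mono fun s' h J x hJ hJb hx => ?_
  exact (h J x hJ hJb hx).trans (sum_window (M := ℕ) _ b x)

theorem realSums_spec (ha : a ≠ 3) (ha' : a ≠ 5) (ht : Nat.clog 2 b ≤ t) (hs : s.word 3 [] = b) :
    Det t (realSums a d) s fun s' => ∀ J x, J.length = d → (∀ y ∈ J, y < b) → x < b →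
      s'.real a (J ++ [x]) = ∑ y ∈ Finset.Ico x b, s.real a (J ++ [y]) := by
  refine (scan_spec (τ := .real) (opv := fun x y : ℝ => x + y) (uv := (0 : ℝ))
    (fun s p x y => by rw [Exp.eval]) (fun s p => by simp [Exp.eval]) (fun x y z => add_assoc x y z)
    (fun x => zero_add x) (fun x => add_zero x) ha ha' ht hs).mono fun s' h J x hJ hJb hx => ?_
  exact (h J x hJ hJb hx).trans (sum_window (M := ℝ) _ b x)

theorem realProds_spec (ha : a ≠ 3) (ha' : a ≠ 5) (ht : Nat.clog 2 b ≤ t)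
    (hs : s.word 3 [] = b) (hb : 0 < b) :
    Det t (realProds a d) s fun s' => ∀ J, J.length = d → (∀ y ∈ J, y < b) →
      s'.real a (J ++ [0]) = ∏ y ∈ Finset.range b, s.real a (J ++ [y]) := by
  refine (scan_spec (τ := .real) (opv := fun x y : ℝ => x * y) (uv := (1 : ℝ))
    (fun s p x y => by rw [Exp.eval]) (fun s p => by simp [Exp.eval]) (fun x y z => mul_assoc x y z)
    (fun x => one_mul x) (fun x => mul_one x) ha ha' ht hs).mono fun s' h J hJ hJb => ?_
  exact (h J 0 hJ hJb hb).trans (prod_window (M := ℝ) _ b)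

/-- Sum a real array with `d + 1` indices over its last index. -/
def collapse (a d : ℕ) : Prog :=
  .seq (realSums a d) (.rset a (cube d) (.rget a (snocIdx d (.lit 0))))

theorem collapse_spec (ha : a ≠ 3) (ha' : a ≠ 5) (ht : Nat.clog 2 b ≤ t) (hs : s.word 3 [] = b)
    (hb : 0 < b) :
    Det t (collapse a d) s fun s' => ∀ J, J.length = d → (∀ y ∈ J, y < b) →
      s'.real a J = ∑ y ∈ Finset.range b, s.real a (J ++ [y]) := by
  refine Det.seq (realSums_spec (d := d) ha ha' ht hs).frame ?_
  rintro s₁ ⟨h1, hw, -⟩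
  have h3 : s₁.word 3 [] = b := by rw [hw 3 (by simp [realSums, scan, Prog.keepsWord, Prog.set]), hs]
  refine Det.rset fun s' h2 _ J hJ hJb => ?_
  rw [h2, Function.update_self, if_pos (mem_box_replicate.2 ⟨hJ, h3 ▸ hJb⟩)]
  simp only [Exp.eval]
  rw [eval_snocIdx s₁ hJ (List.prefix_refl _)]
  simp only [Exp.eval]
  rw [h1 J 0 hJ hJb hb, Finset.range_eq_Ico]

end Scans

/-! ### The Faddeev–LeVerrier recursion as a matrix power -/

/-- Indices of the entries of the coefficients of the adjugate: order, row, column, degree. -/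
abbrev FLIdx (b : ℕ) : Type := Fin b × Fin b × Fin b × Fin b

section Transition

open Polynomial

variable {b : ℕ}

/-- The matrix of one step of the Faddeev–LeVerrier recursion for `markRows L T`. -/
noncomputable def flStep (L : Matrix (Fin b) (Fin b) ℝ) (T : Finset (Fin b)) :
    Matrix (FLIdx b) (FLIdx b) ℝ := Matrix.of fun I J =>
  if (I.1 : ℕ) ≠ 0 then
    if (I.1 : ℕ) = J.1 + 1 then
      (if I.2.1 = I.2.2.1 ∧ (I.2.2.2 : ℕ) = J.2.2.2 + (if J.2.2.1 ∈ T then 1 else 0) then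
        L J.2.2.1 J.2.1 / (I.1 : ℕ) else 0) -
      (if J.2.2.1 = I.2.2.1 ∧ (I.2.2.2 : ℕ) = J.2.2.2 + (if I.2.1 ∈ T then 1 else 0) then
        L I.2.1 J.2.1 else 0)
    else 0
  else if (J.1 : ℕ) = 0 ∧ (J.2.1 : ℕ) = 0 ∧ (J.2.2.1 : ℕ) = 0 ∧ (J.2.2.2 : ℕ) = 0 ∧
    I.2.1 = I.2.2.1 ∧ (I.2.2.2 : ℕ) = 0 then 1 else 0

/-- Multiplication by a marked entry is a shift of the degree index. Keeping only degrees below `b`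
loses nothing, since coefficient `d` of the product involves no coefficient beyond `d`. -/
theorem sum_shift_coeff (p : ℝ[X]) (x : ℝ) (c : Prop) [Decidable c] (d : Fin b) :
    ∑ e : Fin b, (if (d : ℕ) = e + (if c then 1 else 0) then x else 0) * p.coeff e =
      ((if c then X else 1) * C x * p).coeff d := by
  by_cases hc : c
  · simp only [hc, if_true]
    rw [mul_assoc]
    rcases Nat.eq_zero_or_pos (d : ℕ) with h | h
    · rw [h, coeff_X_mul_zero]
      exact Finset.sum_eq_zero fun e _ => by rw [if_neg (by omega), zero_mul]
    · obtain ⟨m, hm⟩ : ∃ m, (d : ℕ) = m + 1 := ⟨d - 1, by omega⟩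
      have hmb : m < b := by omega
      rw [hm, coeff_X_mul, coeff_C_mul, Finset.sum_eq_single ⟨m, hmb⟩]
      · simp
      · intro e _ he
        rw [if_neg (fun h => he (Fin.ext (by simp; omega))), zero_mul]
      · simp
  · simp only [hc, if_false, add_zero, one_mul]
    rw [coeff_C_mul, Finset.sum_eq_single d]
    · simp
    · intro e _ he
      rw [if_neg (fun h => he (Fin.ext h.symm)), zero_mul]
    · simp

/-- The coordinate `(0, 0, 0, 0)` serves as the constant `1`: it reproduces itself and regenerates
the identity matrix at order zero in every step. Order `k` is obtained from order `k - 1`, so after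
`N` steps all orders below `N` are correct, and additional steps do no harm. -/
theorem flStep_pow [NeZero b] (L : Matrix (Fin b) (Fin b) ℝ) (T : Finset (Fin b)) (N : ℕ) :
    ∀ k a c d : Fin b, (k : ℕ) + 1 ≤ N →
      (flStep L T ^ N) (k, a, c, d) (0, 0, 0, 0) = (adjCoeff (markRows L T) k a c).coeff d := by
  induction N with
  | zero => intro k a c d h; omega
  | succ N ih =>
    have hstar : (flStep L T ^ N) (0, 0, 0, 0) (0, 0, 0, 0) = 1 := by
      cases N with
      | zero => simp
      | succ N =>
        rw [ih 0 0 0 0 (by simp), Fin.val_zero, adjCoeff_zero]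
        simp
    intro k a c d hk
    rw [pow_succ', Matrix.mul_apply]
    rcases Nat.eq_zero_or_pos (k : ℕ) with h0 | hpos
    · rw [Finset.sum_eq_single (0, 0, 0, 0)]
      · rw [hstar, mul_one, h0, adjCoeff_zero]
        simp only [flStep, Matrix.of_apply, h0, ne_eq, not_true_eq_false, if_false, Fin.val_zero,
          true_and]
        by_cases hac : a = c <;> simp [hac, Matrix.one_apply, coeff_one]
      · rintro ⟨k', a', c', d'⟩ _ hne
        have : ¬((k' : ℕ) = 0 ∧ (a' : ℕ) = 0 ∧ (c' : ℕ) = 0 ∧ (d' : ℕ) = 0 ∧ a = c ∧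
            (d : ℕ) = 0) := by
          rintro ⟨h1, h2, h3, h4, -⟩
          refine hne ?_
          simp only [Prod.mk.injEq]
          exact ⟨Fin.ext (by simpa using h1), Fin.ext (by simpa using h2),
            Fin.ext (by simpa using h3), Fin.ext (by simpa using h4)⟩
        have hz : flStep L T (k, a, c, d) (k', a', c', d') = 0 := by
          simp only [flStep, Matrix.of_apply, h0, ne_eq, not_true_eq_false, if_false]
          exact if_neg this
        rw [hz, zero_mul]
      · simp
    · obtain ⟨κ, hκ⟩ : ∃ κ, (k : ℕ) = κ + 1 := ⟨k - 1, by omega⟩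
      have hκb : κ < b := by omega
      have hV : ∀ a' c' d', (flStep L T ^ N) (⟨κ, hκb⟩, a', c', d') (0, 0, 0, 0) =
          (adjCoeff (markRows L T) κ a' c').coeff d' := fun a' c' d' => ih _ _ _ _ (by simp; omega)
      have hk' : ∀ k' : Fin b, (k : ℕ) = k' + 1 ↔ k' = ⟨κ, hκb⟩ := fun k' => by
        rw [Fin.ext_iff, hκ]; simp only; omega
      rw [Fintype.sum_prod_type, Finset.sum_eq_single ⟨κ, hκb⟩]
      rotate_left
      · intro k' _ hne
        refine Finset.sum_eq_zero fun J _ => ?_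
        have : ¬(k : ℕ) = k' + 1 := fun h => hne ((hk' k').1 h)
        simp only [flStep, Matrix.of_apply, this, if_false]
        rw [if_pos (by omega), zero_mul]
      · simp
      simp only [Fintype.sum_prod_type, hV]
      have hW : ∀ a' c' d', flStep L T (k, a, c, d) (⟨κ, hκb⟩, a', c', d') =
          (if a = c then (1 : ℝ) else 0) * (1 / (κ + 1)) *
            (if (d : ℕ) = d' + (if c' ∈ T then 1 else 0) then L c' a' else 0) -
          (if c' = c then 1 else 0) *
            (if (d : ℕ) = d' + (if a ∈ T then 1 else 0) then L a a' else 0) := fun a' c' d' => by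
        simp only [flStep, Matrix.of_apply, ne_eq, show (k : ℕ) ≠ 0 by omega, not_false_eq_true,
          if_true]
        rw [if_pos hκ, hκ]
        congr 1
        · by_cases h1 : a = c
          · by_cases h2 : (d : ℕ) = d' + (if c' ∈ T then 1 else 0)
            · rw [if_pos ⟨h1, h2⟩, if_pos h1, if_pos h2]
              push_cast
              ring
            · rw [if_neg fun h => h2 h.2, if_neg h2, mul_zero]
          · rw [if_neg fun h => h1 h.1, if_neg h1, zero_mul, zero_mul]
        · by_cases h1 : c' = c
          · by_cases h2 : (d : ℕ) = d' + (if a ∈ T then 1 else 0)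
            · rw [if_pos ⟨h1, h2⟩, if_pos h1, if_pos h2, one_mul]
            · rw [if_neg fun h => h2 h.2, if_neg h2, mul_zero]
          · rw [if_neg fun h => h1 h.1, if_neg h1, zero_mul]
      simp only [hW, sub_mul, Finset.sum_sub_distrib]
      -- The trace of the product, divided by its order, supplies the sum of minors on the diagonal.
      have e1 : ∑ a', ∑ c', ∑ d' : Fin b, (if a = c then (1 : ℝ) else 0) * (1 / (κ + 1)) *
          (if (d : ℕ) = d' + (if c' ∈ T then 1 else 0) then L c' a' else 0) *
            (adjCoeff (markRows L T) κ a' c').coeff d' =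
          (minorSum (markRows L T) (κ + 1) * (1 : Matrix (Fin b) (Fin b) ℝ[X]) a c).coeff d := by
        have ht := congrArg (fun p : ℝ[X] => p.coeff d) (trace_mul_adjCoeff (markRows L T) κ)
        simp only [Matrix.trace, Matrix.diag_apply, Matrix.mul_apply, finsetSum_coeff] at ht
        have h2 : ((κ + 1 : ℕ) * minorSum (markRows L T) (κ + 1)).coeff d =
            ((κ : ℝ) + 1) * (minorSum (markRows L T) (κ + 1)).coeff d := by
          rw [← C_eq_natCast, coeff_C_mul]
          push_cast
          ring
        rw [h2] at ht
        simp only [mul_assoc, ← Finset.mul_sum]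
        simp only [← mul_assoc, sum_shift_coeff]
        rw [Finset.sum_comm]
        have h3 : ∀ a' c', ((if c' ∈ T then X else 1) * C (L c' a') *
            adjCoeff (markRows L T) κ a' c').coeff d =
            (markRows L T c' a' * adjCoeff (markRows L T) κ a' c').coeff d := fun a' c' => rfl
        simp only [h3]
        rw [ht]
        have : (κ : ℝ) + 1 ≠ 0 := by positivity
        by_cases hac : a = c
        · rw [if_pos hac, hac, Matrix.one_apply_eq, mul_one]
          field_simp
        · simp [hac]
      -- The remaining term of the recursion is the ordinary product with the marked matrix.
      have e2 : ∑ a', ∑ c', ∑ d' : Fin b, (if c' = c then (1 : ℝ) else 0) *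
          (if (d : ℕ) = d' + (if a ∈ T then 1 else 0) then L a a' else 0) *
            (adjCoeff (markRows L T) κ a' c').coeff d' =
          ((markRows L T * adjCoeff (markRows L T) κ) a c).coeff d := by
        have h2 : ∀ a' c', ∑ d' : Fin b, (if c' = c then (1 : ℝ) else 0) *
            (if (d : ℕ) = d' + (if a ∈ T then 1 else 0) then L a a' else 0) *
            (adjCoeff (markRows L T) κ a' c').coeff d' = (if c' = c then (1 : ℝ) else 0) *
              (markRows L T a a' * adjCoeff (markRows L T) κ a' c').coeff d := fun a' c' => by
          simp only [mul_assoc (if c' = c then (1 : ℝ) else 0), ← Finset.mul_sum, sum_shift_coeff]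
          rfl
        simp only [h2]
        simp only [ite_mul, one_mul, zero_mul, Finset.sum_ite_eq', Finset.mem_univ, if_true]
        rw [Matrix.mul_apply, finsetSum_coeff]
      rw [e1, e2, hκ, adjCoeff_succ, Matrix.sub_apply, Matrix.smul_apply, smul_eq_mul, coeff_sub]

end Transition

/-! ### The program for the conditioned minor sums -/

/-- Equality test for words. -/
def Exp.weq (x y : Exp .word) : Exp .word := .wite (.wlt x y) (.lit 0) (.wite (.wlt y x) (.lit 0) (.lit 1))

/-- Conjunction of truth values. -/
def Exp.wand (x y : Exp .word) : Exp .word := .wite x y (.lit 0)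

theorem Exp.eval_weq (s : Config) (p : List ℕ) (x y : Exp .word) :
    ((Exp.weq x y).eval s p : ℕ) = if (x.eval s p : ℕ) = (y.eval s p : ℕ) then 1 else 0 := by
  have key : ∀ m n : ℕ, (if (if m < n then 1 else 0) ≠ 0 then 0 else
      if (if n < m then 1 else 0) ≠ 0 then 0 else 1) = if m = n then 1 else 0 := fun m n => by
    rcases lt_trichotomy m n with h | h | h
    · simp [h, h.ne]
    · simp [h]
    · simp [h, h.ne', h.not_gt]
  simp only [Exp.weq, Exp.eval]
  exact key _ _

theorem Exp.eval_wand (s : Config) (p : List ℕ) (x y : Exp .word) :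
    ((Exp.wand x y).eval s p : ℕ) = if (x.eval s p : ℕ) ≠ 0 then (y.eval s p : ℕ) else 0 := by
  simp only [Exp.wand, Exp.eval]

/-- The entries of `flStep L T`, with the indicator of `T` in the word array `a`. -/
def flEntry (a : ℕ) : Exp .real :=
  .rite (.pid 0)
    (.rite (.weq (.pid 0) (.wadd (.pid 4) (.lit 1)))
      (.rsub
        (.rite (.wand (.weq (.pid 1) (.pid 2))
            (.weq (.pid 3) (.wadd (.pid 7) (.wget a ![.pid 6]))))
          (.rdiv (.rget 0 ![.pid 6, .pid 5]) (.ofWord (.pid 0))) (.ofWord (.lit 0)))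
        (.rite (.wand (.weq (.pid 6) (.pid 2))
            (.weq (.pid 3) (.wadd (.pid 7) (.wget a ![.pid 1]))))
          (.rget 0 ![.pid 1, .pid 5]) (.ofWord (.lit 0))))
      (.ofWord (.lit 0)))
    (.ofWord (.wand (.weq (.pid 4) (.lit 0)) (.wand (.weq (.pid 5) (.lit 0))
      (.wand (.weq (.pid 6) (.lit 0)) (.wand (.weq (.pid 7) (.lit 0))
        (.wand (.weq (.pid 1) (.pid 2)) (.weq (.pid 3) (.lit 0))))))))

/-- Square the matrix in real array `2`. -/
def square : Prog :=
  .seq (.rset 2 (cube 12) (.rmul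
      (.rget 2 ![.pid 0, .pid 1, .pid 2, .pid 3, .pid 8, .pid 9, .pid 10, .pid 11])
      (.rget 2 ![.pid 8, .pid 9, .pid 10, .pid 11, .pid 4, .pid 5, .pid 6, .pid 7])))
    (.seq (collapse 2 11) (.seq (collapse 2 10) (.seq (collapse 2 9) (collapse 2 8))))

/-- Compute the coefficients of the adjugate for the set with indicator in word array `a`. -/
def faddeevLeVerrier (a : ℕ) : Prog :=
  .seq (.rset 2 (cube 8) (flEntry a))
    (.seq (.wset 6 (cube 0) (.lit 1))
      (.loop (.wlt (.reg 6) (.reg 3))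
        (.seq square (.wset 6 (cube 0) (.wadd (.reg 6) (.reg 6))))))

/-- The coordinates of an index. -/
def FLIdx.toList {b : ℕ} (I : FLIdx b) : List ℕ := [I.1, I.2.1, I.2.2.1, I.2.2.2]

theorem FLIdx.lt_of_mem {b : ℕ} (I : FLIdx b) {y : ℕ} (hy : y ∈ I.toList) : y < b := by
  simp only [FLIdx.toList, List.mem_cons, List.not_mem_nil, or_false] at hy
  rcases hy with h | h | h | h <;> rw [h] <;> exact Fin.isLt _

/-- The set `T` has its indicator in word array `a`. -/
def HoldsSet {b : ℕ} (s : Config) (a : ℕ) (T : Finset (Fin b)) : Prop :=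
  ∀ i : Fin b, s.word a [(i : ℕ)] = if i ∈ T then 1 else 0

/-- The matrix `L` is in real array `0`. -/
def HoldsMatrix {b : ℕ} (s : Config) (L : Matrix (Fin b) (Fin b) ℝ) : Prop :=
  ∀ i j : Fin b, s.real 0 [(i : ℕ), (j : ℕ)] = L i j

section FLProgram

variable {b t : ℕ}

theorem eval_flEntry {L : Matrix (Fin b) (Fin b) ℝ} {T : Finset (Fin b)} {a : ℕ} {s : Config}
    (hT : HoldsSet s a T) (hL : HoldsMatrix s L) (I J : FLIdx b) :
    ((flEntry a).eval s (I.toList ++ J.toList) : ℝ) = flStep L T I J := by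
  obtain ⟨k, i, j, d⟩ := I
  obtain ⟨k', i', j', d'⟩ := J
  have h1 := hT j'
  have h2 := hT i
  have h3 := hL j' i'
  have h4 := hL i i'
  simp only [flEntry, Exp.eval, Exp.eval_weq, Exp.eval_wand, FLIdx.toList, List.cons_append,
    List.nil_append, List.getD_cons_zero, List.getD_cons_succ, List.ofFn_succ, List.ofFn_zero,
    Matrix.cons_val_zero, Matrix.cons_val_succ, flStep, Matrix.of_apply, h1, h2, h3, h4]
  by_cases c1 : (k : ℕ) = 0
  · simp only [c1, ne_eq, not_true_eq_false, if_false]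
    by_cases e1 : (k' : ℕ) = 0 <;> by_cases e2 : (i' : ℕ) = 0 <;> by_cases e3 : (j' : ℕ) = 0 <;>
      by_cases e4 : (d' : ℕ) = 0 <;> by_cases e5 : (i : ℕ) = j <;>
      simp [e1, e2, e3, e4, e5, Fin.ext_iff]
  · simp only [c1, ne_eq, not_false_eq_true, if_true]
    by_cases c2 : (k : ℕ) = k' + 1
    · simp only [c2, if_true, one_ne_zero, not_false_eq_true]
      congr 1
      · by_cases e1 : (i : ℕ) = j <;> by_cases e2 : (d : ℕ) = d' + (if j' ∈ T then 1 else 0) <;>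
          simp [e1, e2, Fin.ext_iff]
      · by_cases e1 : (j' : ℕ) = j <;> by_cases e2 : (d : ℕ) = d' + (if i ∈ T then 1 else 0) <;>
          simp [e1, e2, Fin.ext_iff]
    · simp [c2]

/-- All products `M I K * M K J` are formed at once, and the four coordinates of `K` are then summed
out one after the other. These twelve indices determine the number of processors. -/
theorem square_spec (ht : Nat.clog 2 b ≤ t) (hb : 0 < b) {s : Config} (hs : s.word 3 [] = b)
    {M : Matrix (FLIdx b) (FLIdx b) ℝ}
    (hM : ∀ I J : FLIdx b, s.real 2 (I.toList ++ J.toList) = M I J) :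
    Det t square s fun s' => ∀ I J : FLIdx b, s'.real 2 (I.toList ++ J.toList) = (M ^ 2) I J := by
  refine Det.seq (Q := fun s₁ => s₁.word 3 [] = b ∧ ∀ I J K : FLIdx b,
    s₁.real 2 (I.toList ++ J.toList ++ K.toList) = M I K * M K J)
    (Det.rset fun s₁ h1 h2 => ⟨by rw [h2, hs], fun I J K => ?_⟩) ?_
  · rw [h1, Function.update_self, if_pos, ← hM, ← hM]
    · simp [FLIdx.toList, Exp.eval, List.ofFn_succ]
    · rw [mem_box_replicate, hs]
      refine ⟨by simp [FLIdx.toList], fun y hy => ?_⟩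
      rcases List.mem_append.1 hy with h | h
      · rcases List.mem_append.1 h with h | h
        · exact I.lt_of_mem h
        · exact J.lt_of_mem h
      · exact K.lt_of_mem h
  rintro s₁ ⟨e1, hP⟩
  have kw : ∀ d, (collapse 2 d).keepsWord 3 = true := fun d => rfl
  refine Det.seq (collapse_spec (by decide) (by decide) ht e1 hb).frame ?_
  rintro s₂ ⟨h2, w2, -⟩
  have e2 : s₂.word 3 [] = b := by rw [w2 3 (kw _), e1]
  refine Det.seq (collapse_spec (by decide) (by decide) ht e2 hb).frame ?_
  rintro s₃ ⟨h3, w3, -⟩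
  have e3 : s₃.word 3 [] = b := by rw [w3 3 (kw _), e2]
  refine Det.seq (collapse_spec (by decide) (by decide) ht e3 hb).frame ?_
  rintro s₄ ⟨h4, w4, -⟩
  have e4 : s₄.word 3 [] = b := by rw [w4 3 (kw _), e3]
  refine (collapse_spec (by decide) (by decide) ht e4 hb).mono fun s₅ h5 I J => ?_
  have hlt : ∀ y ∈ I.toList ++ J.toList, y < b := fun y hy => by
    rcases List.mem_append.1 hy with h | h
    · exact I.lt_of_mem h
    · exact J.lt_of_mem h
  have hsnoc : ∀ {l : List ℕ} {x : ℕ}, (∀ y ∈ l, y < b) → x < b → ∀ y ∈ l ++ [x], y < b := by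
    intro l x hl hx y hy
    rcases List.mem_append.1 hy with h | h
    · exact hl y h
    · rw [List.mem_singleton.1 h]; exact hx
  rw [h5 _ (by simp [FLIdx.toList]) hlt, pow_two, Matrix.mul_apply, Fintype.sum_prod_type,
    Finset.sum_range]
  refine Finset.sum_congr rfl fun x _ => ?_
  have l1 := hsnoc hlt x.isLt
  rw [h4 _ (by simp [FLIdx.toList]) l1, Fintype.sum_prod_type, Finset.sum_range]
  refine Finset.sum_congr rfl fun y _ => ?_
  have l2 := hsnoc l1 y.isLt
  rw [h3 _ (by simp [FLIdx.toList]) l2, Fintype.sum_prod_type, Finset.sum_range]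
  refine Finset.sum_congr rfl fun z _ => ?_
  have l3 := hsnoc l2 z.isLt
  rw [h2 _ (by simp [FLIdx.toList]) l3, Finset.sum_range]
  refine Finset.sum_congr rfl fun w _ => ?_
  rw [← hP I J (x, y, z, w)]
  simp [FLIdx.toList]

/-- Squaring stops at an exponent `2 ^ Nat.clog 2 b ≥ b`, enough for every order `k < b`. -/
theorem faddeevLeVerrier_spec [NeZero b] (ht : Nat.clog 2 b ≤ t)
    {L : Matrix (Fin b) (Fin b) ℝ} {T : Finset (Fin b)} {a : ℕ} {s : Config}
    (hs : s.word 3 [] = b) (hT : HoldsSet s a T) (hL : HoldsMatrix s L) :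
    Det t (faddeevLeVerrier a) s fun s' => ∀ k i j d : Fin b,
      s'.real 2 [(k : ℕ), i, j, d, 0, 0, 0, 0] = (adjCoeff (markRows L T) k i j).coeff d := by
  have hb : 0 < b := Nat.pos_of_ne_zero (NeZero.ne b)
  refine Det.seq (Q := fun s₁ => s₁.word 3 [] = b ∧ ∀ I J : FLIdx b,
    s₁.real 2 (I.toList ++ J.toList) = flStep L T I J)
    (Det.rset fun s₁ h1 h2 => ⟨by rw [h2, hs], fun I J => ?_⟩) ?_
  · rw [h1, Function.update_self, if_pos, eval_flEntry hT hL]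
    rw [mem_box_replicate, hs]
    refine ⟨by simp [FLIdx.toList], fun y hy => ?_⟩
    rcases List.mem_append.1 hy with h | h
    · exact I.lt_of_mem h
    · exact J.lt_of_mem h
  rintro s₁ ⟨e1, hM⟩
  refine Det.seq (Q := fun s₂ => s₂.word 6 [] = 1 ∧ s₂.word 3 [] = b ∧ ∀ I J : FLIdx b,
    s₂.real 2 (I.toList ++ J.toList) = flStep L T I J)
    (Det.wset fun s₂ h1 h2 => ⟨by simp [h1, box, Exp.eval], by simp [h1, e1], by rw [h2]; exact hM⟩) ?_
  rintro s₂ ⟨f6, f3, hM⟩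
  refine (Det.loop (N := Nat.clog 2 b) (fun i s' => s'.word 6 [] = 2 ^ i ∧ s'.word 3 [] = b ∧
    ∀ I J : FLIdx b, s'.real 2 (I.toList ++ J.toList) = (flStep L T ^ 2 ^ i) I J) ht
    ⟨by simpa using f6, f3, by simpa using hM⟩ (fun i s' u m h => h) ?_ ?_).mono ?_
  · rintro i s' hi ⟨k1, k2, k3⟩
    have hlt : 2 ^ i < b := (Nat.lt_clog_iff_pow_lt one_lt_two).1 hi
    refine ⟨by simp [Exp.ctrl, Exp.eval, k1, k2, hlt], ?_⟩
    refine Det.seq (square_spec ht hb k2 k3).frame ?_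
    rintro s'' ⟨l1, lw, -⟩
    have l6 : s''.word 6 [] = 2 ^ i := by rw [lw 6 rfl, k1]
    have l3 : s''.word 3 [] = b := by rw [lw 3 rfl, k2]
    refine Det.wset fun s₃ m1 m2 => ⟨?_, ?_, ?_⟩
    · simp [m1, box, Exp.eval, l6, pow_succ, mul_two]
    · simp [m1, l3]
    · intro I J
      rw [m2, l1, ← pow_mul, pow_succ]
  · rintro s' ⟨k1, k2, -⟩
    have := Nat.le_pow_clog one_lt_two b
    simp [Exp.ctrl, Exp.eval, k1, k2, this]
  · rintro s' ⟨-, -, k3⟩ k i j d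
    have hle := Nat.le_pow_clog one_lt_two b
    rw [← flStep_pow L T (2 ^ Nat.clog 2 b) k i j d (by omega), ← k3]
    simp [FLIdx.toList]

theorem faddeevLeVerrier_keepsWord (a c : ℕ) (h5 : c ≠ 5) (h6 : c ≠ 6) :
    (faddeevLeVerrier a).keepsWord c = true := by
  simp [faddeevLeVerrier, square, collapse, realSums, scan, Prog.set, Prog.keepsWord, h5.symm,
    h6.symm]

theorem faddeevLeVerrier_keepsReal (a c : ℕ) (h2 : c ≠ 2) :
    (faddeevLeVerrier a).keepsReal c = true := by
  simp [faddeevLeVerrier, square, collapse, realSums, scan, Prog.set, Prog.keepsReal, h2.symm]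

end FLProgram

/-! ### Sampling from a finite distribution with independent coins -/

section FirstSuccess

variable {b : ℕ}

/-- The first index at which the coin shows `1`. -/
noncomputable def firstSuccess (g : Fin b → Bool) : Option (Fin b) :=
  if h : ∃ i, g i = true ∧ ∀ j < i, g j = false then some h.choose else none

theorem firstSuccess_eq_some {g : Fin b → Bool} {i : Fin b} :
    firstSuccess g = some i ↔ g i = true ∧ ∀ j < i, g j = false := by
  have huniq : ∀ i i' : Fin b, (g i = true ∧ ∀ j < i, g j = false) →
      (g i' = true ∧ ∀ j < i', g j = false) → i = i' := by
    intro i i' h h'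
    rcases lt_trichotomy i i' with hlt | heq | hlt
    · have := h'.2 i hlt
      rw [h.1] at this; exact absurd this (by decide)
    · exact heq
    · have := h.2 i' hlt
      rw [h'.1] at this; exact absurd this (by decide)
  unfold firstSuccess
  split_ifs with h
  · rw [Option.some_inj]
    constructor
    · rintro rfl; exact h.choose_spec
    · exact huniq _ _ h.choose_spec
  · simp only [false_iff]
    exact fun h' => h ⟨i, h'⟩

/-- The event constrains each coin separately, so the sum factors. Coins after `i` are free and
contribute total mass one. -/
theorem sum_firstSuccess_some (h : Fin b → ℝ) (i : Fin b) :
    ∑ g : Fin b → Bool, (if firstSuccess g = some i then ∏ j, coinMass (h j) (g j) else 0) =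
      (∏ j ∈ Finset.Iio i, coinMass (h j) false) * coinMass (h i) true := by
  let m : Fin b → Bool → ENNReal := fun j c =>
    if j < i then (if c then 0 else coinMass (h j) false)
    else if j = i then (if c then coinMass (h j) true else 0) else coinMass (h j) c
  have h1 : ∀ g : Fin b → Bool,
      (if firstSuccess g = some i then ∏ j, coinMass (h j) (g j) else 0) = ∏ j, m j (g j) := by
    intro g
    split_ifs with hg
    · rw [firstSuccess_eq_some] at hg
      refine Finset.prod_congr rfl fun j _ => ?_
      by_cases hj : j < i
      · simp [m, hj, hg.2 j hj]
      · by_cases hj' : j = i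
        · subst hj'; simp [m, hg.1]
        · simp [m, hj, hj']
    · rw [firstSuccess_eq_some, not_and_or] at hg
      rcases hg with hg | hg
      · exact (Finset.prod_eq_zero (Finset.mem_univ i) (by simp [m, hg])).symm
      · push Not at hg
        obtain ⟨j, hj, hgj⟩ := hg
        have hgj : g j = true := by simpa using hgj
        exact (Finset.prod_eq_zero (Finset.mem_univ j) (by simp [m, hj, hgj])).symm
  simp only [h1]
  rw [← Fintype.prod_sum]
  have h2 : ∀ j, ∑ c, m j c = (if j < i then coinMass (h j) false else 1) *
      (if j = i then coinMass (h j) true else 1) := by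
    intro j
    rw [Fintype.sum_bool]
    by_cases hj : j < i
    · simp [m, hj, hj.ne]
    · by_cases hj' : j = i
      · subst hj'; simp [m]
      · have := coinMass_sum (h j)
        rw [Fintype.sum_bool] at this
        simp [m, hj, hj', this]
  simp only [h2, Finset.prod_mul_distrib, Finset.prod_ite_eq', Finset.mem_univ, if_true]
  congr 1
  rw [Finset.prod_ite, Finset.prod_const_one, mul_one]
  refine Finset.prod_congr ?_ fun _ _ => rfl
  ext j; simp

theorem sum_prod_coinMass {ι : Type*} [Fintype ι] [DecidableEq ι] (h : ι → ℝ) :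
    ∑ g : ι → Bool, ∏ j, coinMass (h j) (g j) = 1 := by
  rw [← Fintype.prod_sum (fun j c => coinMass (h j) c)]
  simp only [coinMass_sum, Finset.prod_const_one]

theorem sum_firstSuccess_none (h : Fin b → ℝ) :
    ∑ g : Fin b → Bool, (if firstSuccess g = none then ∏ j, coinMass (h j) (g j) else 0) +
      ∑ i, ∑ g : Fin b → Bool,
        (if firstSuccess g = some i then ∏ j, coinMass (h j) (g j) else 0) = 1 := by
  rw [← Fintype.sum_option (f := fun o => ∑ g : Fin b → Bool,
    (if firstSuccess g = o then ∏ j, coinMass (h j) (g j) else 0)), Finset.sum_comm]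
  simp only [Finset.sum_ite_eq, Finset.mem_univ, if_true]
  exact sum_prod_coinMass h

/-- With tails `Q j`, each factor is `Q (j + 1) / Q j` and the product telescopes. -/
theorem prod_hazard (q : ℕ → ℝ) (hq : ∀ i, 0 ≤ q i) (i : ℕ) (hi : i ≤ b) :
    (∏ j ∈ Finset.range i, (1 - q j / ∑ y ∈ Finset.Ico j b, q y)) * ∑ y ∈ Finset.Ico 0 b, q y =
      ∑ y ∈ Finset.Ico i b, q y := by
  induction i with
  | zero => simp
  | succ i ih =>
    rw [Finset.prod_range_succ, mul_right_comm, ih (by omega),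
      Finset.sum_eq_sum_Ico_succ_bot (show i < b by omega)]
    set S := ∑ y ∈ Finset.Ico (i + 1) b, q y
    have hS : 0 ≤ S := Finset.sum_nonneg fun y _ => hq y
    -- If the tail vanishes, the division gives `0` by convention, and both sides are zero.
    by_cases h0 : q i + S = 0
    · have h1 : q i = 0 := by linarith [hq i]
      have h2 : S = 0 := by linarith
      simp [h1, h2]
    · field_simp
      ring

theorem hazard_mem (q : ℕ → ℝ) (hq : ∀ i, 0 ≤ q i) {i : ℕ} (hi : i < b) :
    0 ≤ q i / ∑ y ∈ Finset.Ico i b, q y ∧ q i / ∑ y ∈ Finset.Ico i b, q y ≤ 1 := by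
  have h0 : 0 ≤ ∑ y ∈ Finset.Ico i b, q y := Finset.sum_nonneg fun y _ => hq y
  have h1 : q i ≤ ∑ y ∈ Finset.Ico i b, q y :=
    Finset.single_le_sum (fun y _ => hq y) (Finset.mem_Ico.2 ⟨le_rfl, hi⟩)
  exact ⟨div_nonneg (hq i) h0, div_le_one_of_le₀ h1 h0⟩

theorem coinMass_true {q : ℝ} (h0 : 0 ≤ q) (h1 : q ≤ 1) : coinMass q true = ENNReal.ofReal q := by
  simp [coinMass, h0, h1]

theorem coinMass_false {q : ℝ} (h0 : 0 ≤ q) (h1 : q ≤ 1) :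
    coinMass q false = ENNReal.ofReal (1 - q) := by
  simp [coinMass, h0, h1]

theorem sum_firstSuccess_hazard (q : ℕ → ℝ) (hq : ∀ i, 0 ≤ q i)
    (hQ : 0 < ∑ y ∈ Finset.Ico 0 b, q y) (i : Fin b) :
    ∑ g : Fin b → Bool, (if firstSuccess g = some i then
      ∏ j : Fin b, coinMass (q j / ∑ y ∈ Finset.Ico (j : ℕ) b, q y) (g j) else 0) =
      ENNReal.ofReal (q i / ∑ y ∈ Finset.Ico 0 b, q y) := by
  rw [sum_firstSuccess_some, coinMass_true (hazard_mem q hq i.isLt).1 (hazard_mem q hq i.isLt).2]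
  have h1 : ∏ j ∈ Finset.Iio i, coinMass (q j / ∑ y ∈ Finset.Ico (j : ℕ) b, q y) false =
      ∏ j ∈ Finset.range i, ENNReal.ofReal (1 - q j / ∑ y ∈ Finset.Ico (j : ℕ) b, q y) := by
    rw [← Nat.Iio_eq_range, ← Fin.map_valEmbedding_Iio, Finset.prod_map]
    exact Finset.prod_congr rfl fun j _ =>
      coinMass_false (hazard_mem q hq j.isLt).1 (hazard_mem q hq j.isLt).2
  rw [h1, ← ENNReal.ofReal_prod_of_nonneg, ← ENNReal.ofReal_mul]
  · congr 1
    have := prod_hazard q hq i i.isLt.le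
    rw [eq_div_iff hQ.ne', mul_right_comm, this]
    set S := ∑ y ∈ Finset.Ico (i : ℕ) b, q y
    by_cases h0 : S = 0
    · have h1 : q i ≤ S := Finset.single_le_sum (fun y _ => hq y)
        (Finset.mem_Ico.2 ⟨le_rfl, i.isLt⟩)
      rw [h0, zero_mul]
      linarith [hq i]
    · field_simp
  · refine Finset.prod_nonneg fun j hj => ?_
    have := hazard_mem q hq (show j < b from (Finset.mem_range.1 hj).trans i.isLt)
    linarith [this.2]
  · intro j hj
    have := hazard_mem q hq (show j < b from (Finset.mem_range.1 hj).trans i.isLt)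
    linarith [this.2]

/-- Independent rows remain independent after applying `o` to each row. -/
theorem sum_comp_outcome {S G O : Type*} [Fintype S] [DecidableEq S] [Fintype G] [Fintype O]
    [DecidableEq O] (w : S → G → ENNReal) (o : G → O) (V : (S → O) → ENNReal) :
    ∑ g : S → G, (∏ s, w s (g s)) * V (fun s => o (g s)) =
      ∑ x : S → O, (∏ s, ∑ g : G, if o g = x s then w s g else 0) * V x := by
  classical
  have h : ∀ x : S → O, (∏ s, ∑ g : G, if o g = x s then w s g else 0) * V x =
      ∑ g : S → G, (if (fun s => o (g s)) = x then (∏ s, w s (g s)) * V x else 0) := by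
    intro x
    rw [Fintype.prod_sum, Finset.sum_mul]
    refine Finset.sum_congr rfl fun g _ => ?_
    split_ifs with hx
    · congr 1
      exact Finset.prod_congr rfl fun s _ => if_pos (congrFun hx s)
    · obtain ⟨s, hs⟩ : ∃ s, o (g s) ≠ x s := by
        by_contra hc
        push Not at hc
        exact hx (funext hc)
      rw [Finset.prod_eq_zero (Finset.mem_univ s) (if_neg hs), zero_mul]
  simp only [h]
  rw [Finset.sum_comm]
  refine Finset.sum_congr rfl fun g _ => ?_
  rw [Finset.sum_ite_eq]
  simp

/-- The set of first successes of the rows. -/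
noncomputable def firstSet (f : Fin b × Fin b → Bool) : Finset (Fin b) :=
  Finset.univ.filter fun i => ∃ s, f (s, i) = true ∧ ∀ j < i, f (s, j) = false

/-- Independent rows of coins with hazard rates as biases yield independent samples. -/
theorem sum_firstSet (q : ℕ → ℝ) (hq : ∀ i, 0 ≤ q i) (hQ : 0 < ∑ y ∈ Finset.Ico 0 b, q y)
    {l : ℕ} (hl : l ≤ b) (v : Finset (Fin b) → ENNReal) :
    ∑ f : Fin b × Fin b → Bool, (∏ x : Fin b × Fin b, coinMass (if (x.1 : ℕ) < l then
        q x.2 / ∑ y ∈ Finset.Ico (x.2 : ℕ) b, q y else 0) (f x)) * v (firstSet f) =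
      ∑ x : Fin l → Fin b, (∏ s, ENNReal.ofReal (q (x s) / ∑ y ∈ Finset.Ico 0 b, q y)) *
        v (Finset.univ.image x) := by
  classical
  let bias : Fin b → Fin b → ℝ := fun s i =>
    if (s : ℕ) < l then q i / ∑ y ∈ Finset.Ico (i : ℕ) b, q y else 0
  let V : (Fin b → Option (Fin b)) → ENNReal := fun x =>
    v (Finset.univ.filter fun i => ∃ s, x s = some i)
  have h1 : ∑ f : Fin b × Fin b → Bool, (∏ x : Fin b × Fin b, coinMass (if (x.1 : ℕ) < l then
        q x.2 / ∑ y ∈ Finset.Ico (x.2 : ℕ) b, q y else 0) (f x)) * v (firstSet f) =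
      ∑ g : Fin b → Fin b → Bool, (∏ s, ∏ i, coinMass (bias s i) (g s i)) *
        V (fun s => firstSuccess (g s)) := by
    refine Fintype.sum_equiv (Equiv.curry _ _ _) _ _ fun f => ?_
    rw [Fintype.prod_prod_type]
    congr 1
    simp only [V, firstSet, firstSuccess_eq_some]
    rfl
  rw [h1, sum_comp_outcome (fun s g => ∏ i, coinMass (bias s i) (g i)) firstSuccess V]
  set p : Fin b → Option (Fin b) → ENNReal := fun s o =>
    ∑ g : Fin b → Bool, if firstSuccess g = o then ∏ i, coinMass (bias s i) (g i) else 0 with hp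
  have hsome : ∀ (s : Fin b) (i : Fin b), (s : ℕ) < l →
      p s (some i) = ENNReal.ofReal (q i / ∑ y ∈ Finset.Ico 0 b, q y) := by
    intro s i hs
    simp only [hp, bias, hs, if_true]
    exact sum_firstSuccess_hazard q hq hQ i
  have hsome' : ∀ (s : Fin b) (i : Fin b), ¬(s : ℕ) < l → p s (some i) = 0 := by
    intro s i hs
    simp only [hp, bias, hs, if_false]
    rw [sum_firstSuccess_some]
    simp [coinMass]
  -- The probabilities of the individual outcomes already add up to one, so an active row always
  -- succeeds; the last positive weight has hazard rate one.
  have hnone : ∀ s : Fin b, (s : ℕ) < l → p s none = 0 := by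
    intro s hs
    have := sum_firstSuccess_none (bias s)
    change p s none + ∑ i, p s (some i) = 1 at this
    have h2 : ∑ i, p s (some i) = 1 := by
      rw [Finset.sum_congr rfl fun i _ => hsome s i hs, ← ENNReal.ofReal_sum_of_nonneg]
      · rw [← Finset.sum_div, ← Finset.range_eq_Ico, Finset.sum_range, div_self,
          ENNReal.ofReal_one]
        rw [← Finset.range_eq_Ico, Finset.sum_range] at hQ
        exact hQ.ne'
      · exact fun i _ => div_nonneg (hq i) hQ.le
    rw [h2] at this
    have h3 : p s none + 1 = 0 + 1 := by rw [this, zero_add]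
    exact (ENNReal.add_left_inj ENNReal.one_ne_top).1 h3
  have hnone' : ∀ s : Fin b, ¬(s : ℕ) < l → p s none = 1 := by
    intro s hs
    have := sum_firstSuccess_none (bias s)
    change p s none + ∑ i, p s (some i) = 1 at this
    rwa [Finset.sum_eq_zero fun i _ => hsome' s i hs, add_zero] at this
  -- Rows from `l` on have bias zero and never succeed. Thus only outcomes succeeding in exactly the
  -- first `l` rows have mass, and these correspond to functions on `Fin l`.
  let ext : (Fin l → Fin b) → Fin b → Option (Fin b) := fun x s =>
    if hs : (s : ℕ) < l then some (x ⟨s, hs⟩) else none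
  have hext : Function.Injective ext := by
    intro x y hxy
    funext s
    have := congrFun hxy (Fin.castLE hl s)
    simpa [ext] using this
  symm
  refine Fintype.sum_of_injective ext hext _ _ (fun x hx => ?_) fun x => ?_
  · have : ∃ s, p s (x s) = 0 := by
      by_contra hc
      push Not at hc
      have hs1 : ∀ s : Fin l, ∃ i, x (Fin.castLE hl s) = some i := by
        intro s
        rw [← Option.ne_none_iff_exists']
        intro h
        exact hc (Fin.castLE hl s) (by rw [h]; exact hnone _ s.isLt)
      choose y hy using hs1
      refine hx ⟨y, funext fun s => ?_⟩
      by_cases hs : (s : ℕ) < l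
      · simp only [ext, hs, dif_pos]
        exact (hy ⟨s, hs⟩).symm
      · simp only [ext, hs, dif_neg, not_false_eq_true]
        cases hxs : x s with
        | none => rfl
        | some i => exact absurd (by rw [hxs]; exact hsome' s i hs) (hc s)
    obtain ⟨s, hs⟩ := this
    rw [Finset.prod_eq_zero (Finset.mem_univ s) hs, zero_mul]
  · congr 1
    · refine Fintype.prod_of_injective (Fin.castLE hl) (Fin.castLE_injective hl) _ _
        (fun s hs => ?_) fun s => ?_
      · have hs' : ¬(s : ℕ) < l := fun h => hs ⟨⟨s, h⟩, rfl⟩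
        simp only [ext, hs', dif_neg, not_false_eq_true]
        exact hnone' s hs'
      · have hs' : ((Fin.castLE hl s : Fin b) : ℕ) < l := s.isLt
        simp only [ext, hs', dif_pos]
        exact (hsome _ _ hs').symm
    · simp only [V]
      congr 1
      ext i
      simp only [Finset.mem_image, Finset.mem_univ, true_and, Finset.mem_filter]
      constructor
      · rintro ⟨s, rfl⟩
        exact ⟨Fin.castLE hl s, by simp [ext]⟩
      · rintro ⟨s, hs⟩
        by_cases hs' : (s : ℕ) < l
        · simp only [ext, hs', dif_pos, Option.some_inj] at hs
          exact ⟨_, hs⟩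
        · simp [ext, hs'] at hs

end FirstSuccess

/-! ### The sampling program -/

/-- The biases of the coins, one row for each sample. -/
def hazardBias : Exp .real :=
  .rite (.wlt (.pid 0) (.reg 8)) (.rdiv (.rget 3 ![.pid 1]) (.rget 4 ![.pid 1])) (.ofWord (.lit 0))

/-- Compute the suffix sums of the weights in real array `3`. -/
def weightSums : Prog := .seq (.rset 4 (cube 1) (.rget 3 ![.pid 0])) (realSums 4 0)

/-- Compute in word array `15` the set of first successes of the coins in word array `12`. -/
def collectFirst : Prog :=
  .seq (.wset 13 (cube 2) (.wget 12 ![.pid 0, .pid 1])) (.seq (wordSums 13 1)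
    (.seq (.wset 14 (cube 2) (.wite (.wlt (.wget 13 ![.pid 1, .pid 0]) (.wget 13 ![.pid 1, .lit 0]))
        (.lit 0) (.wget 12 ![.pid 1, .pid 0])))
      (.seq (wordSums 14 1)
        (.wset 15 (cube 1) (.wite (.wget 14 ![.pid 0, .lit 0]) (.lit 1) (.lit 0))))))

/-- Draw as many independent samples as word register `8` says, with weights in real array `3`. -/
def sample : Prog := .seq weightSums (.seq (.flip 12 (cube 2) hazardBias) collectFirst)

/-- Pairs of numbers below `b` as indices. -/
def pairBox (b : ℕ) : Fin b × Fin b ≃ box (List.replicate 2 b) where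
  toFun x := ⟨[(x.1 : ℕ), (x.2 : ℕ)], by
    rw [mem_box_replicate]
    exact ⟨rfl, by simp⟩⟩
  invFun I :=
    have h := mem_box_replicate.1 I.2
    (⟨I.1[0]'(by omega), h.2 _ (List.getElem_mem _)⟩, ⟨I.1[1]'(by omega), h.2 _ (List.getElem_mem _)⟩)
  left_inv x := rfl
  right_inv I := by
    have h := mem_box_replicate.1 I.2
    ext1
    apply List.ext_getElem
    · simp [h.1]
    · intro i h1 h2
      simp at h1
      interval_cases i <;> rfl

section SampleProgram

variable {b t : ℕ}

theorem pair_mem_box (x y : Fin b) : [(x : ℕ), (y : ℕ)] ∈ box (List.replicate 2 b) := by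
  rw [mem_box_replicate]
  exact ⟨rfl, by simp⟩

theorem single_mem_box (x : Fin b) : [(x : ℕ)] ∈ box (List.replicate 1 b) := by
  rw [mem_box_replicate]
  exact ⟨rfl, by simp⟩

theorem weightSums_spec (ht : Nat.clog 2 b ≤ t) {s : Config} (hs : s.word 3 [] = b) {q : ℕ → ℝ}
    (hq : ∀ i < b, s.real 3 [i] = q i) :
    Det t weightSums s fun s' => ∀ i < b, s'.real 4 [i] = ∑ y ∈ Finset.Ico i b, q y := by
  refine Det.seq (Q := fun s₁ => s₁.word 3 [] = b ∧ ∀ i < b, s₁.real 4 [i] = q i)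
    (Det.rset fun s₁ h1 h2 => ⟨by rw [h2, hs], fun i hi => ?_⟩) ?_
  · rw [h1, Function.update_self, if_pos (by rw [hs]; exact single_mem_box ⟨i, hi⟩), ← hq i hi]
    simp [Exp.eval]
  rintro s₁ ⟨h3, h4⟩
  refine (realSums_spec (by decide) (by decide) ht h3).mono fun s₂ h i hi => ?_
  have := h [] i rfl (by simp) hi
  rw [List.nil_append] at this
  rw [this]
  exact Finset.sum_congr rfl fun y hy => h4 y (Finset.mem_Ico.1 hy).2

/-- Comparing a suffix sum with the total detects an earlier success without a sequential search. -/
theorem sum_Ico_eq_sum_range_iff {f : ℕ → ℕ} {i : ℕ} (hi : i < b) :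
    ∑ y ∈ Finset.Ico i b, f y < ∑ y ∈ Finset.Ico 0 b, f y ↔ ∃ j < i, f j ≠ 0 := by
  rw [← Finset.sum_Ico_consecutive f (Nat.zero_le i) hi.le, Nat.lt_add_left_iff_pos,
    Nat.pos_iff_ne_zero, Ne, Finset.sum_eq_zero_iff]
  simp

theorem collectFirst_spec (ht : Nat.clog 2 b ≤ t) {s : Config} (hs : s.word 3 [] = b)
    {f : Fin b × Fin b → Bool} (hf : ∀ x y : Fin b, s.word 12 [(x : ℕ), (y : ℕ)] = (f (x, y)).toNat) :
    Det t collectFirst s fun s' => HoldsSet s' 15 (firstSet f) := by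
  classical
  let F : ℕ → ℕ → ℕ := fun x y => s.word 12 [x, y]
  refine Det.seq (Q := fun s₁ => s₁.word 3 [] = b ∧ s₁.word 12 = s.word 12 ∧
    ∀ x y : Fin b, s₁.word 13 [(x : ℕ), (y : ℕ)] = F x y)
    (Det.wset fun s₁ h1 h2 => ⟨by simp [h1, hs], by simp [h1], fun x y => ?_⟩) ?_
  · rw [h1, Function.update_self, if_pos (by rw [hs]; exact pair_mem_box x y)]
    simp [Exp.eval, F]
  rintro s₁ ⟨e1, w1, h1⟩
  refine Det.seq (wordSums_spec (d := 1) (by decide) (by decide) ht e1).frame ?_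
  rintro s₂ ⟨h2, fw, -⟩
  have e2 : s₂.word 3 [] = b := by rw [fw 3 rfl, e1]
  have w2 : s₂.word 12 = s.word 12 := by rw [fw 12 rfl, w1]
  have h2 : ∀ x y : Fin b, s₂.word 13 [(x : ℕ), (y : ℕ)] = ∑ z ∈ Finset.Ico (y : ℕ) b, F x z := by
    intro x y
    have := h2 [(x : ℕ)] y rfl (by simp) y.isLt
    rw [List.singleton_append] at this
    rw [this]
    exact Finset.sum_congr rfl fun z hz => h1 x ⟨z, (Finset.mem_Ico.1 hz).2⟩
  clear fw
  -- The indices are transposed here so that the next sum, along the last index, runs over the rows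
  -- for a fixed element.
  refine Det.seq (Q := fun s₃ => s₃.word 3 [] = b ∧ ∀ x y : Fin b, s₃.word 14 [(y : ℕ), (x : ℕ)] =
    if f (x, y) = true ∧ ∀ z < y, f (x, z) = false then 1 else 0)
    (Det.wset fun s₃ h1 h2 => ⟨by simp [h1, e2], fun x y => ?_⟩) ?_
  · rw [h1, Function.update_self, if_pos (by rw [e2]; exact pair_mem_box y x)]
    have hb : 0 < b := x.pos
    have k1 := ‹∀ x y : Fin b, s₂.word 13 [(x : ℕ), (y : ℕ)] = _› x y
    have k2 := ‹∀ x y : Fin b, s₂.word 13 [(x : ℕ), (y : ℕ)] = _› x ⟨0, hb⟩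
    simp only [Exp.eval, List.ofFn_succ, List.ofFn_zero, Matrix.cons_val_zero,
      Matrix.cons_val_succ, List.getD_cons_zero, List.getD_cons_succ, k1, w2, hf]
    rw [show s₂.word 13 [(x : ℕ), 0] = _ from k2]
    have hiff : (∑ z ∈ Finset.Ico (y : ℕ) b, F x z < ∑ z ∈ Finset.Ico 0 b, F x z) ↔
        ∃ z < y, f (x, z) = true := by
      rw [sum_Ico_eq_sum_range_iff y.isLt]
      constructor
      · rintro ⟨j, hj, hne⟩
        refine ⟨⟨j, hj.trans y.isLt⟩, hj, ?_⟩
        have := hf x ⟨j, hj.trans y.isLt⟩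
        simp only [F] at hne
        rw [this] at hne
        by_contra hc
        simp [hc] at hne
      · rintro ⟨j, hj, hne⟩
        refine ⟨j, hj, ?_⟩
        simp only [F, hf, hne]
        decide
    by_cases c : ∃ z < y, f (x, z) = true
    · rw [if_pos (hiff.2 c), if_pos one_ne_zero, if_neg]
      rintro ⟨-, hall⟩
      obtain ⟨z, hz, hz'⟩ := c
      rw [hall z hz] at hz'
      exact absurd hz' (by decide)
    · rw [if_neg fun h => c (hiff.1 h), if_neg (by simp)]
      have hall : ∀ z < y, f (x, z) = false := fun z hz => by
        by_contra hc
        exact c ⟨z, hz, by simpa using hc⟩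
      by_cases hfx : f (x, y) = true
      · rw [if_pos ⟨hfx, hall⟩, hfx]; rfl
      · rw [if_neg fun h => hfx h.1]
        simp [hfx]
  rintro s₃ ⟨e3, h3⟩
  refine Det.seq (wordSums_spec (d := 1) (by decide) (by decide) ht e3).frame ?_
  rintro s₄ ⟨h4, fw, -⟩
  have e4 : s₄.word 3 [] = b := by rw [fw 3 rfl, e3]
  refine Det.wset fun s₅ h5 _ i => ?_
  have hi := h4 [(i : ℕ)] 0 rfl (by simp) i.pos
  rw [List.singleton_append, ← Finset.range_eq_Ico, Finset.sum_range] at hi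
  simp only [List.singleton_append, h3] at hi
  rw [h5, Function.update_self, if_pos (by rw [e4]; exact single_mem_box i)]
  simp only [Exp.eval, List.ofFn_succ, List.ofFn_zero, Matrix.cons_val_zero,
    Matrix.cons_val_succ, List.getD_cons_zero, hi]
  have hiff : (∑ x : Fin b, if f (x, i) = true ∧ ∀ z < i, f (x, z) = false then 1 else 0) ≠ 0 ↔
      i ∈ firstSet f := by
    rw [Ne, Finset.sum_eq_zero_iff, firstSet, Finset.mem_filter]
    push Not
    simp
  by_cases c : i ∈ firstSet f
  · rw [if_pos (hiff.2 c), if_pos c]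
  · rw [if_neg fun h => c (hiff.1 h), if_neg c]

theorem card_firstSet_le {f : Fin b × Fin b → Bool} {l : ℕ}
    (hf : ∀ x i, f (x, i) = true → (x : ℕ) < l) : (firstSet f).card ≤ l := by
  classical
  have hsub : (firstSet f).map Function.Embedding.some ⊆
      (Finset.univ.filter fun x : Fin b => (x : ℕ) < l).image
        fun x => firstSuccess fun i => f (x, i) := by
    intro o ho
    obtain ⟨i, hi, rfl⟩ := Finset.mem_map.1 ho
    obtain ⟨-, x, hx, hx'⟩ := Finset.mem_filter.1 hi
    exact Finset.mem_image.2 ⟨x, by simp [hf x i hx], firstSuccess_eq_some.2 ⟨hx, hx'⟩⟩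
  have h1 := (Finset.card_le_card hsub).trans Finset.card_image_le
  rw [Finset.card_map] at h1
  refine h1.trans ?_
  rw [← Finset.card_map Fin.valEmbedding]
  refine (Finset.card_le_card (t := Finset.range l) fun y hy => ?_).trans (Finset.card_range l).le
  obtain ⟨x, hx, rfl⟩ := Finset.mem_map.1 hy
  simpa using hx

/-- The law of the sampling program. -/
theorem Runs.sample_seq (ht : Nat.clog 2 b ≤ t) {s : Config} (hs : s.word 3 [] = b) {q : ℕ → ℝ}
    (hq0 : ∀ i, 0 ≤ q i) (hq : ∀ i < b, s.real 3 [i] = q i)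
    (hQ : 0 < ∑ y ∈ Finset.Ico 0 b, q y) {l : ℕ} (hl : s.word 8 [] = l) (hlb : l ≤ b)
    (v : Finset (Fin b) → ENNReal) {P : Prog} {φ : Config → ENNReal} {τ : ℕ}
    (h : ∀ R : Finset (Fin b), R.card ≤ l → (∀ i ∈ R, 0 < q i) → ∀ s', HoldsSet s' 15 R →
      (∀ a, sample.keepsWord a = true → s'.word a = s.word a) →
      (∀ a, sample.keepsReal a = true → s'.real a = s.real a) →
      s'.time ≤ s.time + sample.timeBound t → Runs P s' φ (v R) τ) :
    Runs (.seq sample P) s φ (∑ x : Fin l → Fin b,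
      (∏ i, ENNReal.ofReal (q (x i) / ∑ y ∈ Finset.Ico 0 b, q y)) *
        v (Finset.univ.image x)) τ := by
  classical
  rw [← sum_firstSet q hq0 hQ hlb v]
  refine Runs.assoc (Runs.det_seq (weightSums_spec ht hs hq).frame ?_)
  rintro s₁ ⟨h4, fw1, fr1⟩ t1
  have e1 : s₁.word 3 [] = b := by rw [fw1 3 rfl, hs]
  have e8 : s₁.word 8 [] = l := by rw [fw1 8 rfl, hl]
  have hq1 : ∀ i < b, s₁.real 3 [i] = q i := by rw [fr1 3 rfl]; exact hq
  obtain ⟨e, he⟩ : ∃ e : Fin b × Fin b ≃ box (List.replicate 2 (s₁.word 3 [])),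
      ∀ x, (e x : List ℕ) = [(x.1 : ℕ), (x.2 : ℕ)] := by
    rw [e1]; exact ⟨pairBox b, fun x => rfl⟩
  have hbias : ∀ x : Fin b × Fin b, (hazardBias.eval s₁ (e x) : ℝ) =
      if (x.1 : ℕ) < l then q x.2 / ∑ y ∈ Finset.Ico (x.2 : ℕ) b, q y else 0 := by
    intro x
    rw [he, ← h4 x.2 x.2.isLt, ← hq1 x.2 x.2.isLt]
    simp only [hazardBias, Exp.eval, Exp.eval_reg, e8, List.ofFn_succ, List.ofFn_zero,
      Matrix.cons_val_zero, List.getD_cons_zero, List.getD_cons_succ]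
    by_cases c : (x.1 : ℕ) < l
    · rw [if_pos c, if_pos c, if_pos one_ne_zero]
    · rw [if_neg c, if_neg c, if_neg (not_not.2 rfl), Nat.cast_zero]
  refine Runs.assoc ?_
  have key := Runs.flip_seq (a := 12) (d := 2) (q := hazardBias) (R := .seq collectFirst P)
    (s := s₁) (φ := φ) e (fun f => v (firstSet f)) (τ := τ) ?_
  · simpa only [hbias] using key
  intro f hf s₂ k1 k2 k3
  have e2 : s₂.word 3 [] = b := by rw [k1]; simpa using e1
  refine Runs.det_seq (collectFirst_spec (f := f) ht e2 fun x y => ?_).frame ?_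
  · have hmem : [(x : ℕ), (y : ℕ)] ∈ box (List.replicate 2 (s₁.word 3 [])) := by
      rw [e1]; exact pair_mem_box x y
    rw [k1, Function.update_self, dif_pos hmem]
    have : e.symm ⟨_, hmem⟩ = (x, y) := by
      rw [Equiv.symm_apply_eq]
      exact Subtype.ext (he (x, y)).symm
    rw [this]
  rintro s₃ ⟨l1, fw3, fr3⟩ t3
  refine h _ ?_ ?_ s₃ l1 ?_ ?_ ?_
  · refine card_firstSet_le fun x i hx => ?_
    have := hf (x, i)
    rw [hbias, hx] at this
    by_contra hc
    exact this (by simp [hc, coinMass])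
  · intro i hi
    rw [firstSet, Finset.mem_filter] at hi
    obtain ⟨-, x, hx, -⟩ := hi
    have := hf (x, i)
    rw [hbias, hx] at this
    refine (hq0 i).lt_of_ne fun h0 => this ?_
    simp [coinMass, ← h0]
  · intro a ha
    simp only [sample, Prog.keepsWord, Bool.and_eq_true] at ha
    rw [fw3 a ha.2.2, k1, Function.update_of_ne, fw1 a ha.1]
    rintro rfl
    exact absurd ha.2.1 (by decide)
  · intro a ha
    simp only [sample, Prog.keepsReal, Bool.and_eq_true] at ha
    rw [fr3 a ha.2.2, k2, fr1 a ha.1]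
  · have : sample.timeBound t = weightSums.timeBound t +
      ((Prog.flip 12 (cube 2) hazardBias).timeBound 0 + collectFirst.timeBound t) := rfl
    omega

end SampleProgram

/-! ### One round of rejection sampling -/

section Round

variable {m : ℕ} {L : Matrix (Fin m) (Fin m) ℝ}

/-- The conditional probability of `S` given that the elements of `T` are selected. -/
noncomputable def condProb (L : Matrix (Fin m) (Fin m) ℝ) (k : ℕ) (S T : Finset (Fin m)) : ℝ :=
  if T ⊆ S ∧ S.card = k then dppWeight L S / condZ L k T else 0

theorem condProb_nonneg (hL : L.PosSemidef) (k : ℕ) (S T : Finset (Fin m)) :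
    0 ≤ condProb L k S T := by
  unfold condProb
  split_ifs
  · exact div_nonneg (dppWeight_nonneg hL S) (condZ_nonneg hL k T)
  · exact le_rfl

theorem sum_condProb {k : ℕ} {T : Finset (Fin m)} (hT : 0 < condZ L k T) :
    ∑ S, condProb L k S T = 1 := by
  unfold condProb
  rw [← Finset.sum_filter, ← Finset.sum_div]
  have : Finset.univ.filter (fun S : Finset (Fin m) => T ⊆ S ∧ S.card = k) =
      ((Finset.univ : Finset (Fin m)).powersetCard k).filter (T ⊆ ·) := by
    ext S
    simp [Finset.mem_powersetCard, and_comm]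
  rw [this]
  exact div_self hT.ne'

/-- The probability of accepting the batch `R` of `l` proposed elements. -/
noncomputable def acceptProb (L : Matrix (Fin m) (Fin m) ℝ) (k : ℕ) (T : Finset (Fin m)) (l : ℕ)
    (R : Finset (Fin m)) : ℝ :=
  if R.card = l then 1 / 2 * (condZ L k (R ∪ T) / condZ L k T) /
    ((∏ i ∈ R, condZ L k (insert i T) / condZ L k T) *
      ∏ i ∈ Finset.range l, (((k : ℝ) - T.card) - i) / ((k : ℝ) - T.card)) else 0

/-- Weierstrass's product inequality. -/
theorem one_sub_sum_le_prod (f : ℕ → ℝ) (hf : ∀ i, 0 ≤ f i) (l : ℕ) (hf1 : ∀ i < l, f i ≤ 1) :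
    1 - ∑ i ∈ Finset.range l, f i ≤ ∏ i ∈ Finset.range l, (1 - f i) := by
  induction l with
  | zero => simp
  | succ l ih =>
    rw [Finset.sum_range_succ, Finset.prod_range_succ]
    have h1 := ih fun i hi => hf1 i (by omega)
    have h2 := hf1 l (by omega)
    have h3 : 0 ≤ ∑ i ∈ Finset.range l, f i := Finset.sum_nonneg fun i _ => hf i
    nlinarith [mul_le_mul_of_nonneg_right h1 (by linarith : 0 ≤ 1 - f l), mul_nonneg h3 (hf l)]

/-- The birthday bound: the factors are `1 - i / r`, and the sum of the `i / r` is at most `l ^ 2 /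
(2 * r) ≤ 1 / 2`. This is what limits a batch to the square root of the number of missing elements.
-/
theorem half_le_prod_falling {l : ℕ} {r : ℝ} (hr : 0 < r) (hl : (l : ℝ) ^ 2 ≤ r) :
    1 / 2 ≤ ∏ i ∈ Finset.range l, (r - i) / r := by
  have h1 : ∀ i ∈ Finset.range l, (r - i) / r = 1 - i / r := fun i _ => by field_simp
  rw [Finset.prod_congr rfl h1]
  refine le_trans ?_ (one_sub_sum_le_prod (fun i => (i : ℝ) / r) (fun i => by positivity) l ?_)
  · have h2 : ∀ l : ℕ, ∑ i ∈ Finset.range l, (i : ℝ) ≤ (l : ℝ) ^ 2 / 2 := by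
      intro l
      induction l with
      | zero => simp
      | succ l ih =>
        rw [Finset.sum_range_succ]
        push_cast
        nlinarith
    rw [← Finset.sum_div]
    have h3 : (∑ i ∈ Finset.range l, (i : ℝ)) / r ≤ 1 / 2 := by
      rw [div_le_iff₀ hr]
      linarith [h2 l]
    linarith
  · intro i hi
    rw [div_le_one hr]
    have : (i : ℝ) + 1 ≤ l := by exact_mod_cast hi
    nlinarith

theorem prod_falling_eq {r l : ℕ} (hl : l ≤ r) :
    ∏ i ∈ Finset.range l, ((r : ℝ) - i) / r = (r.descFactorial l : ℝ) / (r : ℝ) ^ l := by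
  rw [Finset.prod_div_distrib, Finset.prod_const, Finset.card_range, Nat.descFactorial_eq_prod_range,
    Nat.cast_prod]
  congr 1
  refine Finset.prod_congr rfl fun i hi => ?_
  rw [Nat.cast_sub ((Finset.mem_range.1 hi).le.trans hl)]

theorem acceptProb_nonneg (hL : L.PosSemidef) {k : ℕ} {T : Finset (Fin m)} {l : ℕ}
    (hl : (l : ℝ) ^ 2 ≤ (k : ℝ) - T.card) (hr : T.card < k) (R : Finset (Fin m)) :
    0 ≤ acceptProb L k T l R := by
  have hr' : (0 : ℝ) < (k : ℝ) - T.card := by rw [sub_pos]; exact_mod_cast hr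
  unfold acceptProb
  split_ifs
  · have h2 := half_le_prod_falling hr' hl
    refine div_nonneg (mul_nonneg (by norm_num) (div_nonneg (condZ_nonneg hL k _)
      (condZ_nonneg hL k _))) (mul_nonneg (Finset.prod_nonneg fun i _ =>
      div_nonneg (condZ_nonneg hL k _) (condZ_nonneg hL k _)) (by linarith))
  · exact le_rfl

/-- Negative correlation bounds the quotient of probabilities by one, and the factor `1 / 2`
compensates for the falling product. -/
theorem acceptProb_le_one (hL : L.PosSemidef) {k : ℕ} {T : Finset (Fin m)} {l : ℕ}
    (hl : (l : ℝ) ^ 2 ≤ (k : ℝ) - T.card) (hr : T.card < k) (hT : 0 < condZ L k T)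
    {R : Finset (Fin m)} (hR : ∀ i ∈ R, 0 < condZ L k (insert i T)) :
    acceptProb L k T l R ≤ 1 := by
  have hr' : (0 : ℝ) < (k : ℝ) - T.card := by rw [sub_pos]; exact_mod_cast hr
  unfold acceptProb
  split_ifs
  · have h2 := half_le_prod_falling hr' hl
    have h1 := condZ_union_div_le hL hT R
    have h3 : 0 < ∏ i ∈ R, condZ L k (insert i T) / condZ L k T :=
      Finset.prod_pos fun i hi => div_pos (hR i hi) hT
    rw [div_le_one (mul_pos h3 (by linarith))]
    nlinarith
  · exact zero_le_one

theorem card_injective_into {ι : Type*} [Fintype ι] [DecidableEq ι] (A : Finset ι) (l : ℕ)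
    [DecidablePred fun x : Fin l → ι => Function.Injective x ∧ ∀ s, x s ∈ A] :
    (Finset.univ.filter fun x : Fin l → ι => Function.Injective x ∧ ∀ s, x s ∈ A).card =
      A.card.descFactorial l := by
  have h := Fintype.card_embedding_eq (α := Fin l) (β := A)
  rw [Fintype.card_coe, Fintype.card_fin] at h
  rw [← h, ← Fintype.card_subtype]
  refine Fintype.card_congr
    { toFun := fun x => ⟨fun s => ⟨x.1 s, x.2.2 s⟩, fun s s' hs => x.2.1 (congrArg Subtype.val hs)⟩
      invFun := fun y => ⟨fun s => y s, fun s s' hs => y.injective (Subtype.ext hs),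
        fun s => (y s).2⟩
      left_inv := fun x => rfl
      right_inv := fun y => rfl }

/-- The weights of the proposals. -/
noncomputable def proposal (L : Matrix (Fin m) (Fin m) ℝ) (k : ℕ) (T : Finset (Fin m))
    (i : Fin m) : ℝ := if i ∈ T then 0 else condZ L k (insert i T)

theorem sum_proposal (L : Matrix (Fin m) (Fin m) ℝ) (k : ℕ) (T : Finset (Fin m)) :
    ∑ i, proposal L k T i = ((k : ℝ) - T.card) * condZ L k T := by
  rw [← sum_condZ_insert]
  unfold proposal
  rw [Finset.sum_ite, Finset.sum_const_zero, zero_add]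
  refine Finset.sum_congr ?_ fun _ _ => rfl
  ext i; simp

/-- The marginals in the proposal cancel those in the acceptance probability, and the powers of `k -
T.card` cancel as well. What is left depends only on the set of proposed elements. -/
theorem proposal_mul_acceptProb (hL : L.PosSemidef) {k : ℕ} {T : Finset (Fin m)} {l : ℕ}
    (hl : l ≤ k - T.card) (hr : T.card < k) (hT : 0 < condZ L k T) (x : Fin l → Fin m)
    [Decidable (Function.Injective x ∧ ∀ s, x s ∈ Tᶜ)] :
    (∏ s, proposal L k T (x s) / (((k : ℝ) - T.card) * condZ L k T)) *
        acceptProb L k T l (Finset.univ.image x) =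
      if Function.Injective x ∧ ∀ s, x s ∈ Tᶜ then
        1 / 2 * condZ L k (Finset.univ.image x ∪ T) / condZ L k T /
          ((k - T.card).descFactorial l : ℝ) else 0 := by
  split_ifs with hx
  · obtain ⟨hinj, hxT⟩ := hx
    have hcard : (Finset.univ.image x).card = l := by
      rw [Finset.card_image_of_injective _ hinj, Finset.card_univ, Fintype.card_fin]
    have hprop : ∀ s, proposal L k T (x s) = condZ L k (insert (x s) T) := fun s =>
      if_neg (Finset.mem_compl.1 (hxT s))
    rw [acceptProb, if_pos hcard, Finset.prod_image fun s _ s' _ h => hinj h]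
    have hrr : ((k : ℝ) - T.card) = ((k - T.card : ℕ) : ℝ) := by rw [Nat.cast_sub hr.le]
    rw [hrr, prod_falling_eq hl]
    simp only [hprop]
    have hr0 : (0 : ℝ) < ((k - T.card : ℕ) : ℝ) := by exact_mod_cast Nat.sub_pos_of_lt hr
    have hdf : (0 : ℝ) < ((k - T.card).descFactorial l : ℝ) := by
      exact_mod_cast Nat.pos_of_ne_zero fun h => absurd (Nat.descFactorial_eq_zero_iff_lt.1 h) (by omega)
    -- If a marginal vanishes, so does the larger conditioned sum in the numerator, and both sides
    -- are zero.
    by_cases h0 : ∃ s, condZ L k (insert (x s) T) = 0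
    · obtain ⟨s, hs⟩ := h0
      have h1 : condZ L k (Finset.univ.image x ∪ T) = 0 := by
        refine le_antisymm (hs ▸ condZ_anti hL k ?_) (condZ_nonneg hL k _)
        exact Finset.insert_subset (Finset.mem_union_left _ (Finset.mem_image_of_mem _
          (Finset.mem_univ s))) Finset.subset_union_right
      rw [h1]
      simp
    · push Not at h0
      have hp : ∏ s, condZ L k (insert (x s) T) ≠ 0 := Finset.prod_ne_zero_iff.2 fun s _ => h0 s
      simp only [Finset.prod_div_distrib, Finset.prod_const, Finset.card_univ, Fintype.card_fin]
      field_simp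
      rw [mul_pow]
      ring
  -- A repetition makes the proposed set too small, hence rejected; an element of `T` has proposal
  -- weight zero.
  · by_cases hxT : ∀ s, x s ∈ Tᶜ
    · have hinj : ¬Function.Injective x := fun h => hx ⟨h, hxT⟩
      have hcard : (Finset.univ.image x).card ≠ l := by
        intro h
        have := Finset.card_image_iff.1 (h.trans (by simp : l = (Finset.univ : Finset (Fin l)).card))
        exact hinj fun s s' hs => this (by simp) (by simp) hs
      rw [acceptProb, if_neg hcard, mul_zero]
    · push Not at hxT
      obtain ⟨s, hs⟩ := hxT
      rw [Finset.prod_eq_zero (Finset.mem_univ s), zero_mul]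
      rw [proposal, if_pos (by simpa using hs), zero_div]

/-- In each round, a set is reached by an accepted batch with half its probability. -/
theorem sum_proposal_acceptProb_condProb (hL : L.PosSemidef) {k : ℕ} {T : Finset (Fin m)} {l : ℕ}
    (hl : l ≤ k - T.card) (hr : T.card < k) (hT : 0 < condZ L k T) (S : Finset (Fin m)) :
    ∑ x : Fin l → Fin m, (∏ s, proposal L k T (x s) / (((k : ℝ) - T.card) * condZ L k T)) *
        (acceptProb L k T l (Finset.univ.image x) * condProb L k S (Finset.univ.image x ∪ T)) =
      1 / 2 * condProb L k S T := by
  classical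
  have hdf : (0 : ℝ) < ((k - T.card).descFactorial l : ℝ) := by
    exact_mod_cast Nat.pos_of_ne_zero fun h => absurd (Nat.descFactorial_eq_zero_iff_lt.1 h) (by omega)
  simp only [← mul_assoc, proposal_mul_acceptProb hL hl hr hT]
  by_cases hS : T ⊆ S ∧ S.card = k
  · have h1 : ∀ x : Fin l → Fin m,
        (if Function.Injective x ∧ ∀ s, x s ∈ Tᶜ then
          1 / 2 * condZ L k (Finset.univ.image x ∪ T) / condZ L k T /
            ((k - T.card).descFactorial l : ℝ) else 0) *
          condProb L k S (Finset.univ.image x ∪ T) =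
        if Function.Injective x ∧ ∀ s, x s ∈ S \ T then
          1 / 2 * dppWeight L S / condZ L k T / ((k - T.card).descFactorial l : ℝ) else 0 := by
      intro x
      have hsub : Finset.univ.image x ∪ T ⊆ S ↔ ∀ s, x s ∈ S := by
        rw [Finset.union_subset_iff, Finset.image_subset_iff]
        simp [hS.1]
      have hiff : (∀ s, x s ∈ S \ T) ↔ (∀ s, x s ∈ Tᶜ) ∧ ∀ s, x s ∈ S := by
        simp only [Finset.mem_sdiff, Finset.mem_compl, forall_and, and_comm]
      simp only [condProb, hiff, hsub]
      by_cases c1 : Function.Injective x ∧ ∀ s, x s ∈ Tᶜ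
      · by_cases c2 : ∀ s, x s ∈ S
        · rw [if_pos c1, if_pos ⟨c2, hS.2⟩, if_pos ⟨c1.1, c1.2, c2⟩]
          rcases (condZ_nonneg hL k (Finset.univ.image x ∪ T)).eq_or_lt with h0 | h0
          · have : dppWeight L S = 0 := le_antisymm
              (h0 ▸ dppWeight_le_condZ hL (hsub.2 c2) hS.2) (dppWeight_nonneg hL S)
            rw [this]; simp
          · field_simp
        · simp [c2]
      · rw [if_neg c1, zero_mul, if_neg fun h => c1 ⟨h.1, h.2.1⟩]
    simp only [h1]
    -- The set `S` is reached through the injective tuples of `S \ T`. Their number is the falling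
    -- factorial in the denominator.
    rw [← Finset.sum_filter, Finset.sum_const, card_injective_into, nsmul_eq_mul,
      Finset.card_sdiff_of_subset hS.1, hS.2, condProb, if_pos hS]
    field_simp
  · rw [condProb, if_neg hS, mul_zero]
    refine Finset.sum_eq_zero fun x _ => ?_
    have h0 : condProb L k S (Finset.univ.image x ∪ T) = 0 :=
      if_neg fun h => hS ⟨Finset.subset_union_right.trans h.1, h.2⟩
    rw [h0, mul_zero]

/-- Sum the preceding identity over `S`. The value does not depend on `T`, so the number of
rejections carries no information on the sample. -/
theorem sum_proposal_acceptProb (hL : L.PosSemidef) {k : ℕ} {T : Finset (Fin m)} {l : ℕ}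
    (hl : l ≤ k - T.card) (hr : T.card < k) (hT : 0 < condZ L k T) :
    ∑ x : Fin l → Fin m, (∏ s, proposal L k T (x s) / (((k : ℝ) - T.card) * condZ L k T)) *
        acceptProb L k T l (Finset.univ.image x) = 1 / 2 := by
  have h : ∀ x : Fin l → Fin m, acceptProb L k T l (Finset.univ.image x) =
      ∑ S, acceptProb L k T l (Finset.univ.image x) * condProb L k S (Finset.univ.image x ∪ T) := by
    intro x
    rw [← Finset.mul_sum]
    -- If the enlarged set is impossible, its conditional probabilities do not sum to one, but it is
    -- never accepted.
    rcases (condZ_nonneg hL k (Finset.univ.image x ∪ T)).eq_or_lt with h0 | h0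
    · simp [acceptProb, ← h0]
    · rw [sum_condProb h0, mul_one]
  rw [Finset.sum_congr rfl fun x _ => congrArg _ (h x)]
  simp only [Finset.mul_sum]
  rw [Finset.sum_comm]
  simp only [sum_proposal_acceptProb_condProb hL hl hr hT]
  rw [← Finset.mul_sum, sum_condProb hT, mul_one]

theorem sum_prod_proposal {k : ℕ} {T : Finset (Fin m)} (l : ℕ) (hr : T.card < k)
    (hT : 0 < condZ L k T) :
    ∑ x : Fin l → Fin m, ∏ s, proposal L k T (x s) / (((k : ℝ) - T.card) * condZ L k T) = 1 := by
  rw [← Fintype.prod_sum (fun (_ : Fin l) i => proposal L k T i / (((k : ℝ) - T.card) * condZ L k T)),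
    ← Finset.sum_div, sum_proposal, div_self, Finset.prod_const_one]
  have : (0 : ℝ) < (k : ℝ) - T.card := by rw [sub_pos]; exact_mod_cast hr
  positivity

end Round

/-! ### One round of rejection sampling as a program -/

/-- A diagonal entry of the adjugate, as computed by `faddeevLeVerrier`. -/
def adjEntry (i d : Exp .word) : Exp .real :=
  .rget 2 ![.reg 4, i, i, d, .lit 0, .lit 0, .lit 0, .lit 0]

/-- The last index, which is that of a zero row of the matrix. -/
def lastIdx : Exp .word := .wsub (.reg 3) (.lit 1)

/-- Compute the weights of the proposals. -/
def propose : Prog :=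
  .seq (faddeevLeVerrier 2)
    (.seq (.rset 3 (cube 1) (.rite (.wget 2 ![.pid 0]) (.ofWord (.lit 0))
        (.rsub (adjEntry lastIdx (.reg 7)) (adjEntry (.pid 0) (.reg 7)))))
      (.rset 5 (cube 0) (adjEntry lastIdx (.reg 7))))

/-- Compute the data for the acceptance probability of the batch in word array `15`. -/
def assess : Prog :=
  .seq (.wset 16 (cube 1) (.wget 15 ![.pid 0])) (.seq (wordSums 16 0)
    (.seq (.wset 11 (cube 1) (.wite (.wget 15 ![.pid 0]) (.lit 1) (.wget 2 ![.pid 0])))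
      (.seq (.rset 6 (cube 1) (.rmul
          (.rite (.wget 15 ![.pid 0]) (.rdiv (.rget 3 ![.pid 0]) (.rreg 5)) (.ofWord (.lit 1)))
          (.rite (.wlt (.pid 0) (.reg 8)) (.rdiv
            (.rsub (.rsub (.ofWord (.reg 4)) (.ofWord (.reg 7))) (.ofWord (.pid 0)))
            (.rsub (.ofWord (.reg 4)) (.ofWord (.reg 7)))) (.ofWord (.lit 1)))))
        (.seq (realProds 6 0) (faddeevLeVerrier 11)))))

/-- The acceptance probability. -/
def acceptBias : Exp .real :=
  .rite (.weq (.wget 16 ![.lit 0]) (.reg 8))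
    (.rdiv (.rmul (.rdiv (.ofWord (.lit 1)) (.ofWord (.lit 2)))
        (.rdiv (adjEntry lastIdx (.wadd (.reg 7) (.reg 8))) (.rreg 5))) (.rget 6 ![.lit 0]))
    (.ofWord (.lit 0))

/-- Pass to the state after the acceptance or rejection recorded in word register `17`. -/
def update : Prog :=
  .seq (.wset 2 (cube 1) (.wite (.reg 17) (.wget 11 ![.pid 0]) (.wget 2 ![.pid 0])))
    (.seq (.wset 7 (cube 0) (.wite (.reg 17) (.wadd (.reg 7) (.reg 8)) (.reg 7)))
      (.seq (.wset 9 (cube 0) (.wite (.reg 17) (.reg 10) (.wsub (.reg 9) (.lit 1))))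
        (.seq (.rset 8 (cube 0) (.rite (.reg 17)
            (.rmul (.rreg 8) (.rsub (.ofWord (.lit 1)) (.rreg 7))) (.rreg 8)))
          (.wset 8 (cube 0) (.wite (.rlt (.ofWord (.wsub (.reg 4) (.reg 7)))
            (.rmul (.ofWord (.reg 8)) (.ofWord (.reg 8)))) (.wsub (.reg 8) (.lit 1)) (.reg 8))))))

/-- Propose a batch of elements, and accept or reject it. -/
def attempt : Prog :=
  .seq propose (.seq sample (.seq assess (.seq (.flip 17 (cube 0) acceptBias) update)))

/-- The memory in the main loop: the elements of `T` have been selected, `a` attempts remain for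
the present batch, and the probability that the previous batches were completed is `σ`. -/
structure Sampling {n : ℕ} (L : Matrix (Fin (n + 1)) (Fin (n + 1)) ℝ) (k : ℕ)
    (T : Finset (Fin (n + 1))) (m a : ℕ) (y σ δ : ℝ) (s : Config) : Prop where
  size : s.word 3 [] = n + 1
  order : s.word 4 [] = k
  card : s.word 7 [] = T.card
  batch : s.word 8 [] = Nat.sqrt (k - T.card)
  attempts : s.word 9 [] = a
  maxAttempts : s.word 10 [] = m
  selected : HoldsSet s 2 T
  matrix : HoldsMatrix s L
  tolerance : s.real 1 [] = δ
  miss : s.real 7 [] = y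
  success : s.real 8 [] = σ

section AttemptProgram

variable {n k t : ℕ} {L : Matrix (Fin (n + 1)) (Fin (n + 1)) ℝ} {T : Finset (Fin (n + 1))}
  {m a : ℕ} {y σ δ : ℝ} {s : Config}

theorem condZ_insert_last (hpad : ∀ S, Fin.last n ∈ S → dppWeight L S = 0) (k : ℕ)
    (T : Finset (Fin (n + 1))) : condZ L k (insert (Fin.last n) T) = 0 :=
  Finset.sum_eq_zero fun _ hS =>
    hpad _ ((Finset.mem_filter.1 hS).2 (Finset.mem_insert_self _ _))

theorem coeff_adjCoeff_markRows (k : ℕ) (T : Finset (Fin (n + 1))) (i : Fin (n + 1)) :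
    (adjCoeff (markRows L T) k i i).coeff T.card = condZ L k T - condZ L k (insert i T) := by
  rw [← coeff_minorSum_markRows, ← coeff_minorSum_sub_markRows, Polynomial.coeff_sub]
  ring

/-- No nonzero minor passes through the padded index, so its diagonal entry is the whole sum. One
array thus supplies both the partition function and, by subtraction, all marginals. -/
theorem coeff_adjCoeff_last (hpad : ∀ S, Fin.last n ∈ S → dppWeight L S = 0) (k : ℕ)
    (T : Finset (Fin (n + 1))) :
    (adjCoeff (markRows L T) k (Fin.last n) (Fin.last n)).coeff T.card = condZ L k T := by
  rw [coeff_adjCoeff_markRows, condZ_insert_last hpad, sub_zero]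

theorem eval_adjEntry (i d : Exp .word) (p : List ℕ) :
    ((adjEntry i d).eval s p : ℝ) = s.real 2 [s.word 4 [], (i.eval s p : ℕ), (i.eval s p : ℕ),
      (d.eval s p : ℕ), 0, 0, 0, 0] := by
  simp only [adjEntry, Exp.eval, List.ofFn_succ, List.ofFn_zero, Matrix.cons_val_zero,
    Matrix.cons_val_succ, Exp.eval_reg]

theorem eval_lastIdx (hs : s.word 3 [] = n + 1) (p : List ℕ) :
    (lastIdx.eval s p : ℕ) = (Fin.last n : ℕ) := by
  simp only [lastIdx, Exp.eval, Exp.eval_reg, hs]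
  rfl

theorem propose_spec (hpad : ∀ S, Fin.last n ∈ S → dppWeight L S = 0) (hkn : k ≤ n)
    (ht : Nat.clog 2 (n + 1) ≤ t) (hT : T.card ≤ k) (h : Sampling L k T m a y σ δ s) :
    Det t propose s fun s' => (∀ i : Fin (n + 1), s'.real 3 [(i : ℕ)] = proposal L k T i) ∧
      s'.real 5 [] = condZ L k T := by
  refine Det.seq (faddeevLeVerrier_spec ht h.size h.selected h.matrix).frame ?_
  rintro s₁ ⟨h1, fw, -⟩
  have w : ∀ c, c ≠ 5 → c ≠ 6 → s₁.word c = s.word c := fun c h5 h6 =>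
    fw c (faddeevLeVerrier_keepsWord 2 c h5 h6)
  have e3 : s₁.word 3 [] = n + 1 := by rw [w 3 (by decide) (by decide), h.size]
  have e4 : s₁.word 4 [] = k := by rw [w 4 (by decide) (by decide), h.order]
  have e7 : s₁.word 7 [] = T.card := by rw [w 7 (by decide) (by decide), h.card]
  have hW : ∀ i : Fin (n + 1), s₁.real 2 [k, (i : ℕ), (i : ℕ), T.card, 0, 0, 0, 0] =
      condZ L k T - condZ L k (insert i T) := fun i => by
    rw [← coeff_adjCoeff_markRows]
    exact h1 ⟨k, by omega⟩ i i ⟨T.card, by omega⟩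
  have hWl : s₁.real 2 [k, ((Fin.last n : Fin (n + 1)) : ℕ), ((Fin.last n : Fin (n + 1)) : ℕ),
      T.card, 0, 0, 0, 0] = condZ L k T := by
    rw [hW, condZ_insert_last hpad, sub_zero]
  refine Det.seq (Q := fun s₂ => (∀ i : Fin (n + 1), s₂.real 3 [(i : ℕ)] = proposal L k T i) ∧
    s₂.word = s₁.word ∧ s₂.real 2 = s₁.real 2) (Det.rset fun s₂ k1 k2 => ⟨fun i => ?_, k2, ?_⟩) ?_
  · rw [k1, Function.update_self, if_pos (by rw [e3]; exact single_mem_box i)]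
    have hsel : s₁.word 2 [(i : ℕ)] = if i ∈ T then 1 else 0 := by
      rw [w 2 (by decide) (by decide)]; exact h.selected i
    simp only [Exp.eval, eval_adjEntry, eval_lastIdx e3, Exp.eval_reg, e4, e7, List.ofFn_succ,
      List.ofFn_zero, Matrix.cons_val_zero, List.getD_cons_zero, hWl, hW, hsel]
    by_cases c : i ∈ T <;> simp [proposal, c]
  · rw [k1]; simp
  rintro s₂ ⟨k1, k2, k3⟩
  refine Det.rset fun s₃ l1 l2 => ⟨fun i => by rw [l1]; simpa using k1 i, ?_⟩
  rw [l1, Function.update_self, if_pos (by simp [box]), eval_adjEntry,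
    eval_lastIdx (by rw [k2, e3]), Exp.eval_reg, k2, k3, e4, e7, hWl]

theorem assess_spec (hpad : ∀ S, Fin.last n ∈ S → dppWeight L S = 0) (hkn : k ≤ n)
    (ht : Nat.clog 2 (n + 1) ≤ t) (hT : T.card ≤ k) (h : Sampling L k T m a y σ δ s)
    (hq : ∀ i : Fin (n + 1), s.real 3 [(i : ℕ)] = proposal L k T i)
    (hg : s.real 5 [] = condZ L k T) {R : Finset (Fin (n + 1))} (hR : HoldsSet s 15 R)
    (hRT : ∀ i ∈ R, i ∉ T) :
    Det t assess s fun s' =>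
      ((acceptBias.eval s' [] : ℝ) = acceptProb L k T (Nat.sqrt (k - T.card)) R) ∧
      HoldsSet s' 11 (R ∪ T) := by
  set l := Nat.sqrt (k - T.card) with hl
  have hlk : l ≤ k - T.card := Nat.sqrt_le_self _
  refine Det.seq (Q := fun s₁ => (∀ a, a ≠ 16 → s₁.word a = s.word a) ∧ s₁.real = s.real ∧
    ∀ i : Fin (n + 1), s₁.word 16 [(i : ℕ)] = if i ∈ R then 1 else 0)
    (Det.wset fun s₁ h1 h2 => ⟨fun c hc => by rw [h1, Function.update_of_ne hc], h2, fun i => ?_⟩) ?_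
  · rw [h1, Function.update_self, if_pos (by rw [h.size]; exact single_mem_box i)]
    simp only [Exp.eval, List.ofFn_succ, List.ofFn_zero, Matrix.cons_val_zero, List.getD_cons_zero]
    exact hR i
  rintro s₁ ⟨w1, r1, c1⟩
  refine Det.seq (wordSums_spec (d := 0) (by decide) (by decide) ht
    (by rw [w1 3 (by decide), h.size])).frame ?_
  rintro s₂ ⟨c2, w2, r2⟩
  have w2 : ∀ a, a ≠ 16 → a ≠ 5 → s₂.word a = s.word a := fun c h1 h2 => by
    rw [w2 c (by simp [wordSums, scan, Prog.set, Prog.keepsWord, h1.symm, h2.symm]), w1 c h1]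
  have r2 : s₂.real = s.real := by
    funext c
    rw [r2 c rfl, r1]
  have c2 : s₂.word 16 [0] = R.card := by
    have := c2 [] 0 rfl (by simp) (Nat.succ_pos n)
    rw [List.nil_append, ← Finset.range_eq_Ico, Finset.sum_range] at this
    rw [this]
    simp only [List.nil_append, c1]
    simp
  refine Det.seq (Q := fun s₃ => (∀ a, a ≠ 16 → a ≠ 5 → a ≠ 11 → s₃.word a = s.word a) ∧
    s₃.real = s.real ∧ s₃.word 16 [0] = R.card ∧ HoldsSet s₃ 11 (R ∪ T))
    (Det.wset fun s₃ h1 h2 => ⟨fun c h3 h4 h5 => by rw [h1, Function.update_of_ne h5, w2 c h3 h4],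
      by rw [h2, r2], by rw [h1, Function.update_of_ne (by decide), c2], fun i => ?_⟩) ?_
  · rw [h1, Function.update_self, if_pos (by rw [w2 3 (by decide) (by decide), h.size]; exact single_mem_box i)]
    have e1 : s₂.word 15 [(i : ℕ)] = if i ∈ R then 1 else 0 := by rw [w2 15 (by decide) (by decide)]; exact hR i
    have e2 : s₂.word 2 [(i : ℕ)] = if i ∈ T then 1 else 0 := by rw [w2 2 (by decide) (by decide)]; exact h.selected i
    simp only [Exp.eval, List.ofFn_succ, List.ofFn_zero, Matrix.cons_val_zero, List.getD_cons_zero,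
      e1, e2, Finset.mem_union]
    by_cases c : i ∈ R <;> simp [c]
  rintro s₃ ⟨w3, r3, c3, u3⟩
  have e3 : s₃.word 3 [] = n + 1 := by rw [w3 3 (by decide) (by decide) (by decide), h.size]
  refine Det.seq (Q := fun s₄ => s₄.word = s₃.word ∧ (∀ a, a ≠ 6 → s₄.real a = s.real a) ∧
    ∀ i : Fin (n + 1), s₄.real 6 [(i : ℕ)] =
      (if i ∈ R then condZ L k (insert i T) / condZ L k T else 1) *
      (if (i : ℕ) < l then (((k : ℝ) - T.card) - (i : ℕ)) / ((k : ℝ) - T.card) else 1))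
    (Det.rset fun s₄ h1 h2 => ⟨h2, fun c h3 => by rw [h1, Function.update_of_ne h3, r3],
      fun i => ?_⟩) ?_
  · rw [h1, Function.update_self, if_pos (by rw [e3]; exact single_mem_box i)]
    have e15 : s₃.word 15 [(i : ℕ)] = if i ∈ R then 1 else 0 := by
      rw [w3 15 (by decide) (by decide) (by decide)]; exact hR i
    have e8 : s₃.word 8 [] = l := by rw [w3 8 (by decide) (by decide) (by decide), h.batch]
    have e4 : s₃.word 4 [] = k := by rw [w3 4 (by decide) (by decide) (by decide), h.order]
    have e7 : s₃.word 7 [] = T.card := by rw [w3 7 (by decide) (by decide) (by decide), h.card]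
    simp only [Exp.eval, List.ofFn_succ, List.ofFn_zero, Matrix.cons_val_zero, List.getD_cons_zero,
      Exp.eval_reg, Exp.eval_rreg, e15, e8, e4, e7, r3, hq, hg]
    congr 1
    · by_cases c : i ∈ R
      · simp [c, proposal, hRT i c]
      · simp [c]
    · by_cases c : (i : ℕ) < l <;> simp [c]
  rintro s₄ ⟨w4, r4, p4⟩
  refine Det.seq (realProds_spec (d := 0) (by decide) (by decide) ht (by rw [w4, e3])
    (Nat.succ_pos n)).frame ?_
  rintro s₅ ⟨p5, w5, r5⟩
  have w5 : ∀ a, a ≠ 5 → s₅.word a = s₃.word a := fun c h1 => by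
    rw [w5 c (by simp [realProds, scan, Prog.set, Prog.keepsWord, h1.symm]), w4]
  have r5 : ∀ a, a ≠ 6 → s₅.real a = s.real a := fun c h1 => by
    rw [r5 c (by simp [realProds, scan, Prog.set, Prog.keepsReal, h1.symm]), r4 c h1]
  have p5 : s₅.real 6 [0] = (∏ i ∈ R, condZ L k (insert i T) / condZ L k T) *
      ∏ i ∈ Finset.range l, (((k : ℝ) - T.card) - i) / ((k : ℝ) - T.card) := by
    have := p5 [] rfl (by simp)
    rw [List.nil_append, Finset.prod_range] at this
    rw [this]
    simp only [List.nil_append, p4, Finset.prod_mul_distrib]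
    congr 1
    · rw [Finset.prod_ite_mem, Finset.univ_inter]
    · rw [← Finset.prod_range (fun i => if i < l then
        (((k : ℝ) - T.card) - (i : ℕ)) / ((k : ℝ) - T.card) else 1),
        ← Finset.prod_subset (Finset.range_subset_range.2 (show l ≤ n + 1 by omega))]
      · exact Finset.prod_congr rfl fun i hi => if_pos (Finset.mem_range.1 hi)
      · exact fun i _ hi => if_neg (by simpa using hi)
  have e3' : s₅.word 3 [] = n + 1 := by rw [w5 3 (by decide), e3]
  refine (faddeevLeVerrier_spec (T := R ∪ T) (a := 11) (L := L) ht e3'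
    (by rw [HoldsSet, w5 11 (by decide)]; exact u3)
    (by rw [HoldsMatrix, r5 0 (by decide)]; exact h.matrix)).frame.mono ?_
  rintro s₆ ⟨h6, w6, r6⟩
  have w6 : ∀ c, c ≠ 5 → c ≠ 6 → s₆.word c = s₃.word c := fun c h1 h2 => by
    rw [w6 c (faddeevLeVerrier_keepsWord 11 c h1 h2), w5 c h1]
  have r6 : ∀ c, c ≠ 2 → s₆.real c = s₅.real c := fun c h1 =>
    r6 c (faddeevLeVerrier_keepsReal 11 c h1)
  refine ⟨?_, by rw [HoldsSet, w6 11 (by decide) (by decide)]; exact u3⟩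
  have e8 : s₆.word 8 [] = l := by
    rw [w6 8 (by decide) (by decide), w3 8 (by decide) (by decide) (by decide), h.batch]
  have e4 : s₆.word 4 [] = k := by
    rw [w6 4 (by decide) (by decide), w3 4 (by decide) (by decide) (by decide), h.order]
  have e7 : s₆.word 7 [] = T.card := by
    rw [w6 7 (by decide) (by decide), w3 7 (by decide) (by decide) (by decide), h.card]
  have e16 : s₆.word 16 [0] = R.card := by rw [w6 16 (by decide) (by decide), c3]
  have e33 : s₆.word 3 [] = n + 1 := by rw [w6 3 (by decide) (by decide), e3]
  have g6 : s₆.real 5 [] = condZ L k T := by rw [r6 5 (by decide), r5 5 (by decide), hg]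
  have p6 := p5
  rw [← r6 6 (by decide)] at p6
  simp only [acceptBias, Exp.eval, Exp.eval_weq, Exp.eval_reg, Exp.eval_rreg, eval_adjEntry,
    eval_lastIdx e33, List.ofFn_succ, List.ofFn_zero, Matrix.cons_val_zero, e8, e4, e7, e16, g6, p6]
  by_cases c : R.card = l
  · have hdisj : Disjoint R T := Finset.disjoint_left.2 hRT
    have hcard : (R ∪ T).card = T.card + l := by
      rw [Finset.card_union_of_disjoint hdisj, c, add_comm]
    have hW : s₆.real 2 [k, ((Fin.last n : Fin (n + 1)) : ℕ), ((Fin.last n : Fin (n + 1)) : ℕ),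
        T.card + l, 0, 0, 0, 0] = condZ L k (R ∪ T) := by
      rw [← coeff_adjCoeff_last hpad, hcard]
      exact h6 ⟨k, by omega⟩ (Fin.last n) (Fin.last n) ⟨T.card + l, by omega⟩
    rw [hW, acceptProb, if_pos c, if_pos c, if_pos one_ne_zero]
    simp
  · rw [acceptProb, if_neg c, if_neg c]
    simp

end AttemptProgram

/-- A single coin. -/
theorem Runs.flip_reg {a : ℕ} {q : Exp .real} {R : Prog} {s : Config} {φ : Config → ENNReal}
    (v : Bool → ENNReal) {τ : ℕ}
    (h : ∀ c : Bool, coinMass (q.eval s []) c ≠ 0 → ∀ s',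
      s'.word = Function.update s.word a (Function.update (s.word a) [] c.toNat) →
      s'.real = s.real → s'.time ≤ s.time + (Prog.flip a (cube 0) q).timeBound 0 →
      Runs R s' φ (v c) τ) :
    Runs (.seq (.flip a (cube 0) q) R) s φ
      (coinMass (q.eval s []) true * v true + coinMass (q.eval s []) false * v false) τ := by
  have hbox : box (List.replicate 0 (s.word 3 [])) = {[]} := rfl
  let e : Unit ≃ box (List.replicate 0 (s.word 3 [])) :=
    { toFun := fun _ => ⟨[], by simp [box]⟩
      invFun := fun _ => ()
      left_inv := fun _ => rfl
      right_inv := fun I => Subtype.ext (Finset.mem_singleton.1 (hbox.subset I.2)).symm }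
  have key := Runs.flip_seq (a := a) (d := 0) (q := q) (R := R) (s := s) (φ := φ) e
    (fun f => v (f ())) (τ := τ) ?_
  · convert key using 1
    rw [Fintype.sum_equiv (Equiv.funUnique Unit Bool) _
      (fun c => coinMass (q.eval s []) c * v c) fun f => by simp [e], Fintype.sum_bool]
  intro f hf s' h1 h2 h3
  refine h (f ()) (hf ()) s' ?_ h2 h3
  rw [h1]
  congr 1
  funext I
  by_cases hI : I = []
  · subst hI
    rw [dif_pos (by simp [box]), Function.update_self]
  · rw [dif_neg (by rw [hbox, Finset.mem_singleton]; exact hI), Function.update_of_ne hI]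

/-- After a completed batch the integer square root falls by at most one, so one comparison updates
the batch size. -/
theorem Nat.sqrt_sub_sqrt {r : ℕ} (hr : 0 < r) :
    Nat.sqrt (r - Nat.sqrt r) =
      if r - Nat.sqrt r < Nat.sqrt r * Nat.sqrt r then Nat.sqrt r - 1 else Nat.sqrt r := by
  have h1 := Nat.sqrt_le r
  have h2 := Nat.lt_succ_sqrt r
  have h3 : 0 < Nat.sqrt r := Nat.sqrt_pos.2 hr
  obtain ⟨l, hl⟩ : ∃ l, Nat.sqrt r = l + 1 := ⟨Nat.sqrt r - 1, by omega⟩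
  rw [hl] at h1 h2 ⊢
  simp only [Nat.succ_eq_add_one] at h2
  symm
  rw [Nat.eq_sqrt]
  split_ifs with h
  · rw [Nat.add_sub_cancel]
    refine ⟨?_, h⟩
    have : l * l + l + l + 1 ≤ r := by linarith
    omega
  · exact ⟨not_lt.1 h, by omega⟩

section AttemptRule

variable {n k t : ℕ} {L : Matrix (Fin (n + 1)) (Fin (n + 1)) ℝ} {T : Finset (Fin (n + 1))}
  {m a : ℕ} {y σ δ : ℝ} {s : Config}

/-- The memory apart from the scratch space. -/
theorem Sampling.congr (h : Sampling L k T m a y σ δ s) {s' : Config}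
    (hw : ∀ c ∈ [2, 3, 4, 7, 8, 9, 10], s'.word c = s.word c)
    (hr : ∀ c ∈ [0, 1, 7, 8], s'.real c = s.real c) : Sampling L k T m a y σ δ s' where
  size := by rw [hw 3 (by decide), h.size]
  order := by rw [hw 4 (by decide), h.order]
  card := by rw [hw 7 (by decide), h.card]
  batch := by rw [hw 8 (by decide), h.batch]
  attempts := by rw [hw 9 (by decide), h.attempts]
  maxAttempts := by rw [hw 10 (by decide), h.maxAttempts]
  selected := by rw [HoldsSet, hw 2 (by decide)]; exact h.selected
  matrix := by rw [HoldsMatrix, hr 0 (by decide)]; exact h.matrix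
  tolerance := by rw [hr 1 (by decide), h.tolerance]
  miss := by rw [hr 7 (by decide), h.miss]
  success := by rw [hr 8 (by decide), h.success]

theorem update_spec (hT : T.card < k) (h : Sampling L k T m a y σ δ s) {c : Bool}
    (hc : s.word 17 [] = c.toNat) {T' : Finset (Fin (n + 1))} (hT' : HoldsSet s 11 T')
    (hcard : c = true → T'.card = T.card + Nat.sqrt (k - T.card)) :
    Det t update s fun s' => if c = true then Sampling L k T' m m y (σ * (1 - y)) δ s'
      else Sampling L k T m (a - 1) y σ δ s' := by
  refine Det.seq (Q := fun s₁ => (∀ a, a ≠ 2 → s₁.word a = s.word a) ∧ s₁.real = s.real ∧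
    HoldsSet s₁ 2 (if c = true then T' else T))
    (Det.wset fun s₁ h1 h2 => ⟨fun c hc => by rw [h1, Function.update_of_ne hc], h2, fun i => ?_⟩) ?_
  · rw [h1, Function.update_self, if_pos (by rw [h.size]; exact single_mem_box i)]
    have e1 := hT' i
    have e2 := h.selected i
    simp only [Exp.eval, List.ofFn_succ, List.ofFn_zero, Matrix.cons_val_zero, List.getD_cons_zero,
      Exp.eval_reg, hc, e1, e2]
    cases c <;> simp
  rintro s₁ ⟨w1, r1, u1⟩
  refine Det.seq (Q := fun s₂ => (∀ a, a ≠ 2 → a ≠ 7 → s₂.word a = s.word a) ∧ s₂.real = s.real ∧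
    HoldsSet s₂ 2 (if c = true then T' else T) ∧ s₂.word 7 [] = (if c = true then T' else T).card)
    (Det.wset fun s₂ h1 h2 => ⟨fun c hc hc' => by rw [h1, Function.update_of_ne hc', w1 c hc],
      by rw [h2, r1], by rw [HoldsSet, h1, Function.update_of_ne (by decide)]; exact u1, ?_⟩) ?_
  · rw [h1, Function.update_self, if_pos (by simp [box])]
    simp only [Exp.eval, Exp.eval_reg, w1 17 (by decide), w1 7 (by decide), w1 8 (by decide), hc,
      h.card, h.batch]
    cases c
    · simp
    · simp [hcard]
  clear w1 r1 u1
  rintro s₂ ⟨w2, r2, u2, c2⟩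
  refine Det.seq (Q := fun s₃ => (∀ a, a ≠ 2 → a ≠ 7 → a ≠ 9 → s₃.word a = s.word a) ∧
    s₃.real = s.real ∧ HoldsSet s₃ 2 (if c = true then T' else T) ∧
    s₃.word 7 [] = (if c = true then T' else T).card ∧
    s₃.word 9 [] = if c = true then m else a - 1)
    (Det.wset fun s₃ h1 h2 => ⟨fun c h3 h4 h5 => by rw [h1, Function.update_of_ne h5, w2 c h3 h4],
      by rw [h2, r2], by rw [HoldsSet, h1, Function.update_of_ne (by decide)]; exact u2,
      by rw [h1, Function.update_of_ne (by decide), c2], ?_⟩) ?_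
  · rw [h1, Function.update_self, if_pos (by simp [box])]
    simp only [Exp.eval, Exp.eval_reg, w2 17 (by decide) (by decide), w2 9 (by decide) (by decide),
      w2 10 (by decide) (by decide), hc, h.attempts, h.maxAttempts]
    cases c <;> simp
  clear w2 r2 u2 c2
  rintro s₃ ⟨w3, r3, u3, c3, a3⟩
  refine Det.seq (Q := fun s₄ => s₄.word = s₃.word ∧ (∀ a, a ≠ 8 → s₄.real a = s.real a) ∧
    s₄.real 8 [] = if c = true then σ * (1 - y) else σ)
    (Det.rset fun s₄ h1 h2 => ⟨h2, fun c hc => by rw [h1, Function.update_of_ne hc, r3], ?_⟩) ?_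
  · rw [h1, Function.update_self, if_pos (by simp [box])]
    simp only [Exp.eval, Exp.eval_reg, Exp.eval_rreg, w3 17 (by decide) (by decide) (by decide), hc,
      r3, h.success, h.miss]
    cases c <;> simp
  rintro s₄ ⟨w4, r4, g4⟩
  refine Det.wset fun s₅ h1 h2 => ?_
  have hb : s₅.word 8 [] = Nat.sqrt (k - (if c = true then T' else T).card) := by
    rw [h1, Function.update_self, if_pos (by simp [box])]
    simp only [Exp.eval, Exp.eval_reg, w4, w3 4 (by decide) (by decide) (by decide),
      w3 8 (by decide) (by decide) (by decide), c3, h.order, h.batch]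
    cases c
    -- After a rejection the comparison fails, since the present batch size is still the integer
    -- square root, and the size is kept.
    · have h3 := Nat.sqrt_le (k - T.card)
      have h4 : ¬((k - T.card : ℕ) : ℝ) < (Nat.sqrt (k - T.card) : ℝ) * (Nat.sqrt (k - T.card) : ℝ) := by
        rw [not_lt]; exact_mod_cast h3
      simp [h4]
    · have h3 : k - T'.card = k - T.card - Nat.sqrt (k - T.card) := by
        rw [hcard rfl]; omega
      simp only [if_true, h3]
      rw [Nat.sqrt_sub_sqrt (Nat.sub_pos_of_lt hT)]
      have h4 : ((k - T.card - Nat.sqrt (k - T.card) : ℕ) : ℝ) <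
          (Nat.sqrt (k - T.card) : ℝ) * (Nat.sqrt (k - T.card) : ℝ) ↔
          k - T.card - Nat.sqrt (k - T.card) < Nat.sqrt (k - T.card) * Nat.sqrt (k - T.card) := by
        exact_mod_cast Iff.rfl
      simp only [h4]
      by_cases h5 : k - T.card - Nat.sqrt (k - T.card) < Nat.sqrt (k - T.card) * Nat.sqrt (k - T.card) <;>
        simp [h5]
  have key : Sampling L k (if c = true then T' else T) m (if c = true then m else a - 1) y
      (if c = true then σ * (1 - y) else σ) δ s₅ := by
    have w : ∀ c, c ≠ 8 → s₅.word c = s₃.word c := fun c hc => by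
      rw [h1, Function.update_of_ne hc, w4]
    exact
    { size := by rw [w 3 (by decide), w3 3 (by decide) (by decide) (by decide), h.size]
      order := by rw [w 4 (by decide), w3 4 (by decide) (by decide) (by decide), h.order]
      card := by rw [w 7 (by decide), c3]
      batch := hb
      attempts := by rw [w 9 (by decide), a3]
      maxAttempts := by rw [w 10 (by decide), w3 10 (by decide) (by decide) (by decide), h.maxAttempts]
      selected := by rw [HoldsSet, w 2 (by decide)]; exact u3
      matrix := by rw [HoldsMatrix, h2, r4 0 (by decide)]; exact h.matrix
      tolerance := by rw [h2, r4 1 (by decide), h.tolerance]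
      miss := by rw [h2, r4 7 (by decide), h.miss]
      success := by rw [h2, g4] }
  cases c <;> simpa using key

theorem attempt_timeBound (t : ℕ) : attempt.timeBound t = propose.timeBound t + (sample.timeBound t +
    (assess.timeBound t + ((Prog.flip 17 (cube 0) acceptBias).timeBound 0 + update.timeBound t))) := rfl

/-- The law of one round. -/
theorem Runs.attempt_seq (hL : L.PosSemidef) (hpad : ∀ S, Fin.last n ∈ S → dppWeight L S = 0)
    (hkn : k ≤ n) (ht : Nat.clog 2 (n + 1) ≤ t) (hT : T.card < k) (hT0 : 0 < condZ L k T)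
    (h : Sampling L k T m a y σ δ s) {P : Prog} {φ : Config → ENNReal} {τ : ℕ}
    (va : Finset (Fin (n + 1)) → ENNReal) (vr : ENNReal)
    (hacc : ∀ T', T'.card = T.card + Nat.sqrt (k - T.card) → 0 < condZ L k T' →
      ∀ s', Sampling L k T' m m y (σ * (1 - y)) δ s' → s'.time ≤ s.time + attempt.timeBound t →
      Runs P s' φ (va T') τ)
    (hrej : ∀ s', Sampling L k T m (a - 1) y σ δ s' → s'.time ≤ s.time + attempt.timeBound t →
      Runs P s' φ vr τ) :
    Runs (.seq attempt P) s φ (∑ x : Fin (Nat.sqrt (k - T.card)) → Fin (n + 1),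
      (∏ i, ENNReal.ofReal (proposal L k T (x i) / (((k : ℝ) - T.card) * condZ L k T))) *
        (ENNReal.ofReal (acceptProb L k T (Nat.sqrt (k - T.card)) (Finset.univ.image x)) *
            va (Finset.univ.image x ∪ T) +
          ENNReal.ofReal (1 - acceptProb L k T (Nat.sqrt (k - T.card)) (Finset.univ.image x)) *
            vr)) τ := by
  classical
  set l := Nat.sqrt (k - T.card) with hl
  have hlk : l ≤ k - T.card := Nat.sqrt_le_self _
  have hl2 : (l : ℝ) ^ 2 ≤ (k : ℝ) - T.card := by
    rw [← Nat.cast_sub hT.le, pow_two]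
    exact_mod_cast Nat.sqrt_le _
  have htb := attempt_timeBound t
  refine Runs.assoc (Runs.det_seq (propose_spec hpad hkn ht hT.le h).frame ?_)
  rintro s₁ ⟨⟨q1, g1⟩, w1, r1⟩ t1
  have h1 : Sampling L k T m a y σ δ s₁ := h.congr
    (fun c hc => w1 c (by fin_cases hc <;> rfl)) (fun c hc => r1 c (by fin_cases hc <;> rfl))
  refine Runs.assoc ?_
  set q : ℕ → ℝ := fun i => if hi : i < n + 1 then proposal L k T ⟨i, hi⟩ else 0 with hq
  have hqi : ∀ i : Fin (n + 1), q i = proposal L k T i := fun i => by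
    simp only [hq, dif_pos i.isLt]
  have hp0 : ∀ i, 0 ≤ proposal L k T i := fun i => by
    unfold proposal
    split_ifs
    · exact le_rfl
    · exact condZ_nonneg hL _ _
  have hsum : ∑ i ∈ Finset.Ico 0 (n + 1), q i = ((k : ℝ) - T.card) * condZ L k T := by
    rw [← sum_proposal, ← Finset.range_eq_Ico, Finset.sum_range]
    exact Finset.sum_congr rfl fun i _ => hqi i
  have hr0 : (0 : ℝ) < (k : ℝ) - T.card := by rw [sub_pos]; exact_mod_cast hT
  have key := Runs.sample_seq (P := .seq (.seq assess (.seq (.flip 17 (cube 0) acceptBias) update)) P)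
    (φ := φ) (τ := τ) ht h1.size (q := q) (fun i => by
      simp only [hq]; split_ifs
      · exact hp0 _
      · exact le_rfl)
    (fun i hi => by rw [q1 ⟨i, hi⟩, hqi ⟨i, hi⟩])
    (by rw [hsum]; exact mul_pos hr0 hT0) h1.batch (by omega)
    (fun R => ENNReal.ofReal (acceptProb L k T l R) * va (R ∪ T) +
          ENNReal.ofReal (1 - acceptProb L k T l R) * vr) ?_
  · simpa only [hsum, hqi] using key
  intro R _ hR s₂ u2 w2 r2 t2
  have hRT : ∀ i ∈ R, i ∉ T ∧ 0 < condZ L k (insert i T) := by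
    intro i hi
    have := hR i hi
    rw [hqi, proposal] at this
    split_ifs at this with hiT
    · exact absurd this (lt_irrefl _)
    · exact ⟨hiT, this⟩
  have h2 : Sampling L k T m a y σ δ s₂ := h1.congr
    (fun c hc => w2 c (by fin_cases hc <;> rfl)) (fun c hc => r2 c (by fin_cases hc <;> rfl))
  refine Runs.assoc (Runs.det_seq (assess_spec (R := R) hpad hkn ht hT.le h2
    (by rw [r2 3 rfl]; exact q1) (by rw [r2 5 rfl]; exact g1) u2 fun i hi => (hRT i hi).1).frame ?_)
  rintro s₃ ⟨⟨b3, u3⟩, w3, r3⟩ t3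
  have h3 : Sampling L k T m a y σ δ s₃ := h2.congr
    (fun c hc => w3 c (by fin_cases hc <;> rfl)) (fun c hc => r3 c (by fin_cases hc <;> rfl))
  have ha0 := acceptProb_nonneg hL hl2 hT R
  have ha1 := acceptProb_le_one hL hl2 hT hT0 fun i hi => (hRT i hi).2
  rw [← coinMass_true ha0 ha1, ← coinMass_false ha0 ha1, ← b3]
  refine Runs.assoc (Runs.flip_reg (fun c => if c = true then va (R ∪ T) else vr) ?_)
  intro c hc s₄ w4 r4 t4
  rw [b3] at hc
  have h4 : Sampling L k T m a y σ δ s₄ := h3.congr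
    (fun c hc => by rw [w4, Function.update_of_ne]; rintro rfl; exact absurd hc (by decide))
    (fun c _ => by rw [r4])
  -- Only outcomes of positive mass are considered. An accepting coin has positive bias, which
  -- forces a batch of full size and a possible enlarged set.
  have hacc0 : c = true → R.card = l ∧ 0 < condZ L k (R ∪ T) := by
    rintro rfl
    rw [coinMass_true ha0 ha1, Ne, ENNReal.ofReal_eq_zero, not_le, acceptProb] at hc
    split_ifs at hc with hcard
    · refine ⟨hcard, (condZ_nonneg hL k _).lt_of_ne fun h0 => ?_⟩
      rw [← h0] at hc
      simp at hc
    · exact absurd hc (lt_irrefl _)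
  refine Runs.det_seq (update_spec (t := t) (c := c) (T' := R ∪ T) hT h4 (by rw [w4]; simp)
    (by rw [HoldsSet, w4, Function.update_of_ne (by decide)]; exact u3) ?_) ?_
  · intro hc'
    rw [Finset.card_union_of_disjoint (Finset.disjoint_left.2 fun i hi => (hRT i hi).1),
      (hacc0 hc').1, add_comm]
  intro s₅ h5 t5
  have t6 : s₅.time ≤ s.time + attempt.timeBound t := by omega
  cases c
  · exact hrej s₅ (by simpa using h5) t6
  · refine hacc (R ∪ T) ?_ (hacc0 rfl).2 s₅ (by simpa using h5) t6
    rw [Finset.card_union_of_disjoint (Finset.disjoint_left.2 fun i hi => (hRT i hi).1),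
      (hacc0 rfl).1, add_comm]

end AttemptRule

/-! ### The main loop -/

section MainLoop

variable {n k t : ℕ} {L : Matrix (Fin (n + 1)) (Fin (n + 1)) ℝ} {T : Finset (Fin (n + 1))}
  {m a : ℕ} {y σ δ : ℝ} {s : Config}

/-- The value of one round if acceptance continues with `A` times the conditional probability and
rejection with `B`: each alternative has total mass one half. -/
theorem sum_round (hL : L.PosSemidef) (hT : T.card < k) (hT0 : 0 < condZ L k T) {l : ℕ}
    (hl : l ≤ k - T.card) (hl2 : (l : ℝ) ^ 2 ≤ (k : ℝ) - T.card) (S : Finset (Fin (n + 1)))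
    {A B : ℝ} (hA : 0 ≤ A) (hB : 0 ≤ B) :
    ∑ x : Fin l → Fin (n + 1),
      (∏ i, ENNReal.ofReal (proposal L k T (x i) / (((k : ℝ) - T.card) * condZ L k T))) *
        (ENNReal.ofReal (acceptProb L k T l (Finset.univ.image x)) *
            ENNReal.ofReal (A * condProb L k S (Finset.univ.image x ∪ T)) +
          ENNReal.ofReal (1 - acceptProb L k T l (Finset.univ.image x)) * ENNReal.ofReal B) =
      ENNReal.ofReal ((A * condProb L k S T + B) / 2) := by
  have hr0 : (0 : ℝ) < (k : ℝ) - T.card := by rw [sub_pos]; exact_mod_cast hT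
  set w : (Fin l → Fin (n + 1)) → ℝ := fun x =>
    ∏ i, proposal L k T (x i) / (((k : ℝ) - T.card) * condZ L k T) with hw
  set α : (Fin l → Fin (n + 1)) → ℝ := fun x => acceptProb L k T l (Finset.univ.image x) with hα
  have hp0 : ∀ i, 0 ≤ proposal L k T i / (((k : ℝ) - T.card) * condZ L k T) := fun i => by
    refine div_nonneg ?_ (mul_pos hr0 hT0).le
    unfold proposal
    split_ifs
    · exact le_rfl
    · exact condZ_nonneg hL _ _
  have hw0 : ∀ x, 0 ≤ w x := fun x => Finset.prod_nonneg fun i _ => hp0 _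
  have hα0 : ∀ x, 0 ≤ α x := fun x => acceptProb_nonneg hL hl2 hT _
  -- The bound uses positive marginals, which a proposal of positive mass guarantees; the other
  -- proposals have weight zero in the sum.
  have hα1 : ∀ x, w x ≠ 0 → α x ≤ 1 := by
    intro x hx
    refine acceptProb_le_one hL hl2 hT hT0 fun i hi => ?_
    obtain ⟨j, -, rfl⟩ := Finset.mem_image.1 hi
    have := Finset.prod_ne_zero_iff.1 hx j (Finset.mem_univ j)
    refine (condZ_nonneg hL _ _).lt_of_ne fun h0 => this ?_
    rw [proposal, ← h0]
    simp
  have hψ0 : ∀ T, 0 ≤ condProb L k S T := condProb_nonneg hL k S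
  have hterm : ∀ x, (∏ i, ENNReal.ofReal
      (proposal L k T (x i) / (((k : ℝ) - T.card) * condZ L k T))) *
        (ENNReal.ofReal (α x) * ENNReal.ofReal (A * condProb L k S (Finset.univ.image x ∪ T)) +
          ENNReal.ofReal (1 - α x) * ENNReal.ofReal B) =
      ENNReal.ofReal (A * (w x * (α x * condProb L k S (Finset.univ.image x ∪ T))) +
        B * (w x - w x * α x)) := by
    intro x
    rw [← ENNReal.ofReal_prod_of_nonneg fun i _ => hp0 _]
    change ENNReal.ofReal (w x) * _ = _
    by_cases hx : w x = 0
    · simp [hx]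
    · have h1 : 0 ≤ 1 - α x := by linarith [hα1 x hx]
      rw [← ENNReal.ofReal_mul (hα0 x), ← ENNReal.ofReal_mul h1, ← ENNReal.ofReal_add
        (mul_nonneg (hα0 x) (mul_nonneg hA (hψ0 _))) (mul_nonneg h1 hB), ← ENNReal.ofReal_mul (hw0 x)]
      congr 1
      ring
  have hnn : ∀ x, 0 ≤ A * (w x * (α x * condProb L k S (Finset.univ.image x ∪ T))) +
        B * (w x - w x * α x) := by
    intro x
    refine add_nonneg (mul_nonneg hA (mul_nonneg (hw0 x) (mul_nonneg (hα0 x) (hψ0 _))))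
      (mul_nonneg hB ?_)
    by_cases hx : w x = 0
    · simp [hx]
    · nlinarith [hα1 x hx, hw0 x]
  rw [Finset.sum_congr rfl fun x _ => hterm x, ← ENNReal.ofReal_sum_of_nonneg fun x _ => hnn x]
  congr 1
  rw [Finset.sum_add_distrib, ← Finset.mul_sum, ← Finset.mul_sum, Finset.sum_sub_distrib,
    sum_proposal_acceptProb_condProb hL hl hT hT0 S, sum_prod_proposal l hT hT0,
    sum_proposal_acceptProb hL hl hT hT0]
  ring

/-- Report the selected set with the right probability if it is complete. -/
def report : Prog :=
  .seq (.flip 1 (cube 0) (.rite (.weq (.reg 7) (.reg 4))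
    (.rdiv (.rsub (.ofWord (.lit 1)) (.rreg 1)) (.rreg 8)) (.ofWord (.lit 0)))) .skip

/-- The condition of the main loop. -/
def unfinished : Exp .word := .wite (.wlt (.reg 7) (.reg 4)) (.reg 9) (.lit 0)

/-- Complete the selection. -/
def completeSelection : Prog := .seq (.loop unfinished attempt) report

/-- The test whether the output is `S`. -/
noncomputable def outputIs {n : ℕ} (S : Finset (Fin n)) (s : Config) : ENNReal :=
  if output n s = some S then 1 else 0

theorem output_eq_some_iff (hT : HoldsSet s 2 T) (hlast : Fin.last n ∉ T) (h1 : s.word 1 [] ≠ 0)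
    (S : Finset (Fin n)) : output n s = some S ↔ S.map Fin.castSuccEmb = T := by
  rw [output, if_neg h1, Option.some_inj]
  have hi : ∀ i : Fin n, s.word 2 [(i : ℕ)] ≠ 0 ↔ i.castSucc ∈ T := fun i => by
    have := hT i.castSucc
    rw [Fin.val_castSucc] at this
    rw [this]
    split_ifs with h <;> simp [h]
  simp only [hi]
  constructor
  · rintro rfl
    ext i
    refine Fin.lastCases ?_ (fun i => ?_) i
    · simp [hlast]
    · simp
  · rintro rfl
    ext i
    simp

/-- The last coin, of bias `(1 - δ) / σ`, levels the success probability from `σ` down to `1 - δ`;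
it is a genuine probability because `σ ≥ 1 - δ`. -/
theorem report_runs (hpad : ∀ S, Fin.last n ∈ S → dppWeight L S = 0)
    (hT0 : 0 < condZ L k T) (h : Sampling L k T m a y σ δ s) (S : Finset (Fin n))
    (hσ : 1 - δ ≤ σ) (hδ : δ < 1) :
    Runs report s (outputIs S) (ENNReal.ofReal (if T.card = k then
      (1 - δ) / σ * condProb L k (S.map Fin.castSuccEmb) T else 0))
      (s.time + report.timeBound 0) := by
  have hlast : Fin.last n ∉ T := fun hl => by
    have := condZ_insert_last hpad k T
    rw [Finset.insert_eq_of_mem hl] at this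
    exact hT0.ne' this
  have hσ0 : 0 < σ := by linarith
  have hb0 : 0 ≤ (1 - δ) / σ := div_nonneg (by linarith) hσ0.le
  have hb1 : (1 - δ) / σ ≤ 1 := div_le_one_of_le₀ hσ hσ0.le
  refine ((Runs.flip_reg (v := fun c => if c = true then
    (if S.map Fin.castSuccEmb = T then 1 else 0) else 0) (τ := s.time + report.timeBound 0) ?_)).congr_value ?_
  · intro c hc s' w r ht
    have hs' : HoldsSet s' 2 T := by
      rw [HoldsSet, w, Function.update_of_ne (by decide)]; exact h.selected
    refine (Runs.of_det (t := 0) (Det.skip ?_)).mono ?_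
    · rw [outputIs]
      cases c
      · have : s'.word 1 [] = 0 := by simp [w]
        simp [output, this]
      · have : s'.word 1 [] ≠ 0 := by simp [w]
        simp only [output_eq_some_iff hs' hlast this S, if_true]
    · simp only [report, Prog.timeBound] at ht ⊢
      omega
  · simp only [Exp.eval, Exp.eval_weq, Exp.eval_reg, Exp.eval_rreg, h.card, h.order, h.tolerance,
      h.success, if_true, Bool.false_eq_true, if_false, mul_zero, add_zero]
    by_cases hc : T.card = k
    · rw [if_pos hc, if_pos hc, if_pos one_ne_zero, Nat.cast_one, coinMass_true hb0 hb1]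
      rw [condProb, condZ_of_card_eq hc]
      rw [condZ_of_card_eq hc] at hT0
      by_cases hS : S.map Fin.castSuccEmb = T
      · rw [if_pos hS, hS, if_pos ⟨Finset.Subset.refl _, hc⟩, div_self hT0.ne', mul_one,
          mul_one]
      · rw [if_neg hS, if_neg]
        · simp
        · rintro ⟨h1, h2⟩
          exact hS (Finset.eq_of_subset_of_card_le h1 (by omega)).symm
    · simp [hc, coinMass]

/-- Squaring reduces this to `l ≥ √r / 2 - 1 / 16`, which follows from `√r ≤ l + 1 ≤ 2 * l`. It
bounds the number of batches by `4 * √k`. -/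
theorem sqrt_sub_natSqrt_le {r : ℕ} (hr : 0 < r) :
    √((r - Nat.sqrt r : ℕ) : ℝ) ≤ √(r : ℝ) - 1 / 4 := by
  set l := Nat.sqrt r with hl
  have h1 : l ≤ r := Nat.sqrt_le_self r
  have h2 : r < (l + 1) * (l + 1) := Nat.lt_succ_sqrt r
  have h3 : 1 ≤ l := Nat.sqrt_pos.2 hr
  have h4 : √(r : ℝ) ≤ l + 1 := by
    rw [Real.sqrt_le_left (by positivity)]
    rw [pow_two]
    exact_mod_cast h2.le
  have h5 : (1 : ℝ) ≤ √(r : ℝ) := by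
    rw [Real.one_le_sqrt]; exact_mod_cast hr
  have h6 : (1 : ℝ) ≤ l := by exact_mod_cast h3
  have h7 := Real.sq_sqrt (Nat.cast_nonneg (α := ℝ) r)
  rw [Real.sqrt_le_left (by linarith), Nat.cast_sub h1]
  nlinarith

theorem Sampling.charge (h : Sampling L k T m a y σ δ s) (u v : ℕ) :
    Sampling L k T m a y σ δ (s.charge u v) :=
  h.congr (fun _ _ => rfl) fun _ _ => rfl

/-- The law of the output of the main loop. -/
theorem completeSelection_runs (hL : L.PosSemidef)
    (hpad : ∀ S, Fin.last n ∈ S → dppWeight L S = 0) (hkn : k ≤ n)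
    (ht : Nat.clog 2 (n + 1) ≤ t) (hδ : δ < 1) (hy : y = (1 / 2) ^ m) (hky : k * y ≤ δ)
    (S : Finset (Fin n)) (N : ℕ) :
    ∀ (T : Finset (Fin (n + 1))) (a : ℕ) (σ : ℝ) (s : Config), Sampling L k T m a y σ δ s →
      T.card ≤ k → 0 < condZ L k T → 1 - T.card * y ≤ σ → a ≤ m →
      a + 4 * m * √((k - T.card : ℕ) : ℝ) ≤ N →
      Runs completeSelection s (outputIs S)
        (ENNReal.ofReal ((if T.card = k then 1 else (1 - (1 / 2) ^ a) / (1 - y)) *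
          ((1 - δ) / σ * condProb L k (S.map Fin.castSuccEmb) T)))
        (s.time + N * (1 + unfinished.size + attempt.timeBound t) +
          (1 + unfinished.size + report.timeBound 0)) := by
  have hy0 : 0 < y := by rw [hy]; positivity
  -- The cases in which the loop ends: selection complete, or no tries left. In general the present
  -- batch is completed with probability `1 - (1 / 2) ^ a` and each later one with probability `1 -
  -- y`, while the final bias divides by `σ` and by `1 - y` for every batch still to come. All but
  -- one of the factors `1 - y` cancel, which explains the claimed value.
  have hfin : ∀ (N : ℕ) (T : Finset (Fin (n + 1))) (a : ℕ) (σ : ℝ) (s : Config),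
      Sampling L k T m a y σ δ s → T.card ≤ k → 0 < condZ L k T → 1 - T.card * y ≤ σ →
      (T.card = k ∨ a = 0) →
      Runs completeSelection s (outputIs S)
        (ENNReal.ofReal ((if T.card = k then 1 else (1 - (1 / 2) ^ a) / (1 - y)) *
          ((1 - δ) / σ * condProb L k (S.map Fin.castSuccEmb) T)))
        (s.time + N * (1 + unfinished.size + attempt.timeBound t) +
          (1 + unfinished.size + report.timeBound 0)) := by
    intro N T a σ s h hT hT0 hσ hor
    have hTy : (T.card : ℝ) * y ≤ k * y := by gcongr
    refine (Runs.loop_false ?_ ((report_runs hpad hT0 (h.charge _ _) S (by linarith) hδ).mono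
      (τ' := _) ?_)).congr_value ?_
    · simp only [Exp.ctrl, unfinished, Exp.eval, Exp.eval_reg, h.card, h.order, h.attempts]
      rcases hor with h1 | h1
      · simp [h1]
      · simp [h1]
    · simp only [Config.charge]
      omega
    · congr 1
      rcases hor with h1 | h1
      · rw [if_pos h1, if_pos h1, one_mul]
      · by_cases h2 : T.card = k
        · rw [if_pos h2, if_pos h2, one_mul]
        · rw [if_neg h2, if_neg h2, h1]; simp
  -- `N` bounds the potential `a + 4 * m * √r`, which decreases by at least one in each round.
  induction N with
  | zero =>
    intro T a σ s h hT hT0 hσ ham hN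
    refine hfin 0 T a σ s h hT hT0 hσ (Or.inr ?_)
    have h1 : (0 : ℝ) ≤ 4 * m * √((k - T.card : ℕ) : ℝ) := by positivity
    have h2 : (a : ℝ) ≤ 0 := by push_cast at hN; linarith
    exact_mod_cast le_antisymm h2 (Nat.cast_nonneg a)
  | succ N ih =>
    intro T a σ s h hT hT0 hσ ham hN
    by_cases hor : T.card = k ∨ a = 0
    · exact hfin (N + 1) T a σ s h hT hT0 hσ hor
    push Not at hor
    have hTk : T.card < k := lt_of_le_of_ne hT hor.1
    obtain ⟨a, rfl⟩ : ∃ a', a = a' + 1 := ⟨a - 1, by omega⟩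
    have hTy : (T.card : ℝ) * y ≤ k * y := by gcongr
    have hk1 : (1 : ℝ) ≤ k := by exact_mod_cast (by omega : 1 ≤ k)
    have hy1 : y < 1 := by nlinarith
    have hσ0 : 0 < σ := by linarith
    set l := Nat.sqrt (k - T.card) with hl
    have hlk : l ≤ k - T.card := Nat.sqrt_le_self _
    have hl1 : 1 ≤ l := Nat.sqrt_pos.2 (by omega)
    have hl2 : (l : ℝ) ^ 2 ≤ (k : ℝ) - T.card := by
      rw [← Nat.cast_sub hT, pow_two]
      exact_mod_cast Nat.sqrt_le _
    have hβ : 0 ≤ (1 - δ) / σ := div_nonneg (by linarith) hσ0.le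
    have hpow : (1 / 2 : ℝ) ^ a ≤ 1 := pow_le_one₀ (by norm_num) (by norm_num)
    set S' := S.map Fin.castSuccEmb with hS'
    refine (Runs.loop_true ?_ (Runs.attempt_seq hL hpad hkn ht hTk hT0 (h.charge _ _)
      (fun T' => ENNReal.ofReal ((1 - δ) / σ / (1 - y) * condProb L k S' T'))
      (ENNReal.ofReal ((1 - (1 / 2) ^ a) / (1 - y) * ((1 - δ) / σ * condProb L k S' T)))
      ?_ ?_)).congr_value ?_
    · simp [Exp.ctrl, unfinished, Exp.eval, h.card, h.order, h.attempts, hTk]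
    · intro T' hT' hT'0 s' hs' htime
      have hc' : T'.card ≤ k := card_le_of_condZ_pos hT'0
      have hst : √((k - T'.card : ℕ) : ℝ) ≤ √((k - T.card : ℕ) : ℝ) - 1 / 4 := by
        have := sqrt_sub_natSqrt_le (r := k - T.card) (by omega)
        rwa [show k - T'.card = k - T.card - Nat.sqrt (k - T.card) by omega]
      -- The success bound survives since `(1 - |T| * y) * (1 - y) ≥ 1 - (|T| + l) * y` for `l ≥ 1`.
      -- Resetting the counter costs `m`, which the drop of `√r` by `1 / 4` pays for.
      refine ((ih T' m (σ * (1 - y)) s' hs' hc' hT'0 ?_ le_rfl ?_).mono ?_).congr_value ?_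
      · rw [hT']
        push_cast
        have hl1' : (1 : ℝ) ≤ l := by exact_mod_cast hl1
        have h1 := mul_le_mul_of_nonneg_right hσ (by linarith : 0 ≤ 1 - y)
        have h2 := mul_le_mul_of_nonneg_right hl1' hy0.le
        have h3 : 0 ≤ (T.card : ℝ) * (y * y) := by positivity
        nlinarith
      · push_cast at hN
        have hm0 : (0 : ℝ) ≤ m := Nat.cast_nonneg m
        have := mul_le_mul_of_nonneg_left hst hm0
        have ha0 : (0 : ℝ) ≤ a := Nat.cast_nonneg a
        linarith
      · simp only [Config.charge] at htime
        have : (N + 1) * (1 + unfinished.size + attempt.timeBound t) =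
          N * (1 + unfinished.size + attempt.timeBound t) +
            (1 + unfinished.size + attempt.timeBound t) := by ring
        omega
      · congr 1
        -- A fresh batch has the full `m` tries, so the factor is `1` by the choice `y = (1 / 2) ^
        -- m`.
        have h1 : (if T'.card = k then 1 else (1 - (1 / 2) ^ m) / (1 - y)) = (1 : ℝ) := by
          split_ifs
          · rfl
          · rw [← hy, div_self (by linarith)]
        rw [h1, one_mul, div_div]
    · intro s' hs' htime
      rw [Nat.add_sub_cancel] at hs'
      refine ((ih T a σ s' hs' hT hT0 hσ (by omega) ?_).mono ?_).congr_value ?_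
      · push_cast at hN
        linarith
      · simp only [Config.charge] at htime
        have : (N + 1) * (1 + unfinished.size + attempt.timeBound t) =
          N * (1 + unfinished.size + attempt.timeBound t) +
            (1 + unfinished.size + attempt.timeBound t) := by ring
        omega
      · rw [if_neg hor.1]
    -- With acceptance and rejection equally likely, the recursion is `1 - 2 ^ (-(a + 1)) = (1 + (1
    -- - 2 ^ (-a))) / 2`.
    · rw [sum_round hL hTk hT0 hlk hl2 S' (div_nonneg hβ (by linarith))
        (mul_nonneg (div_nonneg (by linarith) (by linarith)) (mul_nonneg hβ (condProb_nonneg hL k S' T))),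
        if_neg hor.1]
      congr 1
      have : 1 - y ≠ 0 := by linarith
      rw [pow_succ]
      field_simp
      ring

end MainLoop

/-! ### Padding -/

section Padding

variable {n : ℕ}

/-- Add a zero row and a zero column. -/
def padMatrix (L : Matrix (Fin n) (Fin n) ℝ) : Matrix (Fin (n + 1)) (Fin (n + 1)) ℝ :=
  Matrix.of fun i j => if h : (i : ℕ) < n ∧ (j : ℕ) < n then L ⟨i, h.1⟩ ⟨j, h.2⟩ else 0

theorem padMatrix_castSucc (L : Matrix (Fin n) (Fin n) ℝ) (i j : Fin n) :
    padMatrix L i.castSucc j.castSucc = L i j := by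
  simp [padMatrix]

theorem padMatrix_last_left (L : Matrix (Fin n) (Fin n) ℝ) (j : Fin (n + 1)) :
    padMatrix L (Fin.last n) j = 0 := by
  simp [padMatrix]

theorem padMatrix_last_right (L : Matrix (Fin n) (Fin n) ℝ) (i : Fin (n + 1)) :
    padMatrix L i (Fin.last n) = 0 := by
  simp [padMatrix]

/-- The padded matrix is `Jᵀ * L * J` for the inclusion matrix `J`. -/
theorem padMatrix_posSemidef {L : Matrix (Fin n) (Fin n) ℝ} (hL : L.PosSemidef) :
    (padMatrix L).PosSemidef := by
  have h := hL.conjTranspose_mul_mul_same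
    (Matrix.of fun (i : Fin n) (j : Fin (n + 1)) => if i.castSucc = j then (1 : ℝ) else 0)
  convert h using 1
  ext i j
  simp only [Matrix.mul_apply, Matrix.conjTranspose_apply, Matrix.of_apply, star_trivial]
  refine Fin.lastCases ?_ (fun j => ?_) j
  · simp [padMatrix_last_right, Fin.castSucc_ne_last]
  refine Fin.lastCases ?_ (fun i => ?_) i
  · simp [padMatrix_last_left, Fin.castSucc_ne_last]
  · simp [padMatrix_castSucc]

theorem dppWeight_padMatrix_last (L : Matrix (Fin n) (Fin n) ℝ) (S : Finset (Fin (n + 1)))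
    (hS : Fin.last n ∈ S) : dppWeight (padMatrix L) S = 0 :=
  Matrix.det_eq_zero_of_row_eq_zero ⟨Fin.last n, hS⟩ fun _ => padMatrix_last_left L _

theorem dppWeight_padMatrix_map (L : Matrix (Fin n) (Fin n) ℝ) (S : Finset (Fin n)) :
    dppWeight (padMatrix L) (S.map Fin.castSuccEmb) = dppWeight L S := by
  let e : S ≃ S.map Fin.castSuccEmb :=
    (Equiv.ofInjective (fun i : S => (⟨Fin.castSuccEmb i, Finset.mem_map_of_mem _ i.2⟩ : S.map Fin.castSuccEmb))
      fun i j h => Subtype.ext (Fin.castSuccEmb.injective (congrArg Subtype.val h))).trans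
    (Equiv.subtypeUnivEquiv fun i => by
      obtain ⟨j, hj, hji⟩ := Finset.mem_map.1 i.2
      exact ⟨⟨j, hj⟩, Subtype.ext hji⟩)
  rw [dppWeight, ← Matrix.det_submatrix_equiv_self e, dppWeight]
  congr 1
  ext i j
  exact padMatrix_castSucc L i j

theorem kdppZ_padMatrix (L : Matrix (Fin n) (Fin n) ℝ) (k : ℕ) :
    kdppZ (padMatrix L) k = kdppZ L k := by
  symm
  refine Finset.sum_of_injOn (fun S => S.map Fin.castSuccEmb)
    (fun S _ S' _ h => Finset.map_injective _ h) ?_ ?_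
    fun S _ => (dppWeight_padMatrix_map L S).symm
  · intro S hS
    simpa [Finset.mem_powersetCard] using hS
  · intro S hS hS'
    refine dppWeight_padMatrix_last L S ?_
    by_contra hl
    refine hS' ⟨Finset.univ.filter fun i : Fin n => i.castSucc ∈ S, ?_, ?_⟩
    all_goals
      have hmap : (Finset.univ.filter fun i : Fin n => i.castSucc ∈ S).map Fin.castSuccEmb = S := by
        ext i
        refine Fin.lastCases ?_ (fun i => ?_) i
        · simp [hl]
        · simp
    · rw [← hmap] at hS
      simpa [Finset.mem_powersetCard] using hS
    · exact hmap

theorem condProb_padMatrix (L : Matrix (Fin n) (Fin n) ℝ) (k : ℕ) (S : Finset (Fin n)) :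
    condProb (padMatrix L) k (S.map Fin.castSuccEmb) ∅ = kdppProb L k S := by
  rw [condProb, kdppProb, condZ_empty, kdppZ_padMatrix, dppWeight_padMatrix_map, Finset.card_map]
  simp

end Padding

/-! ### Preparation of the main loop -/

/-- Compute the batch size. -/
def prepareBatch : Prog :=
  .seq (.wset 8 (cube 0) (.lit 0))
    (.loop (.wsub (.lit 1) (.rlt (.ofWord (.reg 4)) (.rmul (.ofWord (.wadd (.reg 8) (.lit 1)))
        (.ofWord (.wadd (.reg 8) (.lit 1))))))
      (.wset 8 (cube 0) (.wadd (.reg 8) (.lit 1))))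

/-- Compute the number of attempts for each batch. -/
def prepareAttempts : Prog :=
  .seq (.wset 10 (cube 0) (.lit 0)) (.seq (.rset 9 (cube 0) (.ofWord (.reg 4)))
    (.seq (.rset 7 (cube 0) (.ofWord (.lit 1)))
      (.loop (.rlt (.rreg 1) (.rreg 9))
        (.seq (.rset 9 (cube 0) (.rdiv (.rreg 9) (.ofWord (.lit 2))))
          (.seq (.rset 7 (cube 0) (.rdiv (.rreg 7) (.ofWord (.lit 2))))
            (.wset 10 (cube 0) (.wadd (.reg 10) (.lit 1))))))))

/-- Set up the main loop. -/
def prepare : Prog :=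
  .seq prepareBatch (.seq prepareAttempts (.seq (.wset 9 (cube 0) (.reg 10))
    (.seq (.wset 7 (cube 0) (.lit 0)) (.rset 8 (cube 0) (.ofWord (.lit 1))))))

/-- The number of attempts for each batch. -/
noncomputable def numAttempts (k : ℕ) (δ : ℝ) : ℕ := Nat.clog 2 ⌈(k : ℝ) / δ⌉₊

/-- This is the loop test of the program: the count is found by halving `k` until it is at most `δ`,
without logarithms or rounding of reals. -/
theorem lt_numAttempts_iff {k : ℕ} {δ : ℝ} (hδ : 0 < δ) {i : ℕ} :
    i < numAttempts k δ ↔ δ < k / 2 ^ i := by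
  rw [numAttempts, Nat.lt_clog_iff_pow_lt one_lt_two, Nat.lt_ceil, lt_div_iff₀ hδ,
    lt_div_iff₀ (by positivity), mul_comm]
  push_cast
  rfl

section Preparation

variable {n k t : ℕ} {s : Config} {δ : ℝ}

/-- Words cannot be multiplied, so squares are compared as reals. The search makes `Nat.sqrt k`
passes, which the time bound can afford once. -/
theorem prepareBatch_spec (hk : s.word 4 [] = k) (ht : Nat.sqrt k ≤ t) :
    Det t prepareBatch s fun s' => s'.word 8 [] = Nat.sqrt k := by
  refine Det.seq (Q := fun s₁ => s₁.word 8 [] = 0 ∧ s₁.word 4 [] = k)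
    (Det.wset fun s₁ h1 _ => ⟨by simp [h1, box, Exp.eval], by simp [h1, hk]⟩) ?_
  rintro s₁ ⟨h8, h4⟩
  have hctrl : ∀ (i : ℕ) (s' : Config), s'.word 8 [] = i → s'.word 4 [] = k →
      ((Exp.wsub (.lit 1) (.rlt (.ofWord (.reg 4)) (.rmul (.ofWord (.wadd (.reg 8) (.lit 1)))
        (.ofWord (.wadd (.reg 8) (.lit 1)))))).ctrl s' = 0 ↔ ¬i < Nat.sqrt k) := by
    intro i s' h1 h2
    have h3 : (k : ℝ) < ((i + 1 : ℕ) : ℝ) * ((i + 1 : ℕ) : ℝ) ↔ ¬i < Nat.sqrt k := by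
      rw [not_lt, ← Nat.lt_succ_iff, Nat.sqrt_lt]
      exact_mod_cast Iff.rfl
    simp only [Exp.ctrl, Exp.eval, Exp.eval_reg, h1, h2, h3]
    by_cases h4 : i < Nat.sqrt k <;> simp [h4]
  refine (Det.loop (N := Nat.sqrt k) (fun i s' => s'.word 8 [] = i ∧ s'.word 4 [] = k) ht
    ⟨h8, h4⟩ (fun i s' u m h => h) ?_ ?_).mono fun s' h => h.1
  · rintro i s' hi ⟨h1, h2⟩
    refine ⟨fun h => (hctrl i s' h1 h2).1 h hi, Det.wset fun s'' h3 _ => ⟨?_, ?_⟩⟩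
    · simp [h3, box, Exp.eval, h1]
    · simp [h3, h2]
  · rintro s' ⟨h1, h2⟩
    exact (hctrl _ s' h1 h2).2 (lt_irrefl _)

theorem prepareAttempts_spec (hδ : 0 < δ) (hk : s.word 4 [] = k) (hs : s.real 1 [] = δ)
    (ht : numAttempts k δ ≤ t) :
    Det t prepareAttempts s fun s' => s'.word 10 [] = numAttempts k δ ∧
      s'.real 7 [] = (1 / 2) ^ numAttempts k δ := by
  refine Det.seq (Q := fun s₁ => s₁.word 10 [] = 0 ∧ s₁.word 4 [] = k ∧ s₁.real = s.real)
    (Det.wset fun s₁ h1 h2 => ⟨by simp [h1, box, Exp.eval], by simp [h1, hk], h2⟩) ?_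
  rintro s₁ ⟨h10, h4, r1⟩
  refine Det.seq (Q := fun s₂ => s₂.word 10 [] = 0 ∧ s₂.real 1 [] = δ ∧ s₂.real 9 [] = k)
    (Det.rset fun s₂ h1 h2 => ⟨by rw [h2, h10], by simp [h1, r1, hs],
      by simp [h1, box, Exp.eval, h4]⟩) ?_
  rintro s₂ ⟨h10, h1, h9⟩
  refine Det.seq (Q := fun s₃ => s₃.word 10 [] = 0 ∧ s₃.real 1 [] = δ ∧ s₃.real 9 [] = k ∧
    s₃.real 7 [] = 1)
    (Det.rset fun s₃ k1 k2 => ⟨by rw [k2, h10], by simp [k1, h1], by simp [k1, h9],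
      by simp [k1, box, Exp.eval]⟩) ?_
  rintro s₃ ⟨h10, h1, h9, h7⟩
  refine (Det.loop (N := numAttempts k δ) (fun i s' => s'.word 10 [] = i ∧ s'.real 1 [] = δ ∧
    s'.real 9 [] = k / 2 ^ i ∧ s'.real 7 [] = (1 / 2) ^ i) ht
    ⟨h10, h1, by simpa using h9, by simpa using h7⟩ (fun i s' u m h => h) ?_ ?_).mono
    fun s' h => ⟨h.1, h.2.2.2⟩
  · rintro i s' hi ⟨h10, h1, h9, h7⟩
    have hlt := (lt_numAttempts_iff hδ).1 hi
    refine ⟨by simp [Exp.ctrl, Exp.eval, h1, h9, hlt], ?_⟩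
    refine Det.seq (Q := fun s₁ => s₁.word 10 [] = i ∧ s₁.real 1 [] = δ ∧
      s₁.real 9 [] = k / 2 ^ (i + 1) ∧ s₁.real 7 [] = (1 / 2) ^ i)
      (Det.rset fun s₁ k1 k2 => ⟨by rw [k2, h10], by simp [k1, h1], ?_, by simp [k1, h7]⟩) ?_
    · simp [k1, box, Exp.eval, h9, pow_succ, div_div]
    rintro s₁ ⟨h10, h1, h9, h7⟩
    refine Det.seq (Q := fun s₁ => s₁.word 10 [] = i ∧ s₁.real 1 [] = δ ∧
      s₁.real 9 [] = k / 2 ^ (i + 1) ∧ s₁.real 7 [] = (1 / 2) ^ (i + 1))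
      (Det.rset fun s₁ k1 k2 => ⟨by rw [k2, h10], by simp [k1, h1], by simp [k1, h9], ?_⟩) ?_
    · simp [k1, box, Exp.eval, h7, pow_succ, div_eq_mul_inv]
    rintro s₂ ⟨h10, h1, h9, h7⟩
    exact Det.wset fun s₃ k1 k2 => ⟨by simp [k1, box, Exp.eval, h10], by rw [k2, h1],
      by rw [k2, h9], by rw [k2, h7]⟩
  · rintro s' ⟨h10, h1, h9, h7⟩
    have := (lt_numAttempts_iff (k := k) hδ).not.1 (lt_irrefl (numAttempts k δ))
    simp [Exp.ctrl, Exp.eval, h1, h9, this]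

theorem prepare_spec {L : Matrix (Fin (n + 1)) (Fin (n + 1)) ℝ} (hδ : 0 < δ)
    (h3 : s.word 3 [] = n + 1) (h4 : s.word 4 [] = k) (h2 : HoldsSet s 2 (∅ : Finset (Fin (n + 1))))
    (hL : HoldsMatrix s L) (h1 : s.real 1 [] = δ) (ht : Nat.sqrt k ≤ t)
    (ht' : numAttempts k δ ≤ t) :
    Det t prepare s (Sampling L k ∅ (numAttempts k δ) (numAttempts k δ)
      ((1 / 2) ^ numAttempts k δ) 1 δ) := by
  refine Det.seq (prepareBatch_spec h4 ht).frame ?_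
  rintro s₁ ⟨e8, w1, r1⟩
  refine Det.seq (prepareAttempts_spec (k := k) hδ (by rw [w1 4 rfl, h4]) (by rw [r1 1 rfl, h1]) ht').frame ?_
  rintro s₂ ⟨⟨e10, e7⟩, w2, r2⟩
  refine Det.seq (Q := fun s₃ => (∀ a, a ≠ 9 → s₃.word a = s₂.word a) ∧ s₃.real = s₂.real ∧
    s₃.word 9 [] = numAttempts k δ) (Det.wset fun s₃ k1 k2 => ⟨fun a ha => by
      rw [k1, Function.update_of_ne ha], k2, by simp [k1, box, e10]⟩) ?_
  rintro s₃ ⟨w3, r3, e9⟩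
  refine Det.seq (Q := fun s₄ => (∀ a, a ≠ 7 → s₄.word a = s₃.word a) ∧ s₄.real = s₃.real ∧
    s₄.word 7 [] = 0) (Det.wset fun s₄ k1 k2 => ⟨fun a ha => by
      rw [k1, Function.update_of_ne ha], k2, by simp [k1, box, Exp.eval]⟩) ?_
  rintro s₄ ⟨w4, r4, c7⟩
  refine Det.rset fun s₅ k1 k2 => ?_
  have w : ∀ a, a ≠ 7 → a ≠ 9 → s₅.word a = s₂.word a := fun a h7 h9 => by
    rw [k2, w4 a h7, w3 a h9]
  have r : ∀ a, a ≠ 8 → s₅.real a = s₂.real a := fun a h8 => by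
    rw [k1, Function.update_of_ne h8, r4, r3]
  exact
  { size := by rw [w 3 (by decide) (by decide), w2 3 rfl, w1 3 rfl, h3]
    order := by rw [w 4 (by decide) (by decide), w2 4 rfl, w1 4 rfl, h4]
    card := by rw [k2, c7, Finset.card_empty]
    batch := by rw [w 8 (by decide) (by decide), w2 8 rfl, e8, Finset.card_empty, Nat.sub_zero]
    attempts := by rw [k2, w4 9 (by decide), e9]
    maxAttempts := by rw [w 10 (by decide) (by decide), e10]
    selected := by rw [HoldsSet, w 2 (by decide) (by decide), w2 2 rfl, w1 2 rfl]; exact h2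
    matrix := by rw [HoldsMatrix, r 0 (by decide), r2 0 rfl, r1 0 rfl]; exact hL
    tolerance := by rw [r 1 (by decide), r2 1 rfl, r1 1 rfl, h1]
    miss := by rw [r 7 (by decide), e7]
    success := by simp [k1, box, Exp.eval] }

end Preparation

/-- Sample from the DPP of the order in word register `4`. -/
def drawFixed : Prog := .seq prepare completeSelection

/-- A bound for the time of `drawFixed`. -/
noncomputable def drawTime (n k : ℕ) (δ : ℝ) : ℕ :=
  prepare.timeBound (Nat.sqrt k + numAttempts k δ) +
    (numAttempts k δ + 4 * numAttempts k δ * (Nat.sqrt k + 1)) *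
      (1 + unfinished.size + attempt.timeBound (Nat.clog 2 (n + 1))) +
    (1 + unfinished.size + report.timeBound 0)

theorem drawFixed_runs {n k : ℕ} {L : Matrix (Fin n) (Fin n) ℝ} {δ : ℝ} {s : Config}
    (hL : L.PosSemidef) (hkn : k ≤ n) (hZ : 0 < kdppZ L k) (hδ : 0 < δ) (hδ1 : δ < 1)
    (h3 : s.word 3 [] = n + 1) (h4 : s.word 4 [] = k) (h2 : HoldsSet s 2 (∅ : Finset (Fin (n + 1))))
    (hM : HoldsMatrix s (padMatrix L)) (h1 : s.real 1 [] = δ) (S : Finset (Fin n)) :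
    Runs drawFixed s (outputIs S) (ENNReal.ofReal ((1 - δ) * kdppProb L k S))
      (s.time + drawTime n k δ) := by
  set m := numAttempts k δ with hm
  refine Runs.det_seq (prepare_spec (t := Nat.sqrt k + m) hδ h3 h4 h2 hM h1 (by omega) (by omega)) ?_
  intro s' hs' ht
  have hky : (k : ℝ) * (1 / 2) ^ m ≤ δ := by
    have := (lt_numAttempts_iff (k := k) hδ).not.1 (lt_irrefl m)
    rw [not_lt] at this
    simpa [div_eq_mul_inv] using this
  have hsq : √(k : ℝ) ≤ Nat.sqrt k + 1 := by
    rw [Real.sqrt_le_left (by positivity), pow_two]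
    exact_mod_cast (Nat.lt_succ_sqrt k).le
  -- The number of rounds is the initial potential with `√k` rounded up.
  refine ((completeSelection_runs (padMatrix_posSemidef hL) (dppWeight_padMatrix_last L) hkn le_rfl
    hδ1 rfl hky S (m + 4 * m * (Nat.sqrt k + 1)) ∅ m 1 s' hs' (by simp) ?_ (by simp) le_rfl ?_).mono
    ?_).congr_value ?_
  · rwa [condZ_empty, kdppZ_padMatrix]
  · rw [Finset.card_empty, Nat.sub_zero]
    push_cast
    gcongr
  · rw [drawTime, ← hm]
    omega
  · rw [condProb_padMatrix]
    congr 1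
    rw [div_one]
    -- Order zero is complete at once. Otherwise `k ≥ 1` and `k * (1 / 2) ^ m ≤ δ < 1` make the
    -- denominator positive.
    have h5 : (if (∅ : Finset (Fin (n + 1))).card = k then 1 else
        (1 - (1 / 2) ^ m) / (1 - (1 / 2) ^ m)) = (1 : ℝ) := by
      split_ifs with hc
      · rfl
      · rw [Finset.card_empty] at hc
        have h6 : (1 : ℝ) ≤ k := by exact_mod_cast (by omega : 1 ≤ k)
        have h7 : (0 : ℝ) < (1 / 2) ^ m := by positivity
        exact div_self (by nlinarith)
    rw [h5, one_mul]

/-! ### Resource bounds -/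

/-- From `2 ^ c < N ≤ 2 * x` follows `(c - 1) * log 2 ≤ log x`; the constant `2` comes from `log 2 >
1 / 2`. -/
theorem clog_le_two_mul_log {N : ℕ} {x : ℝ} (hx : 1 ≤ x) (hN : (N : ℝ) ≤ 2 * x) :
    (Nat.clog 2 N : ℝ) ≤ 2 * (1 + Real.log x) := by
  have hlog : 0 ≤ Real.log x := Real.log_nonneg hx
  obtain hc | ⟨c, hc⟩ : Nat.clog 2 N = 0 ∨ ∃ c, Nat.clog 2 N = c + 1 := by
    rcases Nat.clog 2 N with _ | c
    · exact Or.inl rfl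
    · exact Or.inr ⟨c, rfl⟩
  · rw [hc]; push_cast; linarith
  · have h1 : 2 ^ c < N := (Nat.lt_clog_iff_pow_lt one_lt_two).1 (by omega)
    have h2 : (2 : ℝ) ^ c ≤ 2 * x := le_trans (by exact_mod_cast h1.le) hN
    have h3 := Real.log_le_log (by positivity) h2
    rw [Real.log_pow, Real.log_mul (by norm_num) (by linarith)] at h3
    have h4 := Real.log_two_gt_d9
    rw [hc]
    push_cast
    have h5 : ((c : ℝ) - 1) * Real.log 2 ≤ Real.log x := by linarith
    by_contra h6
    push Not at h6
    nlinarith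

/-- A linear bound is needed because `t` is of size `√k` here; the loops of `prepare` are not
nested. -/
theorem exists_prepare_timeBound_le : ∃ K : ℕ, ∀ t, prepare.timeBound t ≤ K * (t + 1) := by
  refine ⟨10000, fun t => ?_⟩
  simp [prepare, prepareBatch, prepareAttempts, Prog.timeBound, cube, Exp.size, Exp.reg, Exp.rreg]
  omega

/-- The preparation is linear in `√k` plus a logarithm. The main loop makes a logarithmic multiple
of `√k` rounds, each polylogarithmic. The maximum with `1` covers order zero. -/
theorem exists_drawTime_le : ∃ C c : ℕ, ∀ (n k : ℕ) (δ : ℝ), 1 ≤ n → k ≤ n → 0 < δ → δ < 1 →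
    (drawTime n k δ : ℝ) ≤ C * √((max k 1 : ℕ) : ℝ) * (1 + Real.log (n / δ)) ^ c := by
  obtain ⟨K₁, hK₁⟩ := exists_prepare_timeBound_le
  obtain ⟨K₂, d, hK₂⟩ := attempt.exists_timeBound_le
  set u := 1 + unfinished.size with hu
  set v := report.timeBound 0 with hv
  refine ⟨4 * K₁ + 18 * (u + K₂ * 3 ^ d) + (u + v), d + 1, fun n k δ hn hk hδ hδ1 => ?_⟩
  set Λ := 1 + Real.log (n / δ) with hΛ
  set σ := √((max k 1 : ℕ) : ℝ) with hσ
  have hn1 : (1 : ℝ) ≤ n := by exact_mod_cast hn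
  have hx : (n : ℝ) ≤ n / δ := by rw [le_div_iff₀ hδ]; nlinarith
  have hx1 : 1 ≤ (n : ℝ) / δ := hn1.trans hx
  have hΛ1 : 1 ≤ Λ := by linarith [Real.log_nonneg hx1]
  have hσ1 : 1 ≤ σ := by
    rw [hσ, Real.one_le_sqrt]; exact_mod_cast le_max_right k 1
  have hsq : (Nat.sqrt k : ℝ) ≤ σ := by
    refine Real.nat_sqrt_le_real_sqrt.trans (Real.sqrt_le_sqrt ?_)
    exact_mod_cast le_max_left k 1
  have hm : (numAttempts k δ : ℝ) ≤ 2 * Λ := by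
    refine clog_le_two_mul_log hx1 ?_
    have h1 := Nat.ceil_lt_add_one (div_nonneg (Nat.cast_nonneg (α := ℝ) k) hδ.le)
    have h2 : (k : ℝ) / δ ≤ n / δ := by gcongr
    linarith
  have hlam : (Nat.clog 2 (n + 1) : ℝ) ≤ 2 * Λ := by
    refine clog_le_two_mul_log hx1 ?_
    push_cast
    linarith
  set m := numAttempts k δ with hmdef
  set l := Nat.clog 2 (n + 1) with hl
  have hσ0 : 0 ≤ σ := by linarith
  have hΛ0 : 0 ≤ Λ := by linarith
  have hσΛ : 1 ≤ σ * Λ := one_le_mul_of_one_le_of_one_le hσ1 hΛ1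
  have hpow : 1 ≤ Λ ^ d := one_le_pow₀ hΛ1
  have h1 : (prepare.timeBound (Nat.sqrt k + m) : ℝ) ≤ 4 * K₁ * (σ * Λ ^ (d + 1)) := by
    have h2 : (prepare.timeBound (Nat.sqrt k + m) : ℝ) ≤ K₁ * (Nat.sqrt k + m + 1) := by
      exact_mod_cast hK₁ (Nat.sqrt k + m)
    have h3 : (Nat.sqrt k + m + 1 : ℝ) ≤ 4 * (σ * Λ) := by nlinarith
    have h4 : σ * Λ ≤ σ * Λ ^ (d + 1) := by
      rw [pow_succ, ← mul_assoc, mul_right_comm]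
      exact le_mul_of_one_le_right (by positivity) hpow
    calc (prepare.timeBound (Nat.sqrt k + m) : ℝ) ≤ K₁ * (Nat.sqrt k + m + 1) := h2
      _ ≤ K₁ * (4 * (σ * Λ ^ (d + 1))) := by gcongr; linarith
      _ = _ := by ring
  have h5 : ((m + 4 * m * (Nat.sqrt k + 1) : ℕ) : ℝ) ≤ 18 * (σ * Λ) := by
    push_cast
    have h6 : (Nat.sqrt k + 1 : ℝ) ≤ 2 * σ := by linarith
    have h7 : (m : ℝ) * (Nat.sqrt k + 1) ≤ 2 * Λ * (2 * σ) := by gcongr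
    nlinarith
  have h8 : ((u + attempt.timeBound l : ℕ) : ℝ) ≤ (u + K₂ * 3 ^ d) * Λ ^ d := by
    have h9 : (attempt.timeBound l : ℝ) ≤ K₂ * (l + 1) ^ d := by exact_mod_cast hK₂ l
    have h10 : ((l : ℝ) + 1) ^ d ≤ (3 * Λ) ^ d := by gcongr; linarith
    rw [mul_pow] at h10
    push_cast
    have h11 : (K₂ : ℝ) * (l + 1) ^ d ≤ K₂ * (3 ^ d * Λ ^ d) := by gcongr
    have h12 : (u : ℝ) ≤ u * Λ ^ d := le_mul_of_one_le_right (by positivity) hpow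
    linarith
  have h13 : ((u + v : ℕ) : ℝ) ≤ (u + v) * (σ * Λ ^ (d + 1)) := by
    push_cast
    refine le_mul_of_one_le_right (by positivity) ?_
    exact one_le_mul_of_one_le_of_one_le hσ1 (one_le_pow₀ hΛ1)
  have h14 : ((m + 4 * m * (Nat.sqrt k + 1) : ℕ) : ℝ) * ((u + attempt.timeBound l : ℕ) : ℝ) ≤
      18 * (σ * Λ) * ((u + K₂ * 3 ^ d) * Λ ^ d) := by gcongr
  have h15 : (drawTime n k δ : ℝ) = (prepare.timeBound (Nat.sqrt k + m) : ℝ) +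
      ((m + 4 * m * (Nat.sqrt k + 1) : ℕ) : ℝ) * ((u + attempt.timeBound l : ℕ) : ℝ) +
      ((u + v : ℕ) : ℝ) := by
    have : drawTime n k δ = prepare.timeBound (Nat.sqrt k + m) +
      (m + 4 * m * (Nat.sqrt k + 1)) * (u + attempt.timeBound l) + (u + v) := rfl
    rw [this, Nat.cast_add, Nat.cast_add, Nat.cast_mul]
  rw [h15]
  refine (add_le_add (add_le_add h1 h14) h13).trans (le_of_eq ?_)
  push_cast
  ring

/-- By uniqueness the runs for different `S` share one final law. Its masses on successful outputs
add up to `1 - δ`, which leaves exactly `δ` for failure. -/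
theorem exists_exec_of_runs {n τ : ℕ} {P : Prog} {s : Config} {δ : ℝ} {μ : Finset (Fin n) → ℝ}
    (hδ : δ < 1) (hμ : ∀ S, 0 ≤ μ S) (hμ1 : ∑ S, μ S = 1)
    (h : ∀ S, Runs P s (outputIs S) (ENNReal.ofReal ((1 - δ) * μ S)) τ) :
    ∃ D : PMF Config, Exec P s D ∧ SamplesExactly (D.map (output n)) μ δ ∧
      ∀ s' ∈ D.support, s'.time ≤ τ := by
  classical
  obtain ⟨D, hD, -, hτ⟩ := h ∅
  have hsome : ∀ S, (D.map (output n)) (some S) = ENNReal.ofReal ((1 - δ) * μ S) := by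
    intro S
    obtain ⟨D', hD', hev, -⟩ := h S
    obtain rfl := hD.unique hD'
    rw [← hev, PMF.map_apply, PMF.ev]
    refine tsum_congr fun s' => ?_
    rw [outputIs]
    by_cases hs : output n s' = some S
    · rw [if_pos hs.symm, if_pos hs, mul_one]
    · rw [if_neg fun h => hs h.symm, if_neg hs, mul_zero]
  have hnn : ∀ S, 0 ≤ (1 - δ) * μ S := fun S => mul_nonneg (by linarith) (hμ S)
  have htot : ((D.map (output n)) none).toReal = δ := by
    have h1 := (D.map (output n)).tsum_coe
    rw [tsum_fintype, Fintype.sum_option] at h1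
    simp only [hsome] at h1
    rw [← ENNReal.ofReal_sum_of_nonneg fun S _ => hnn S, ← Finset.mul_sum, hμ1, mul_one] at h1
    have h2 := congrArg ENNReal.toReal h1
    rw [ENNReal.toReal_add (PMF.apply_ne_top _ _) ENNReal.ofReal_ne_top,
      ENNReal.toReal_ofReal (by linarith), ENNReal.toReal_one] at h2
    linarith
  refine ⟨D, hD, ⟨htot.le, fun S => ?_⟩, hτ⟩
  rw [htot, hsome, ENNReal.toReal_ofReal (hnn S)]

theorem kdppProb_nonneg {n : ℕ} {L : Matrix (Fin n) (Fin n) ℝ} (hL : L.PosSemidef) (k : ℕ)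
    (S : Finset (Fin n)) : 0 ≤ kdppProb L k S := by
  unfold kdppProb
  split_ifs
  · exact div_nonneg (dppWeight_nonneg hL S)
      (Finset.sum_nonneg fun S _ => dppWeight_nonneg hL S)
  · exact le_rfl

theorem sum_kdppProb {n : ℕ} {L : Matrix (Fin n) (Fin n) ℝ} {k : ℕ} (hZ : 0 < kdppZ L k) :
    ∑ S, kdppProb L k S = 1 := by
  unfold kdppProb
  rw [← Finset.sum_filter, ← Finset.sum_div]
  have : Finset.univ.filter (fun S : Finset (Fin n) => S.card = k) =
      (Finset.univ : Finset (Fin n)).powersetCard k := by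
    ext S
    simp [Finset.mem_powersetCard]
  rw [this]
  exact div_self hZ.ne'

theorem sum_kdppZ {n : ℕ} (L : Matrix (Fin n) (Fin n) ℝ) :
    ∑ k ∈ Finset.range (n + 1), kdppZ L k = dppZ L := by
  rw [dppZ, ← Finset.powerset_univ, Finset.sum_powerset, Finset.card_univ, Fintype.card_fin]
  rfl

theorem kdppZ_zero {n : ℕ} (L : Matrix (Fin n) (Fin n) ℝ) : kdppZ L 0 = 1 := by
  rw [kdppZ, Finset.powersetCard_zero, Finset.sum_singleton, dppWeight]
  exact Matrix.det_isEmpty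

theorem dppZ_pos {n : ℕ} {L : Matrix (Fin n) (Fin n) ℝ} (hL : L.PosSemidef) : 0 < dppZ L := by
  rw [← sum_kdppZ]
  refine lt_of_lt_of_le zero_lt_one ?_
  rw [← kdppZ_zero L]
  exact Finset.single_le_sum (f := fun k => kdppZ L k)
    (fun k _ => Finset.sum_nonneg fun S _ => dppWeight_nonneg hL S) (Finset.mem_range.2 n.succ_pos)

/-- Only the order `S.card` contributes. If its partition function vanishes, so does the weight of
`S`. -/
theorem sum_kdppZ_mul_kdppProb {n : ℕ} {L : Matrix (Fin n) (Fin n) ℝ} (hL : L.PosSemidef)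
    (S : Finset (Fin n)) :
    ∑ k ∈ Finset.range (n + 1), kdppZ L k / dppZ L * kdppProb L k S = dppProb L S := by
  have hcard : S.card ∈ Finset.range (n + 1) := by
    have := Finset.card_le_univ S
    rw [Fintype.card_fin] at this
    simpa [Nat.lt_succ_iff] using this
  rw [Finset.sum_eq_single_of_mem _ hcard fun k _ hk => by rw [kdppProb, if_neg hk.symm, mul_zero],
    kdppProb, if_pos rfl, dppProb]
  have hle : dppWeight L S ≤ kdppZ L S.card :=
    Finset.single_le_sum (f := fun S => dppWeight L S) (fun S _ => dppWeight_nonneg hL S)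
      (Finset.mem_powersetCard.2 ⟨Finset.subset_univ _, rfl⟩)
  rcases (dppWeight_nonneg hL S).eq_or_lt with h0 | h0
  · simp [← h0]
  · have : kdppZ L S.card ≠ 0 := by linarith
    field_simp

theorem dppProb_nonneg {n : ℕ} {L : Matrix (Fin n) (Fin n) ℝ} (hL : L.PosSemidef)
    (S : Finset (Fin n)) : 0 ≤ dppProb L S :=
  div_nonneg (dppWeight_nonneg hL S) (dppZ_pos hL).le

theorem sum_dppProb {n : ℕ} {L : Matrix (Fin n) (Fin n) ℝ} (hL : L.PosSemidef) :
    ∑ S, dppProb L S = 1 := by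
  unfold dppProb
  rw [← Finset.sum_div]
  exact div_self (dppZ_pos hL).ne'

/-! ### The programs -/

/-- Store the number of rows of the padded matrix. -/
def setSize : Prog := .wset 3 (cube 0) (.wadd (.wget 0 ![.lit 0]) (.lit 1))

/-- Sample from the DPP whose order is given in the input. -/
def kdppProgram : Prog := .seq (.wset 4 (cube 0) (.wget 0 ![.lit 1])) drawFixed

/-- Sample the order of the set. -/
def chooseOrder : Prog :=
  .seq (faddeevLeVerrier 2)
    (.seq (.rset 3 (cube 1)
        (.rget 2 ![.pid 0, lastIdx, lastIdx, .lit 0, .lit 0, .lit 0, .lit 0, .lit 0]))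
      (.seq (.wset 8 (cube 0) (.lit 1)) (.seq sample
        (.seq (.wset 16 (cube 1) (.wite (.wget 15 ![.pid 0]) (.pid 0) (.lit 0)))
          (.seq (wordSums 16 0) (.wset 4 (cube 0) (.wget 16 ![.lit 0])))))))

/-- Sample the order and then the set. -/
def dppProgram : Prog := .seq chooseOrder drawFixed

@[simp] theorem uniform_cube {d : ℕ} (h : d ≤ 12) : ∃ d' ≤ 12, cube d = cube d' := ⟨d, h, rfl⟩

theorem faddeevLeVerrier_uniform (a : ℕ) : (faddeevLeVerrier a).Uniform := by
  simp [faddeevLeVerrier, square, collapse, realSums, scan, Prog.set, Prog.Uniform]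

theorem sample_uniform : sample.Uniform := by
  simp [sample, weightSums, collectFirst, realSums, wordSums, scan, Prog.set, Prog.Uniform]

theorem drawFixed_uniform : drawFixed.Uniform := by
  simp [drawFixed, prepare, prepareBatch, prepareAttempts, completeSelection, report, attempt, propose,
    assess, update, realProds, wordSums, scan, Prog.set, Prog.Uniform, sample_uniform,
    faddeevLeVerrier_uniform]

theorem kdppProgram_uniform : kdppProgram.Uniform := by
  simp [kdppProgram, Prog.Uniform, drawFixed_uniform]

theorem dppProgram_uniform : dppProgram.Uniform := by
  simp [dppProgram, chooseOrder, wordSums, scan, Prog.set, Prog.Uniform, drawFixed_uniform,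
    sample_uniform, faddeevLeVerrier_uniform]

/-- The memory from which a set of given order is drawn. -/
structure Ready {n : ℕ} (L : Matrix (Fin n) (Fin n) ℝ) (δ : ℝ) (s : Config) : Prop where
  size : s.word 3 [] = n + 1
  selected : HoldsSet s 2 (∅ : Finset (Fin (n + 1)))
  matrix : HoldsMatrix s (padMatrix L)
  tolerance : s.real 1 [] = δ

section Main

variable {n k : ℕ} {L : Matrix (Fin n) (Fin n) ℝ} {δ : ℝ} {s : Config}

theorem Ready.congr (h : Ready L δ s) {s' : Config} (h2 : s'.word 2 = s.word 2)
    (h3 : s'.word 3 = s.word 3) (h0 : s'.real 0 = s.real 0) (h1 : s'.real 1 = s.real 1) :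
    Ready L δ s' where
  size := by rw [h3, h.size]
  selected := by rw [HoldsSet, h2]; exact h.selected
  matrix := by rw [HoldsMatrix, h0]; exact h.matrix
  tolerance := by rw [h1, h.tolerance]

/-- With nothing selected, the entries at the padded index are the partition functions of all
orders. One draw from these weights gives a singleton, and summing its indices turns it into a word.
-/
theorem Runs.chooseOrder_seq (hL : L.PosSemidef) (h : Ready L δ s) {P : Prog}
    {φ : Config → ENNReal} {τ : ℕ} (v : ℕ → ENNReal)
    (hP : ∀ k ≤ n, 0 < kdppZ L k → ∀ s', Ready L δ s' → s'.word 4 [] = k →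
      s'.time ≤ s.time + chooseOrder.timeBound (Nat.clog 2 (n + 1)) → Runs P s' φ (v k) τ) :
    Runs (.seq chooseOrder P) s φ
      (∑ k ∈ Finset.range (n + 1), ENNReal.ofReal (kdppZ L k / dppZ L) * v k) τ := by
  set t := Nat.clog 2 (n + 1) with ht
  have htb : chooseOrder.timeBound t = (faddeevLeVerrier 2).timeBound t +
    ((Prog.rset 3 (cube 1) (.rget 2 ![.pid 0, lastIdx, lastIdx, .lit 0, .lit 0, .lit 0, .lit 0,
        .lit 0])).timeBound t + ((Prog.wset 8 (cube 0) (.lit 1)).timeBound t + (sample.timeBound t +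
      ((Prog.wset 16 (cube 1) (.wite (.wget 15 ![.pid 0]) (.pid 0) (.lit 0))).timeBound t +
        ((wordSums 16 0).timeBound t + (Prog.wset 4 (cube 0) (.wget 16 ![.lit 0])).timeBound t))))) :=
    rfl
  refine Runs.assoc (Runs.det_seq (faddeevLeVerrier_spec (t := t) le_rfl h.size h.selected
    h.matrix).frame ?_)
  rintro s₁ ⟨f1, w1, r1⟩ t1
  have h1 : Ready L δ s₁ := h.congr (w1 2 rfl) (w1 3 rfl) (r1 0 rfl) (r1 1 rfl)
  set q : ℕ → ℝ := fun k => kdppZ L k with hq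
  have hq0 : ∀ k, 0 ≤ q k := fun k => Finset.sum_nonneg fun S _ => dppWeight_nonneg hL S
  refine Runs.assoc (Runs.det_seq (t := t) (Q := fun s₂ => (∀ i < n + 1, s₂.real 3 [i] = q i) ∧
    Ready L δ s₂) (Det.rset fun s₂ k1 k2 => ⟨fun i hi => ?_, h1.congr (by rw [k2]) (by rw [k2])
      (by rw [k1, Function.update_of_ne (by decide)])
      (by rw [k1, Function.update_of_ne (by decide)])⟩) ?_)
  · rw [k1, Function.update_self, if_pos (by rw [h1.size]; exact single_mem_box ⟨i, hi⟩)]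
    simp only [Exp.eval, eval_lastIdx h1.size, List.ofFn_succ, List.ofFn_zero, Matrix.cons_val_zero,
      Matrix.cons_val_succ, List.getD_cons_zero]
    have e := coeff_adjCoeff_last (dppWeight_padMatrix_last L) i ∅
    rw [Finset.card_empty, condZ_empty, kdppZ_padMatrix] at e
    exact (f1 ⟨i, hi⟩ (Fin.last n) (Fin.last n) 0).trans e
  rintro s₂ ⟨q2, h2⟩ t2
  refine Runs.assoc (Runs.det_seq (t := t) (Q := fun s₃ => (∀ i < n + 1, s₃.real 3 [i] = q i) ∧
    Ready L δ s₃ ∧ s₃.word 8 [] = 1) (Det.wset fun s₃ k1 k2 => ⟨by rw [k2]; exact q2, h2.congr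
      (by rw [k1, Function.update_of_ne (by decide)])
      (by rw [k1, Function.update_of_ne (by decide)]) (by rw [k2]) (by rw [k2]),
      by simp [k1, box, Exp.eval]⟩) ?_)
  rintro s₃ ⟨q3, h3, e8⟩ t3
  refine Runs.assoc ?_
  have hsum : ∑ i ∈ Finset.Ico 0 (n + 1), q i = dppZ L := by
    rw [← Finset.range_eq_Ico, sum_kdppZ]
  refine (Runs.sample_seq (t := t) le_rfl h3.size hq0 q3 (by rw [hsum]; exact dppZ_pos hL) e8
    (by omega) (fun R => v (∑ i ∈ R, (i : ℕ))) ?_).congr_value ?_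
  · intro R hR hRq s₄ u4 w4 r4 t4
    have h4 : Ready L δ s₄ := h3.congr (w4 2 rfl) (w4 3 rfl) (r4 0 rfl) (r4 1 rfl)
    -- The sampling rule guarantees only that `R` has at most one element. An empty `R` would be
    -- read as order zero, whose partition function is `1`, so the continuation is covered there
    -- too.
    have hR' : ∑ i ∈ R, (i : ℕ) ≤ n ∧ 0 < kdppZ L (∑ i ∈ R, (i : ℕ)) := by
      rcases Nat.le_one_iff_eq_zero_or_eq_one.1 hR with hc | hc
      · rw [Finset.card_eq_zero.1 hc, Finset.sum_empty, kdppZ_zero]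
        exact ⟨Nat.zero_le n, zero_lt_one⟩
      · obtain ⟨i, rfl⟩ := Finset.card_eq_one.1 hc
        rw [Finset.sum_singleton]
        exact ⟨Nat.lt_succ_iff.1 i.isLt, hRq i (Finset.mem_singleton_self i)⟩
    refine Runs.assoc (Runs.det_seq (t := t) (Q := fun s₅ => Ready L δ s₅ ∧
      ∀ i : Fin (n + 1), s₅.word 16 [(i : ℕ)] = if i ∈ R then (i : ℕ) else 0)
      (Det.wset fun s₅ k1 k2 => ⟨h4.congr (by rw [k1, Function.update_of_ne (by decide)])
        (by rw [k1, Function.update_of_ne (by decide)]) (by rw [k2]) (by rw [k2]), fun i => ?_⟩) ?_)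
    · rw [k1, Function.update_self, if_pos (by rw [h4.size]; exact single_mem_box i)]
      have e1 := u4 i
      simp only [Exp.eval, List.ofFn_succ, List.ofFn_zero, Matrix.cons_val_zero,
        List.getD_cons_zero, e1]
      by_cases c : i ∈ R <;> simp [c]
    rintro s₅ ⟨h5, c5⟩ t5
    refine Runs.assoc (Runs.det_seq (wordSums_spec (t := t) (d := 0) (by decide) (by decide) le_rfl
      h5.size).frame ?_)
    rintro s₆ ⟨c6, w6, r6⟩ t6
    have h6 : Ready L δ s₆ := h5.congr (w6 2 rfl) (w6 3 rfl) (r6 0 rfl) (r6 1 rfl)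
    have c6 : s₆.word 16 [0] = ∑ i ∈ R, (i : ℕ) := by
      have := c6 [] 0 rfl (by simp) n.succ_pos
      rw [List.nil_append, ← Finset.range_eq_Ico, Finset.sum_range] at this
      rw [this]
      simp only [List.nil_append, c5]
      rw [Finset.sum_ite_mem, Finset.univ_inter]
    refine Runs.det_seq (t := t) (Q := fun s₇ => Ready L δ s₇ ∧ s₇.word 4 [] = ∑ i ∈ R, (i : ℕ))
      (Det.wset fun s₇ k1 k2 => ⟨h6.congr (by rw [k1, Function.update_of_ne (by decide)])
        (by rw [k1, Function.update_of_ne (by decide)]) (by rw [k2]) (by rw [k2]),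
        by simp [k1, box, Exp.eval, c6]⟩) ?_
    rintro s₇ ⟨h7, e4⟩ t7
    exact hP _ hR'.1 hR'.2 s₇ h7 e4 (by omega)
  · rw [Finset.sum_range]
    refine Fintype.sum_equiv (Equiv.funUnique (Fin 1) (Fin (n + 1))) _ _ fun x => ?_
    rw [hsum]
    simp [hq]

theorem exists_setSize (n k : ℕ) (L : Matrix (Fin n) (Fin n) ℝ) (δ : ℝ) :
    ∃ s, Exec setSize (inputConfig n k L δ) (PMF.pure s) ∧ Ready L δ s ∧
      s.word 0 [1] = k ∧ s.time = setSize.timeBound 0 ∧ s.procs = 1 := by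
  refine ⟨_, .wset 3 (cube 0) _ _, ⟨?_, ?_, ?_, ?_⟩, ?_, ?_, ?_⟩
  · simp [Config.setWord, Config.chargePar, Config.charge, procBox, cube, box, Exp.eval, inputConfig]
  · intro i
    simp [Config.setWord, Config.chargePar, Config.charge, inputConfig]
  · intro i j
    simp [Config.setWord, Config.chargePar, Config.charge, inputConfig, padMatrix]
  · simp [Config.setWord, Config.chargePar, Config.charge, inputConfig]
  · simp [Config.setWord, Config.chargePar, Config.charge, inputConfig]
  · simp [Config.setWord, Config.chargePar, Config.charge, inputConfig, setSize, Prog.timeBound]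
  · simp [Config.setWord, Config.chargePar, Config.charge, inputConfig, procBox, cube, box]

theorem exists_exec_setSize {P : Prog} (hP : P.Uniform) (h3 : P.keepsWord 3 = true) {τ : ℕ}
    {μ : Finset (Fin n) → ℝ} (hδ : δ < 1) (hμ : ∀ S, 0 ≤ μ S) (hμ1 : ∑ S, μ S = 1)
    (h : ∀ s, Ready L δ s → s.word 0 [1] = k → s.time = setSize.timeBound 0 →
      ∀ S, Runs P s (outputIs S) (ENNReal.ofReal ((1 - δ) * μ S)) τ) :
    ∃ D : PMF Config, Exec (.seq setSize P) (inputConfig n k L δ) D ∧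
      SamplesExactly (D.map (output n)) μ δ ∧
      ∀ s' ∈ D.support, s'.time ≤ τ ∧ s'.procs ≤ (n + 1) ^ 12 := by
  obtain ⟨s, hs, hr, hk, ht, hp⟩ := exists_setSize n k L δ
  obtain ⟨D, hD, hsamp, hτ⟩ := exists_exec_of_runs hδ hμ hμ1 (h s hr hk ht)
  refine ⟨D, hs.pure_seq hD, hsamp, fun s' hs' => ⟨hτ s' hs', ?_⟩⟩
  have := hD.procs_le (Nat.succ_pos n) hP h3 hr.size s' hs'
  rw [hp, max_eq_right (Nat.one_le_pow _ _ n.succ_pos)] at this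
  exact this

theorem kdppProgram_keepsWord : kdppProgram.keepsWord 3 = true := rfl

theorem dppProgram_keepsWord : dppProgram.keepsWord 3 = true := rfl

theorem procs_bound (hn : 1 ≤ n) {p C : ℕ} (hp : p ≤ (n + 1) ^ 12) (hC : 2 ^ 12 ≤ C) {c : ℕ}
    (hc : 12 ≤ c) {x : ℝ} (hx : 0 ≤ x) : (p : ℝ) ≤ C * (n : ℝ) ^ c * (1 + x) := by
  have hn1 : (1 : ℝ) ≤ n := by exact_mod_cast hn
  have h1 : (p : ℝ) ≤ ((n : ℝ) + 1) ^ 12 := by exact_mod_cast hp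
  have h2 : ((n : ℝ) + 1) ^ 12 ≤ (2 * n) ^ 12 := by gcongr; linarith
  have h3 : (n : ℝ) ^ 12 ≤ (n : ℝ) ^ c := pow_le_pow_right₀ hn1 hc
  have h4 : ((2 : ℝ) ^ 12) ≤ C := by exact_mod_cast hC
  calc (p : ℝ) ≤ 2 ^ 12 * (n : ℝ) ^ 12 := by rw [← mul_pow]; exact h1.trans h2
    _ ≤ C * (n : ℝ) ^ c := by gcongr
    _ ≤ C * (n : ℝ) ^ c * (1 + x) := le_mul_of_one_le_right (by positivity) (by linarith)

end Main

theorem theorem1p4 :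
    (∃ (P : Prog) (C c : ℕ), ∀ (n k : ℕ) (L : Matrix (Fin n) (Fin n) ℝ) (δ : ℝ),
      1 ≤ k → k ≤ n → L.PosSemidef → 0 < kdppZ L k → 0 < δ → δ < 1 →
      ∃ D : PMF Config, Exec P (inputConfig n k L δ) D ∧
        SamplesExactly (D.map (output n)) (kdppProb L k) δ ∧
        ∀ s ∈ D.support,
          (s.time : ℝ) ≤ C * √(k : ℝ) * (1 + Real.log (n / δ)) ^ c ∧
          (s.procs : ℝ) ≤ C * (n : ℝ) ^ c * (1 + Real.log (k / δ))) ∧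
    (∃ (P : Prog) (C c : ℕ), ∀ (n : ℕ) (L : Matrix (Fin n) (Fin n) ℝ) (δ : ℝ),
      1 ≤ n → L.PosSemidef → 0 < δ → δ < 1 →
      ∃ D : PMF Config, Exec P (inputConfig n 0 L δ) D ∧
        SamplesExactly (D.map (output n)) (dppProb L) δ ∧
        ∀ s ∈ D.support,
          (s.time : ℝ) ≤ C * √(n : ℝ) * (1 + Real.log (n / δ)) ^ c ∧
          (s.procs : ℝ) ≤ C * (n : ℝ) ^ c * (1 + Real.log (n / δ))) := by
  obtain ⟨C, c, hC⟩ := exists_drawTime_le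
  have hlog : ∀ (k : ℕ) (δ : ℝ), 1 ≤ k → 0 < δ → δ < 1 → 0 ≤ Real.log (k / δ) := by
    intro k δ hk hδ hδ1
    refine Real.log_nonneg ?_
    rw [le_div_iff₀ hδ]
    have : (1 : ℝ) ≤ k := by exact_mod_cast hk
    linarith
  constructor
  · set u := setSize.timeBound 0 + (Prog.wset 4 (cube 0) (.wget 0 ![.lit 1])).timeBound 0 with hu
    refine ⟨.seq setSize kdppProgram, u + C + 2 ^ 12, c + 12, ?_⟩
    intro n k L δ hk hkn hL hZ hδ hδ1
    obtain ⟨D, h1, h2, h3⟩ := exists_exec_setSize (k := k) (L := L) (δ := δ)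
      (τ := u + drawTime n k δ) kdppProgram_uniform kdppProgram_keepsWord hδ1 (kdppProb_nonneg hL k)
      (sum_kdppProb hZ) (by
        intro s hs h0 ht S
        refine Runs.det_seq (t := 0) (Q := fun s' => Ready L δ s' ∧ s'.word 4 [] = k)
          (Det.wset fun s' k1 k2 => ⟨hs.congr (by rw [k1, Function.update_of_ne (by decide)])
            (by rw [k1, Function.update_of_ne (by decide)]) (by rw [k2]) (by rw [k2]),
            by simp [k1, box, Exp.eval, h0]⟩) ?_
        rintro s' ⟨hs', h4⟩ ht'
        refine (drawFixed_runs hL hkn hZ hδ hδ1 hs'.size h4 hs'.selected hs'.matrix hs'.tolerance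
          S).mono ?_
        omega)
    refine ⟨D, h1, h2, fun s hs => ⟨?_, ?_⟩⟩
    · obtain ⟨h4, -⟩ := h3 s hs
      have h5 := hC n k δ (hk.trans hkn) hkn hδ hδ1
      rw [max_eq_left hk] at h5
      have hΛ : 1 ≤ 1 + Real.log (n / δ) := by linarith [hlog n δ (hk.trans hkn) hδ hδ1]
      have hσ : 1 ≤ √(k : ℝ) := by rw [Real.one_le_sqrt]; exact_mod_cast hk
      set Λ := 1 + Real.log (n / δ)
      have h6 : (s.time : ℝ) ≤ u + drawTime n k δ := by exact_mod_cast h4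
      have h7 : Λ ^ c ≤ Λ ^ (c + 12) := pow_le_pow_right₀ hΛ (by omega)
      have h8 : (1 : ℝ) ≤ √(k : ℝ) * Λ ^ (c + 12) :=
        one_le_mul_of_one_le_of_one_le hσ (one_le_pow₀ hΛ)
      have h9 : C * √(k : ℝ) * Λ ^ c ≤ C * √(k : ℝ) * Λ ^ (c + 12) := by gcongr
      have hu0 : (0 : ℝ) ≤ u := Nat.cast_nonneg u
      push_cast
      nlinarith
    · exact procs_bound (hk.trans hkn) (h3 s hs).2 (by omega) (by omega) (hlog k δ hk hδ hδ1)
  · obtain ⟨K, d, hK⟩ := chooseOrder.exists_timeBound_le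
    set u := setSize.timeBound 0 with hu
    refine ⟨.seq setSize dppProgram, u + K * 3 ^ d + C + 2 ^ 12, c + d + 12, ?_⟩
    intro n L δ hn hL hδ hδ1
    set t := Nat.clog 2 (n + 1) with ht
    -- The order is random and the time bound must hold on every run, so the largest drawing time
    -- over all orders is taken.
    set M := (Finset.range (n + 1)).sup fun k => drawTime n k δ with hM
    obtain ⟨D, h1, h2, h3⟩ := exists_exec_setSize (k := 0) (L := L) (δ := δ)
      (τ := u + chooseOrder.timeBound t + M) dppProgram_uniform dppProgram_keepsWord hδ1
      (dppProb_nonneg hL) (sum_dppProb hL) (by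
        intro s hs _ hst S
        refine (Runs.chooseOrder_seq hL hs
          (fun k => ENNReal.ofReal ((1 - δ) * kdppProb L k S)) ?_).congr_value ?_
        · intro k hk hZ s' hs' h4 ht'
          refine (drawFixed_runs hL hk hZ hδ hδ1 hs'.size h4 hs'.selected hs'.matrix hs'.tolerance
            S).mono ?_
          have : drawTime n k δ ≤ M :=
            Finset.le_sup (f := fun k => drawTime n k δ) (Finset.mem_range.2 (Nat.lt_succ_of_le hk))
          rw [← ht] at ht'
          omega
        -- Every order fails with the same probability `δ`, so the factor `1 - δ` leaves the mixture
        -- and conditioning on success does not bias the order.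
        · have hnn : ∀ k, 0 ≤ kdppZ L k / dppZ L := fun k => div_nonneg
            (Finset.sum_nonneg fun S _ => dppWeight_nonneg hL S) (dppZ_pos hL).le
          have hnn' : ∀ k, 0 ≤ (1 - δ) * kdppProb L k S := fun k =>
            mul_nonneg (by linarith) (kdppProb_nonneg hL k S)
          simp only [← ENNReal.ofReal_mul (hnn _)]
          rw [← ENNReal.ofReal_sum_of_nonneg fun k _ => mul_nonneg (hnn k) (hnn' k),
            ← sum_kdppZ_mul_kdppProb hL S, Finset.mul_sum]
          congr 1
          exact Finset.sum_congr rfl fun k _ => by ring)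
    refine ⟨D, h1, h2, fun s hs => ⟨?_, ?_⟩⟩
    · obtain ⟨h4, -⟩ := h3 s hs
      have hn1 : (1 : ℝ) ≤ n := by exact_mod_cast hn
      have hx : (n : ℝ) ≤ n / δ := by rw [le_div_iff₀ hδ]; nlinarith
      have hΛ : 1 ≤ 1 + Real.log (n / δ) := by linarith [hlog n δ hn hδ hδ1]
      have hσ : 1 ≤ √(n : ℝ) := by rw [Real.one_le_sqrt]; exact hn1
      have hlam : (t : ℝ) ≤ 2 * (1 + Real.log (n / δ)) := by
        refine clog_le_two_mul_log (hn1.trans hx) ?_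
        push_cast
        linarith
      have h5 : (M : ℝ) ≤ C * √(n : ℝ) * (1 + Real.log (n / δ)) ^ c := by
        obtain ⟨k, hk, hkM⟩ := Finset.exists_mem_eq_sup (Finset.range (n + 1)) ⟨0, by simp⟩
          fun k => drawTime n k δ
        have hk := Nat.lt_succ_iff.1 (Finset.mem_range.1 hk)
        rw [hM, hkM]
        refine (hC n k δ hn hk hδ hδ1).trans ?_
        have : √((max k 1 : ℕ) : ℝ) ≤ √(n : ℝ) :=
          Real.sqrt_le_sqrt (by exact_mod_cast max_le hk hn)
        gcongr
      set Λ := 1 + Real.log (n / δ)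
      have h6 : (s.time : ℝ) ≤ u + chooseOrder.timeBound t + M := by exact_mod_cast h4
      have h7 : (chooseOrder.timeBound t : ℝ) ≤ K * 3 ^ d * Λ ^ d := by
        have h8 : (chooseOrder.timeBound t : ℝ) ≤ K * ((t : ℝ) + 1) ^ d := by exact_mod_cast hK t
        have h9 : ((t : ℝ) + 1) ^ d ≤ (3 * Λ) ^ d := by gcongr; linarith
        rw [mul_assoc, ← mul_pow]
        exact h8.trans (by gcongr)
      have hΛ0 : 0 ≤ Λ := by linarith
      have h10 : Λ ^ d ≤ √(n : ℝ) * Λ ^ (c + d + 12) :=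
        (pow_le_pow_right₀ hΛ (by omega)).trans (le_mul_of_one_le_left (by positivity) hσ)
      have h11 : Λ ^ c ≤ Λ ^ (c + d + 12) := pow_le_pow_right₀ hΛ (by omega)
      have h12 : (1 : ℝ) ≤ √(n : ℝ) * Λ ^ (c + d + 12) :=
        one_le_mul_of_one_le_of_one_le hσ (one_le_pow₀ hΛ)
      have h13 : C * √(n : ℝ) * Λ ^ c ≤ C * √(n : ℝ) * Λ ^ (c + d + 12) := by gcongr
      have h14 : K * 3 ^ d * Λ ^ d ≤ K * 3 ^ d * (√(n : ℝ) * Λ ^ (c + d + 12)) := by gcongr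
      have h15 : (u : ℝ) ≤ u * (√(n : ℝ) * Λ ^ (c + d + 12)) :=
        le_mul_of_one_le_right (Nat.cast_nonneg u) h12
      push_cast
      have h16 : (0 : ℝ) ≤ 2 ^ 12 * (√(n : ℝ) * Λ ^ (c + d + 12)) := by positivity
      nlinarith
    · exact procs_bound hn (h3 s hs).2 (by omega) (by omega) (hlog n δ hn hδ hδ1)
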